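/- Let $\omega = e^{2\pi i/3}$, $\Lambda = \omega\mathbb Z\oplus\mathbb Z\subset\mathbb C=\mathbb R^2$, $\Lambda^* = \frac{4\pi i}{\sqrt 3}\Lambda$ and $\langle z,w\rangle = \operatorname{Re}(z\bar w)$. Let $K\in\mathbb C$ satisfy $\omega K\equiv K\not\equiv 0 \bmod \Lambda^*$ (for example $K=\frac43\pi$), and let $U:\mathbb C\to\mathbb C$ be a real analytic function such that $$U(z+\gamma)=e^{i\langle\gamma,K\rangle}U(z)\ (\gamma\in\Lambda),\qquad U(\omega z)=\omega U(z),\qquad \overline{U(\bar z)}=-U(-z).$$ For $\alpha\in\mathbb C$ put, with $D_{\bar z}=\frac1i\partial_{\bar z}$, $$H(\alpha)=\begin{pmatrix}0&D(\alpha)^*\\ D(\alpha)&0\end{pmatrix},\qquad D(\alpha)=\begin{pmatrix}2D_{\bar z}&\alpha U(z)\\ \alpha U(-z)&2D_{\bar z}\end{pmatrix}.$$ For $\gamma\in\Lambda$ let $\mathscr L_\gamma u(z)=\operatorname{diag}(e^{i\langle\gamma,K\rangle},e^{-i\langle\gamma,K\rangle})\,u(z+\gamma)$ on $\mathbb C^2$-valued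 functions, extended diagonally to $\mathbb C^4=\mathbb C^2\times\mathbb C^2$. For $k\in\mathbb C$ let $L^2_k$ be the space of $u\in L^2_{\rm loc}(\mathbb C;\mathbb C^4)$ with $\mathscr L_\gamma u=e^{i\langle k,\gamma\rangle}u$ for all $\gamma\in\Lambda$, and let $H^1_k=L^2_k\cap H^1_{\rm loc}$. Let $E_1(\alpha,k)$ be the smallest nonnegative eigenvalue of $H(\alpha)$ on $L^2_k$ with domain $H^1_k$, that is, the smallest $E\ge 0$ for which $H(\alpha)u=Eu$ has a nonzero solution $u\in H^1_k$. Then, for every $\alpha\in\mathbb C$, $E_1(\alpha,k)$ is well defined for every $k\in\mathbb C$ (the smallest nonnegative eigenvalue exists), and $$\exists\,k\notin\{-K,K\}+\Lambda^*\quad E_1(\alpha,k)=0\qquad\Longleftrightarrow\qquad\forall\,k\in\mathbb C\quad E_1(\alpha,k)=0 .$$ In other words, the zero energy band is flat if and only if the lowest Bloch eigenvalue vanishes at some $k$ outside the lattice $\{-K,K\}+\Lambda^*$ of conic points. -/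

import Mathlib

open MeasureTheory
open scoped ContDiff ComplexConjugate Pointwise Matrix

noncomputable section

namespace ChiralTBG

/-- The cube root of unity `ω = e^{2πi/3}`. -/
def ω₃ : ℂ := Complex.exp (2 * Real.pi * Complex.I / 3)

/-- The real pairing `⟨z, w⟩ = Re (z w̄)` on `ℂ = ℝ²`. -/
def pair (z w : ℂ) : ℝ := (z * conj w).re

/-- The lattice `Λ = ωℤ ⊕ ℤ`. -/
def lattice : Set ℂ := {γ | ∃ m n : ℤ, γ = (m : ℂ) * ω₃ + (n : ℂ)}

/-- The dual lattice `Λ* = (4πi/√3) Λ`. -/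
def dualLattice : Set ℂ :=
  (fun γ : ℂ => 4 * (Real.pi : ℂ) * Complex.I / (Real.sqrt 3 : ℂ) * γ) '' lattice

/-- `K` is a nonzero fixed point of multiplication by `ω` on `ℂ / Λ*`:
`ωK ≡ K ≢ 0 mod Λ*`.  (For instance `K = 4π/3`.) -/
structure IsDiracPoint (K : ℂ) : Prop where
  rot : ω₃ * K - K ∈ dualLattice
  ne_zero : K ∉ dualLattice

/-- The assumptions on the potential `U`: it is real analytic on `ℂ = ℝ²` and has the translation,
rotation and reflection symmetries of the chiral model. -/
structure IsChiralPotential (K : ℂ) (U : ℂ → ℂ) : Prop where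
  analytic : ∀ z, AnalyticAt ℝ U z
  translation : ∀ γ ∈ lattice, ∀ z, U (z + γ) = Complex.exp (Complex.I * pair γ K) * U z
  rotation : ∀ z, U (ω₃ * z) = ω₃ * U z
  reflection : ∀ z, conj (U (conj z)) = -U (-z)

/-- `ℂ²`.  (Only its topology matters below, so the choice of norm is immaterial.) -/
abbrev C2 : Type := Fin 2 → ℂ

/-- `ℂ⁴ = ℂ² × ℂ²`. -/
abbrev C4 : Type := C2 × C2

/-- `u ∈ L²_loc(ℂ; F)`. -/
def MemL2loc {F : Type*} [NormedAddCommGroup F] (u : ℂ → F) : Prop :=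
  ∀ s : Set ℂ, IsCompact s → MemLp u 2 (volume.restrict s)

/-- `g` is the weak (distributional) derivative of `f` in the direction `v ∈ ℂ = ℝ²`.
Used only for `f`, `g` in `L²_loc`, where both integrals converge. -/
def IsWeakDeriv {F : Type*} [NormedAddCommGroup F] [NormedSpace ℝ F]
    (v : ℂ) (f g : ℂ → F) : Prop :=
  ∀ φ : ℂ → ℝ, ContDiff ℝ ∞ φ → HasCompactSupport φ →
    ∫ z, (fderiv ℝ φ z v) • f z = -∫ z, φ z • g z

/-- The matrix `diag (e^{i⟨γ, K⟩}, e^{-i⟨γ, K⟩})`. -/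
def twist (K γ : ℂ) : Matrix (Fin 2) (Fin 2) ℂ :=
  Matrix.diagonal ![Complex.exp (Complex.I * pair γ K), Complex.exp (-(Complex.I * pair γ K))]

/-- The twisted translations `𝓛_γ u (z) = diag (e^{i⟨γ, K⟩}, e^{-i⟨γ, K⟩}) u (z + γ)`, extended
diagonally to `ℂ⁴ = ℂ² × ℂ²`. -/
def transl (K γ : ℂ) (u : ℂ → C4) : ℂ → C4 := fun z =>
  (twist K γ *ᵥ (u (z + γ)).1, twist K γ *ᵥ (u (z + γ)).2)

/-- `u ∈ L²_k(ℂ/Λ; ℂ⁴)`: `u ∈ L²_loc` and `𝓛_γ u = e^{i⟨k, γ⟩} u` (a.e.) for all `γ ∈ Λ`. -/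
structure MemL2k (K k : ℂ) (u : ℂ → C4) : Prop where
  memL2loc : MemL2loc u
  floquet : ∀ γ ∈ lattice,
    transl K γ u =ᵐ[volume] fun z => Complex.exp (Complex.I * pair k γ) • u z

/-- `u ∈ H¹_k(ℂ/Λ; ℂ⁴)`, with weak partial derivatives `ux = ∂u/∂x` and `uy = ∂u/∂y`
(for `z = x + iy`), which belong to `L²_loc`. -/
structure MemH1kWith (K k : ℂ) (u ux uy : ℂ → C4) : Prop where
  memL2k : MemL2k K k u
  memL2loc_x : MemL2loc ux
  memL2loc_y : MemL2loc uy
  deriv_x : IsWeakDeriv 1 u ux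
  deriv_y : IsWeakDeriv Complex.I u uy

/-- The zeroth order part of `D(α)`. -/
def potMatrix (U : ℂ → ℂ) (α z : ℂ) : Matrix (Fin 2) (Fin 2) ℂ :=
  !![0, α * U z; α * U (-z), 0]

/-- The value at `z` of `D(α) v`, where `D(α) = 2 D_z̄ + potMatrix` and
`2 D_z̄ = (2/i) ∂_z̄ = (1/i)(∂_x + i ∂_y)`, in terms of the values `v`, `vx`, `vy` at `z` of the
function and of its two partial derivatives. -/
def opD (U : ℂ → ℂ) (α z : ℂ) (v vx vy : C2) : C2 :=
  (-Complex.I) • (vx + Complex.I • vy) + potMatrix U α z *ᵥ v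

/-- The value at `z` of `D(α)* v`, where `D(α)* = 2 D_z + potMatrixᴴ` is the formal adjoint of
`D(α)` and `2 D_z = (2/i) ∂_z = (1/i)(∂_x - i ∂_y)`. -/
def opDstar (U : ℂ → ℂ) (α z : ℂ) (v vx vy : C2) : C2 :=
  (-Complex.I) • (vx - Complex.I • vy) + (potMatrix U α z)ᴴ *ᵥ v

/-- The value at `z` of `H(α) u`, where `H(α)` is the block operator with rows `(0, D(α)*)` and
`(D(α), 0)`. -/
def opH (U : ℂ → ℂ) (α z : ℂ) (u ux uy : C4) : C4 :=
  (opDstar U α z u.2 ux.2 uy.2, opD U α z u.1 ux.1 uy.1)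

/-- `E` is an eigenvalue of `H(α)` on `L²_k(ℂ/Λ; ℂ⁴)` with domain `H¹_k(ℂ/Λ; ℂ⁴)`: there is a
nonzero `u ∈ H¹_k` with `H(α) u = E u`. -/
def IsBlochEigenvalue (K : ℂ) (U : ℂ → ℂ) (α k : ℂ) (E : ℝ) : Prop :=
  ∃ u ux uy : ℂ → C4, MemH1kWith K k u ux uy ∧ ¬ (u =ᵐ[volume] 0) ∧
    ∀ᵐ z ∂volume, opH U α z (u z) (ux z) (uy z) = (E : ℂ) • u z

/-- The lowest Bloch eigenvalue `E₁(α, k)`: the smallest nonnegative eigenvalue of `H(α)` on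
`L²_k(ℂ/Λ; ℂ⁴)`. -/
def E₁ (K : ℂ) (U : ℂ → ℂ) (α k : ℂ) : ℝ :=
  sInf {E : ℝ | 0 ≤ E ∧ IsBlochEigenvalue K U α k E}

end ChiralTBG

end

/-! On the Fourier side `D(α)` in the sector `k` becomes `diag (lam K k) + V` on `ℓ²`, where `|lam|`
tends to infinity and `V` (`potOp`) is a bounded convolution. The dictionary is
`isBlochEigenvalue_iff`: weak solutions yield square summable Fourier coefficients, and conversely
square summable solutions of the mode system decay rapidly (`decay_bootstrap`), hence come from
classical solutions.

Existence of `E₁` (`exists_isLeast_modeEigenvalue`): either `D(α)` has a kernel and the minimum is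
`0`, or `D(α)` has a compact inverse `A`. In the latter case the positive eigenvalues `E` are those
for which `E⁻²` is an eigenvalue of `A A*`, so the smallest one is `‖A‖⁻¹`.

Flatness. A zero mode at `k` gives a kernel element of `D(α)` at `k`, or of `D(α)*` at `k`; complex
conjugation turns the latter into a kernel element of `D(α)` at `-k` (`exists_kernel_neg`), and
`{-K, K} + Λ*` is symmetric. So let `D(α) u = 0` in a sector `k` outside that set.

A second solution is always available: for every `α` there is `v ≠ 0` with `D(α) v = 0` in the
sector `K` (`exists_kernel_at_K`). At `α = 0` it is a constant in the first component; it persists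
because rotation by `ω` separates it from the possible obstruction to solving the equation.

Since the potential matrix is off-diagonal, the Wronskian `u₀ v₁ - u₁ v₀` is holomorphic. Its
multiplier belongs to `k + K ∉ Λ*`, so it vanishes by Liouville, and `v` is pointwise parallel to
`u` where `u ≠ 0`. If `u` had no zero, then `v = f u` with `f` entire of multiplier `K - k ∉ Λ*`,
which forces `f = 0` and `v = 0`. Hence `u` vanishes at some `z₀` (`IsKernelState.exists_zero`).

There `∂_z̄ u` vanishes as well, so `u` may be multiplied by a quotient of theta functions with at
most simple poles on `z₀ + Λ` and an arbitrary unitary multiplier (`exists_meromorphic_multiplier`).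
The product is continuous, solves the equation off a countable set, and therefore lies in the kernel
in an arbitrary sector `k'` (`IsKernelState.exists_kernel`). -/

noncomputable section

namespace ChiralTBG

/-! ### Diagonal operators on `ℓ²` and their compactness. -/

section DiagonalOperators

variable {ι : Type*}

/-- The Hilbert space `ℓ²(ι)`. -/
abbrev Ell2 (ι : Type*) : Type _ := lp (fun _ : ι => ℂ) 2

lemma ell2_memℓp_iff (f : ι → ℂ) : Memℓp f 2 ↔ Summable fun i => ‖f i‖ ^ 2 := by
  rw [memℓp_gen_iff (by norm_num)]
  simp

lemma ell2_summable (x : Ell2 ι) : Summable fun i => ‖x i‖ ^ 2 :=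
  (ell2_memℓp_iff _).1 (lp.memℓp x)

lemma ell2_norm_sq (x : Ell2 ι) : ‖x‖ ^ 2 = ∑' i, ‖x i‖ ^ 2 := by
  have := lp.norm_rpow_eq_tsum (p := 2) (by norm_num) x
  simpa using this

lemma memℓp_diag {d : ι → ℂ} {C : ℝ} (hd : ∀ i, ‖d i‖ ≤ C) (x : Ell2 ι) :
    Memℓp (fun i => d i * x i) 2 := by
  rw [ell2_memℓp_iff]
  refine Summable.of_nonneg_of_le (fun i => by positivity) (fun i => ?_)
    ((ell2_summable x).mul_left (C ^ 2))
  rw [norm_mul, mul_pow]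
  gcongr
  exact hd i

/-- The diagonal operator with bounded entries `d`. -/
def diagOp (d : ι → ℂ) (C : ℝ) (hC : 0 ≤ C) (hd : ∀ i, ‖d i‖ ≤ C) : Ell2 ι →L[ℂ] Ell2 ι :=
  LinearMap.mkContinuous
    { toFun := fun x => ⟨fun i => d i * x i, memℓp_diag hd x⟩
      map_add' := fun x y => by ext i; exact mul_add _ _ _
      map_smul' := fun c x => by ext i; simp [mul_left_comm] } C (fun x => by
        refine lp.norm_le_of_tsum_le (by norm_num) (by positivity) ?_
        have h1 := ell2_norm_sq x
        have h2 := memℓp_diag hd x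
        rw [ell2_memℓp_iff] at h2
        simp only [ENNReal.toReal_ofNat, Real.rpow_ofNat, LinearMap.coe_mk, AddHom.coe_mk]
        rw [mul_pow, h1, ← tsum_mul_left]
        refine h2.tsum_le_tsum (fun i => ?_) ((ell2_summable x).mul_left (C ^ 2))
        rw [norm_mul, mul_pow]
        gcongr
        exact hd i)

@[simp] lemma diagOp_apply (d : ι → ℂ) (C : ℝ) (hC : 0 ≤ C) (hd : ∀ i, ‖d i‖ ≤ C)
    (x : Ell2 ι) (i : ι) : diagOp d C hC hd x i = d i * x i := rfl

lemma norm_diagOp_le (d : ι → ℂ) (C : ℝ) (hC : 0 ≤ C) (hd : ∀ i, ‖d i‖ ≤ C) :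
    ‖diagOp d C hC hd‖ ≤ C := LinearMap.mkContinuous_norm_le _ hC _

lemma ell2_inner (x y : Ell2 ι) : inner ℂ x y = ∑' i, conj (x i) * y i := by
  rw [lp.inner_eq_tsum]
  simp [mul_comm]

lemma adjoint_diagOp_apply (d : ι → ℂ) (C : ℝ) (hC : 0 ≤ C) (hd : ∀ i, ‖d i‖ ≤ C)
    (x : Ell2 ι) (i : ι) :
    ContinuousLinearMap.adjoint (diagOp d C hC hd) x i = conj (d i) * x i := by
  have h : ContinuousLinearMap.adjoint (diagOp d C hC hd) =
      diagOp (fun i => conj (d i)) C hC (by simpa using hd) := by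
    symm
    rw [ContinuousLinearMap.eq_adjoint_iff]
    intro x y
    simp only [ell2_inner, diagOp_apply]
    congr 1; ext i
    simp; ring
  rw [h]; rfl

lemma isCompactOperator_finsetSum {X : Type*} [NormedAddCommGroup X] [NormedSpace ℂ X]
    {κ : Type*} (s : Finset κ) (f : κ → X →L[ℂ] X)
    (h : ∀ k ∈ s, IsCompactOperator (f k)) : IsCompactOperator (∑ k ∈ s, f k : X →L[ℂ] X) := by
  classical
  induction s using Finset.induction_on with
  | empty => simpa using isCompactOperator_zero
  | insert a s ha ih =>
    rw [Finset.sum_insert ha]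
    exact (h a (by simp)).add (ih fun k hk => h k (by simp [hk]))

/-- A diagonal operator whose entries tend to zero is compact. -/
lemma isCompactOperator_diagOp (d : ι → ℂ) (C : ℝ) (hC : 0 ≤ C) (hd : ∀ i, ‖d i‖ ≤ C)
    (h0 : Filter.Tendsto d Filter.cofinite (nhds 0)) : IsCompactOperator (diagOp d C hC hd) := by
  classical
  -- Compact operators are norm closed, so approximation suffices: truncating to the finitely many
  -- entries with `‖d i‖ ≥ ε / 2` has finite rank and leaves a diagonal error of norm at most `ε /
  -- 2`.
  have key : diagOp d C hC hd ∈ closure {f : Ell2 ι →L[ℂ] Ell2 ι | IsCompactOperator f} := by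
    rw [Metric.mem_closure_iff]
    intro ε hε
    have hfin : {i | ¬ ‖d i‖ < ε / 2}.Finite := by
      have := h0.norm.eventually (gt_mem_nhds (show ‖(0 : ℂ)‖ < ε / 2 by simpa using hε))
      exact this
    set s := hfin.toFinset with hs
    refine ⟨∑ i ∈ s, d i • ((lp.singleContinuousLinearMap ℂ (fun _ : ι => ℂ) 2 i).comp
      (lp.evalCLM ℂ (fun _ : ι => ℂ) 2 i)), ?_, ?_⟩
    · refine isCompactOperator_finsetSum (X := Ell2 ι) s _ fun k _ => ?_
      have h1 : IsCompactOperator (lp.evalCLM ℂ (fun _ : ι => ℂ) 2 k) :=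
        isCompactOperator_of_locallyCompactSpace_dom _
      exact (h1.clm_comp (lp.singleContinuousLinearMap ℂ (fun _ : ι => ℂ) 2 k)).smul (d k)
    · rw [dist_eq_norm]
      set d' : ι → ℂ := fun i => if i ∈ s then 0 else d i with hd'
      have hb : ∀ i, ‖d' i‖ ≤ ε / 2 := by
        intro i
        by_cases hi : i ∈ s
        · simp [d', hi]; positivity
        · simp only [d', hi, if_false]
          simp [hs] at hi
          exact hi.le
      have : diagOp d C hC hd - ∑ i ∈ s, d i • ((lp.singleContinuousLinearMap ℂ
          (fun _ : ι => ℂ) 2 i).comp (lp.evalCLM ℂ (fun _ : ι => ℂ) 2 i)) =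
          diagOp d' (ε / 2) (by positivity) hb := by
        ext x i
        simp only [_root_.sub_apply, _root_.sum_apply, lp.coeFn_sub,
          Pi.sub_apply, diagOp_apply, lp.coeFn_sum, Finset.sum_apply]
        have : ∀ j, ((d j • ((lp.singleContinuousLinearMap ℂ
          (fun _ : ι => ℂ) 2 j).comp (lp.evalCLM ℂ (fun _ : ι => ℂ) 2 j))) x) i
            = if i = j then d j * x j else 0 := by
          intro j
          simp [lp.evalCLM, lp.evalₗ, lp.single_apply, Pi.single_apply]
          split_ifs with h
          · subst h; rfl
          · rfl
        simp only [this, d']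
        by_cases hi : i ∈ s <;> simp [hi]
      rw [this]
      exact (norm_diagOp_le _ _ _ _).trans_lt (by linarith)
  have := isClosed_setOfPred_isCompactOperator (σ₁₂ := RingHom.id ℂ) (M₁ := Ell2 ι) (M₂ := Ell2 ι)
  exact this.closure_subset key

end DiagonalOperators

/-! ### Spectral theory of `diag lam + V` with `|lam| → ∞`. -/

section AbstractModes

variable {ι : Type*}

/-- `E` is an eigenvalue of the off-diagonal operator with blocks `diag lam + V` and
`(diag lam + V)*` on `ℓ²(ι) ⊕ ℓ²(ι)`. -/
def IsModeEigenvalue (lam : ι → ℂ) (V : Ell2 ι →L[ℂ] Ell2 ι) (E : ℝ) : Prop :=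
  ∃ x y : Ell2 ι, (x ≠ 0 ∨ y ≠ 0) ∧ (∀ i, lam i * x i + V x i = E * y i) ∧
    ∀ i, conj (lam i) * y i + ContinuousLinearMap.adjoint V y i = E * x i

/-- The Fredholm alternative at the nonzero spectral value `-1`. The operator `B` in the second case
is the two-sided inverse of `1 + T`. -/
lemma bijective_one_add_of_compact {X : Type*} [NormedAddCommGroup X] [NormedSpace ℂ X]
    [CompleteSpace X] {T : X →L[ℂ] X} (hT : IsCompactOperator T) :
    (∃ f, f ≠ 0 ∧ T f = -f) ∨
      ∃ B : X →L[ℂ] X, (∀ f, B (f + T f) = f) ∧ ∀ f, B f + T (B f) = f := by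
  rcases hT.hasEigenvalue_or_mem_resolventSet (μ := -1) (by simp) with h | h
  · left
    obtain ⟨f, hf⟩ := h.exists_hasEigenvector
    exact ⟨f, hf.2, by simpa using hf.apply_eq_smul⟩
  · right
    rw [spectrum.mem_resolventSet_iff] at h
    obtain ⟨u, hu⟩ := h
    have h1 : ∀ f, (u : X →L[ℂ] X) f = -(f + T f) := by
      intro f; rw [hu]; simp [Algebra.algebraMap_eq_smul_one]; abel
    have h2 : ∀ f, (↑u⁻¹ : X →L[ℂ] X) ((u : X →L[ℂ] X) f) = f := by
      intro f
      rw [← mul_apply_eq_comp, u.inv_mul]; rfl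
    have h3 : ∀ f, (u : X →L[ℂ] X) ((↑u⁻¹ : X →L[ℂ] X) f) = f := by
      intro f
      rw [← mul_apply_eq_comp, u.mul_inv]; rfl
    refine ⟨-(↑u⁻¹ : X →L[ℂ] X), fun f => ?_, fun f => ?_⟩
    · have := h2 f
      rw [h1, map_neg] at this
      simpa using this
    · have := h3 f
      rw [h1] at this
      simp only [_root_.neg_apply, map_neg]
      rw [← neg_add, this]

/-- If `diag lam` has compact resolvent and `diag lam + V` is not injective, zero is an
eigenvalue; otherwise `diag lam + V` has a compact two-sided inverse. -/
lemma exists_compact_inverse (lam : ι → ℂ)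
    (hlam : Filter.Tendsto (fun i => ‖lam i‖) Filter.cofinite Filter.atTop)
    (V : Ell2 ι →L[ℂ] Ell2 ι) :
    (∃ x : Ell2 ι, x ≠ 0 ∧ ∀ i, lam i * x i + V x i = 0) ∨
    ∃ A : Ell2 ι →L[ℂ] Ell2 ι, IsCompactOperator A ∧
      (∀ x f, (∀ i, lam i * x i + V x i = f i) ↔ x = A f) ∧
      ∀ y g, (∀ i, conj (lam i) * y i + ContinuousLinearMap.adjoint V y i = g i) ↔
        y = ContinuousLinearMap.adjoint A g := by
  classical
  -- Replacing the zero entries of `lam` by `1` makes the diagonal invertible with compact inverse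
  -- `G`. With `W = V + diag (lam - μ)` one has `diag lam + V = (1 + W G) diag μ`, so everything
  -- reduces to the alternative for `1 + W G`.
  set μ : ι → ℂ := fun i => if lam i = 0 then 1 else lam i with hμ
  have hμ0 : ∀ i, μ i ≠ 0 := by intro i; simp only [μ]; split_ifs with h <;> simp [h]
  have hlim : Filter.Tendsto (fun i => (μ i)⁻¹) Filter.cofinite (nhds 0) := by
    rw [tendsto_zero_iff_norm_tendsto_zero]
    simp only [norm_inv]
    refine Filter.Tendsto.inv_tendsto_atTop (hlam.congr' ?_)
    filter_upwards [hlam.eventually_gt_atTop 0] with i hi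
    have : lam i ≠ 0 := by simpa using hi
    simp [μ, this]
  obtain ⟨C, hC⟩ : ∃ C, ∀ i, ‖(μ i)⁻¹‖ ≤ C := by
    have hfin : {i | ¬ ‖(μ i)⁻¹‖ < 1}.Finite :=
      hlim.norm.eventually (gt_mem_nhds (show ‖(0 : ℂ)‖ < 1 by simp))
    obtain ⟨C, hC⟩ := (hfin.image fun i => ‖(μ i)⁻¹‖).bddAbove
    refine ⟨max C 1, fun i => ?_⟩
    by_cases h : ‖(μ i)⁻¹‖ < 1
    · exact h.le.trans (le_max_right _ _)
    · exact (hC ⟨i, h, rfl⟩).trans (le_max_left _ _)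
  set C' := max C 0
  have hC' : ∀ i, ‖(μ i)⁻¹‖ ≤ C' := fun i => (hC i).trans (le_max_left _ _)
  set G := diagOp (fun i => (μ i)⁻¹) C' (le_max_right _ _) hC' with hG
  have hGc : IsCompactOperator G := isCompactOperator_diagOp _ _ _ _ hlim
  have hP : ∀ i, ‖lam i - μ i‖ ≤ 1 := by
    intro i; simp only [μ]; split_ifs with h <;> simp [h]
  set P := diagOp (fun i => lam i - μ i) 1 zero_le_one hP with hPdef
  set W := V + P with hW
  have hWx : ∀ x i, W x i = V x i + (lam i - μ i) * x i := fun x i => rfl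
  have hWadj : ∀ x i, ContinuousLinearMap.adjoint W x i =
      ContinuousLinearMap.adjoint V x i + conj (lam i - μ i) * x i := by
    intro x i
    rw [hW, map_add]
    change ContinuousLinearMap.adjoint V x i + ContinuousLinearMap.adjoint P x i = _
    rw [hPdef, adjoint_diagOp_apply]
  have hGx : ∀ x i, G x i = (μ i)⁻¹ * x i := fun x i => rfl
  have hTc : IsCompactOperator (W.comp G) := hGc.clm_comp W
  rcases bijective_one_add_of_compact hTc with ⟨h, h0, hh⟩ | ⟨B, hB1, hB2⟩
  · left
    have hcoord : ∀ i, W (G h) i = - h i := by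
      intro i
      have := congrArg (fun z : Ell2 ι => z i) hh
      simpa using this
    refine ⟨G h, ?_, fun i => ?_⟩
    · intro hz
      apply h0
      have : W (G h) = -h := hh
      rw [hz, map_zero] at this
      simpa using this.symm
    · have h1 := hcoord i
      rw [hWx] at h1
      have h2 := hGx h i
      have h3 : μ i * G h i = h i := by rw [h2]; field_simp [hμ0 i]
      linear_combination h1 + h3
  · right
    refine ⟨G.comp B, hGc.comp_clm B, fun x f => ?_, fun y g => ?_⟩
    · constructor
      · intro hx
        set h : Ell2 ι := f - W x with hh
        have hGh : G h = x := by
          ext i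
          rw [hGx, hh]
          simp only [lp.coeFn_sub, Pi.sub_apply]
          rw [hWx, ← hx i]
          field_simp [hμ0 i]
          ring
        have : h + W (G h) = f := by rw [hGh, hh]; abel
        have h2 := hB1 h
        simp only [ContinuousLinearMap.comp_apply] at h2
        rw [this] at h2
        simp [h2, hGh]
      · rintro rfl i
        have h1 := congrArg (fun z : Ell2 ι => z i) (hB2 f)
        simp only [ContinuousLinearMap.comp_apply, lp.coeFn_add, Pi.add_apply, hWx, hGx] at h1 ⊢
        rw [← h1]
        field_simp [hμ0 i]
        ring
    · have e1 : (G.comp B).adjoint g = B.adjoint (G.adjoint g) := by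
        rw [ContinuousLinearMap.adjoint_comp]; rfl
      have key1 : ∀ y, B.adjoint (y + G.adjoint (W.adjoint y)) = y := by
        intro y
        have : (ContinuousLinearMap.id ℂ (Ell2 ι) + W.comp G).comp B =
            ContinuousLinearMap.id ℂ _ := by
          ext1 f; exact hB2 f
        have h2 := congrArg ContinuousLinearMap.adjoint this
        rw [ContinuousLinearMap.adjoint_comp, map_add, ContinuousLinearMap.adjoint_comp,
          ContinuousLinearMap.adjoint_id] at h2
        exact congrArg (fun T : Ell2 ι →L[ℂ] Ell2 ι => T y) h2
      have key2 : ∀ y, B.adjoint y + G.adjoint (W.adjoint (B.adjoint y)) = y := by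
        intro y
        have : B.comp (ContinuousLinearMap.id ℂ (Ell2 ι) + W.comp G) =
            ContinuousLinearMap.id ℂ _ := by
          ext1 f; exact hB1 f
        have h2 := congrArg ContinuousLinearMap.adjoint this
        rw [ContinuousLinearMap.adjoint_comp, map_add, ContinuousLinearMap.adjoint_comp,
          ContinuousLinearMap.adjoint_id] at h2
        exact congrArg (fun T : Ell2 ι →L[ℂ] Ell2 ι => T y) h2
      have hGa : ∀ y i, G.adjoint y i = conj ((μ i)⁻¹) * y i := fun y i => by
        rw [hG, adjoint_diagOp_apply]
      have hc0 : ∀ i, conj (μ i) ≠ 0 := fun i => by simpa using hμ0 i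
      -- Dividing by `conj μ` turns the adjoint equation into `(1 + G* W*) y = G* g`. This is solved
      -- by `B*`, and `B* G* = A*`.
      have equiv : (∀ i, conj (lam i) * y i + V.adjoint y i = g i) ↔
          y + G.adjoint (W.adjoint y) = G.adjoint g := by
        constructor
        · intro hy
          ext i
          simp only [lp.coeFn_add, Pi.add_apply, hGa, hWadj, ← hy i, map_inv₀, map_sub]
          field_simp [hc0 i]
          ring
        · intro hy i
          have h1 := congrArg (fun z : Ell2 ι => z i) hy
          simp only [lp.coeFn_add, Pi.add_apply, hGa, hWadj, map_inv₀, map_sub] at h1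
          have hci := hc0 i
          field_simp at h1
          linear_combination h1
      rw [equiv, e1]
      constructor
      · intro hy; rw [← hy, key1]
      · rintro rfl; exact key2 _

/-- The smallest nonnegative eigenvalue of the block operator exists. -/
theorem exists_isLeast_modeEigenvalue [Nonempty ι] (lam : ι → ℂ)
    (hlam : Filter.Tendsto (fun i => ‖lam i‖) Filter.cofinite Filter.atTop)
    (V : Ell2 ι →L[ℂ] Ell2 ι) :
    ∃ E, IsLeast {E : ℝ | 0 ≤ E ∧ IsModeEigenvalue lam V E} E := by
  classical
  rcases exists_compact_inverse lam hlam V with ⟨x, hx0, hx⟩ | ⟨A, hAc, hA1, hA2⟩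
  · exact ⟨0, ⟨le_rfl, x, 0, Or.inl hx0, by simpa using hx, by simp⟩, fun E hE => hE.1⟩
  have hAinj : ∀ f, A f = 0 → f = 0 := by
    intro f hf
    have := (hA1 0 f).2 hf.symm
    ext i
    simpa using (this i).symm
  obtain ⟨i₀⟩ := ‹Nonempty ι›
  have hApos : 0 < ‖A‖ := by
    rw [norm_pos_iff]
    intro h
    have := hAinj (lp.single 2 i₀ 1) (by rw [h]; rfl)
    have := congrArg (fun z : Ell2 ι => z i₀) this
    simp at this
  have : Nontrivial (Ell2 ι) := ⟨lp.single 2 i₀ 1, 0, fun h => by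
    have := congrArg (fun z : Ell2 ι => z i₀) h
    simp at this⟩
  -- The eigenvalue equations read `x = E A y`, `y = E A* x`, so `E⁻²` is an eigenvalue of `A A*`;
  -- the least `E` comes from the top of the spectrum of `A A*`.
  set T := A.comp A.adjoint with hT
  have hTc : IsCompactOperator T := hAc.comp_clm _
  have hTsa : IsSelfAdjoint T := by
    rw [ContinuousLinearMap.isSelfAdjoint_iff', hT, ContinuousLinearMap.adjoint_comp,
      ContinuousLinearMap.adjoint_adjoint]
  have hTn : ‖T‖ = ‖A‖ ^ 2 := by
    have := CStarRing.norm_self_mul_star (x := A)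
    rw [sq, ← this]; rfl
  -- Some spectral value attains the spectral radius, which is `‖T‖` by self-adjointness; being
  -- nonzero, it is an eigenvalue by compactness.
  obtain ⟨μ, hμs, hμn⟩ := spectrum.exists_nnnorm_eq_spectralRadius T
  rw [T.spectralRadius_eq_nnnorm hTsa] at hμn
  have hμnorm : ‖μ‖ = ‖A‖ ^ 2 := by
    rw [← hTn]; exact congrArg NNReal.toReal (by exact_mod_cast hμn)
  have hμ0 : μ ≠ 0 := by
    rw [← norm_pos_iff, hμnorm]; positivity
  obtain ⟨x, hx⟩ := ((hTc.hasEigenvalue_iff_mem_spectrum hμ0).2 hμs).exists_hasEigenvector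
  have hTx : A (A.adjoint x) = μ • x := hx.apply_eq_smul
  have hx0 : x ≠ 0 := hx.2
  -- So far only the modulus of `μ` is known; positivity of `A A*` excludes every other phase.
  have hμeq : μ = ((‖A‖ ^ 2 : ℝ) : ℂ) := by
    have h1 : inner ℂ x (A (A.adjoint x)) = ((‖A.adjoint x‖ ^ 2 : ℝ) : ℂ) := by
      rw [← ContinuousLinearMap.adjoint_inner_left, inner_self_eq_norm_sq_to_K]; simp
    rw [hTx, inner_smul_right, inner_self_eq_norm_sq_to_K] at h1
    have hxn : (‖x‖ : ℂ) ≠ 0 := by simpa using hx0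
    have h2 : μ = ((‖A.adjoint x‖ ^ 2 / ‖x‖ ^ 2 : ℝ) : ℂ) := by
      have hxn' : (‖x‖ : ℂ) ^ 2 ≠ 0 := pow_ne_zero _ hxn
      push_cast
      rw [eq_div_iff hxn']
      push_cast at h1
      exact h1
    rw [h2] at hμnorm ⊢
    rw [Complex.norm_real, Real.norm_of_nonneg (by positivity)] at hμnorm
    rw [hμnorm]
  refine ⟨‖A‖⁻¹, ⟨by positivity, x, (‖A‖⁻¹ : ℂ) • A.adjoint x, Or.inl hx0, ?_, ?_⟩, ?_⟩
  · have h1 : x = A (((‖A‖⁻¹ : ℂ) * ‖A‖⁻¹) • A.adjoint x) := by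
      rw [map_smul, hTx, hμeq, smul_smul]
      have : (‖A‖ : ℂ) ≠ 0 := by exact_mod_cast hApos.ne'
      push_cast
      field_simp
      simp
    have h2 := (hA1 _ _).2 h1
    intro i
    rw [h2 i]
    simp [mul_assoc]
  · have h1 : (‖A‖⁻¹ : ℂ) • A.adjoint x = A.adjoint ((‖A‖⁻¹ : ℂ) • x) := by simp
    have h2 := (hA2 _ _).2 h1
    intro i
    rw [h2 i]
    simp
  · rintro E ⟨hE0, u, w, huw, h1, h2⟩
    have e1 : u = A ((E : ℂ) • w) := (hA1 _ _).1 (fun i => by rw [h1 i, lp.coeFn_smul]; rfl)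
    have e2 : w = A.adjoint ((E : ℂ) • u) := (hA2 _ _).1 (fun i => by rw [h2 i, lp.coeFn_smul]; rfl)
    have n1 : ‖u‖ ≤ ‖A‖ * E * ‖w‖ := by
      calc ‖u‖ = ‖A ((E : ℂ) • w)‖ := by rw [← e1]
        _ ≤ ‖A‖ * ‖(E : ℂ) • w‖ := A.le_opNorm _
        _ = _ := by rw [norm_smul, Complex.norm_real, Real.norm_of_nonneg hE0, mul_assoc]
    have n2 : ‖w‖ ≤ ‖A‖ * E * ‖u‖ := by
      calc ‖w‖ = ‖A.adjoint ((E : ℂ) • u)‖ := by rw [← e2]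
        _ ≤ ‖A.adjoint‖ * ‖(E : ℂ) • u‖ := (A.adjoint).le_opNorm _
        _ = _ := by
          rw [norm_smul, Complex.norm_real, Real.norm_of_nonneg hE0, mul_assoc,
            LinearIsometryEquiv.norm_map]
    -- Adding the two norm bounds gives an inequality that a nonzero pair satisfies only if `‖A‖ * E
    -- ≥ 1`.
    have hs : ‖u‖ + ‖w‖ ≤ ‖A‖ * E * (‖u‖ + ‖w‖) := by nlinarith
    have hpos : 0 < ‖u‖ + ‖w‖ := by
      rcases huw with h | h
      · have := norm_pos_iff.2 h; positivity
      · have := norm_pos_iff.2 h; positivity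
    have : 1 ≤ ‖A‖ * E := by
      by_contra hlt
      push Not at hlt
      nlinarith
    rw [inv_le_iff_one_le_mul₀ hApos]
    linarith

/-- Existence of a kernel element on a symmetry class on which `diag lam` has index one. -/
theorem exists_kernel_of_symmetry_class (lam : ι → ℂ)
    (hlam : Filter.Tendsto (fun i => ‖lam i‖) Filter.cofinite Filter.atTop)
    (V : Ell2 ι →L[ℂ] Ell2 ι) (i₀ : ι) (h0 : ∀ i, lam i = 0 ↔ i = i₀)
    (Y : Submodule ℂ (Ell2 ι)) (hYc : IsClosed (Y : Set (Ell2 ι)))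
    (hY0 : ∀ f ∈ Y, f i₀ = 0) (hYe : ∀ e : Ell2 ι, (∀ i, lam i * e i = 0) → V e ∈ Y)
    (hYV : ∀ f ∈ Y, ∀ x : Ell2 ι, (∀ i, x i = (lam i)⁻¹ * f i) → V x ∈ Y) :
    ∃ x : Ell2 ι, x ≠ 0 ∧ ∀ i, lam i * x i + V x i = 0 := by
  classical
  have hlim : Filter.Tendsto (fun i => (lam i)⁻¹) Filter.cofinite (nhds 0) := by
    rw [tendsto_zero_iff_norm_tendsto_zero]
    simp only [norm_inv]
    exact hlam.inv_tendsto_atTop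
  obtain ⟨C, hC0, hC⟩ : ∃ C, 0 ≤ C ∧ ∀ i, ‖(lam i)⁻¹‖ ≤ C := by
    have hfin : {i | ¬ ‖(lam i)⁻¹‖ < 1}.Finite :=
      hlim.norm.eventually (gt_mem_nhds (show ‖(0 : ℂ)‖ < 1 by simp))
    obtain ⟨C, hC⟩ := (hfin.image fun i => ‖(lam i)⁻¹‖).bddAbove
    refine ⟨max C 1, by positivity, fun i => ?_⟩
    by_cases h : ‖(lam i)⁻¹‖ < 1
    · exact h.le.trans (le_max_right _ _)
    · exact (hC ⟨i, h, rfl⟩).trans (le_max_left _ _)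
  -- At `i₀` the convention `0⁻¹ = 0` applies. Elements of `Y` vanish there, so `G` is still a right
  -- inverse of `diag lam` on `Y`.
  set G := diagOp (fun i => (lam i)⁻¹) C hC0 hC with hG
  have hGc : IsCompactOperator G := isCompactOperator_diagOp _ _ _ _ hlim
  have hinv : ∀ f ∈ Y, V (G f) ∈ Y := fun f hf => hYV f hf (G f) fun i => rfl
  have hGl : ∀ f ∈ Y, ∀ i, lam i * G f i = f i := by
    intro f hf i
    rw [hG, diagOp_apply]
    by_cases hi : i = i₀
    · subst hi; simp [hY0 f hf, (h0 i).2 rfl]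
    · have := mt (h0 i).1 hi; field_simp
  set e : Ell2 ι := lp.single 2 i₀ 1 with he
  have hle : ∀ i, lam i * e i = 0 := by
    intro i
    by_cases hi : i = i₀
    · simp [(h0 i).2 hi]
    · simp [he, lp.single_apply, hi]
  have : CompleteSpace Y := hYc.completeSpace_coe
  let T : Y →L[ℂ] Y := ((V.comp G).comp Y.subtypeL).codRestrict Y fun f => hinv f f.2
  have hT : ∀ f : Y, (T f : Ell2 ι) = V (G f) := fun f => rfl
  have hTc : IsCompactOperator T := by
    have h1 : IsCompactOperator ((V.comp G).comp Y.subtypeL) :=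
      (hGc.clm_comp V).comp_clm _
    exact h1.codRestrict (V := Y) (fun f => hinv f f.2) hYc
  -- Both alternatives produce a kernel element. If `f + V G f = 0` with `f ≠ 0`, take `G f`.
  -- Otherwise solve `f + V G f = -V e` and take `e + G f`, which is nonzero because its entry at
  -- `i₀` is `1`.
  rcases bijective_one_add_of_compact hTc with ⟨f, hf0, hf⟩ | ⟨B, -, hB⟩
  · have hVG : V (G f) = -(f : Ell2 ι) := by rw [← hT, hf]; rfl
    refine ⟨G f, fun hz => hf0 ?_, fun i => ?_⟩
    · rw [hz, map_zero] at hVG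
      ext1
      simpa using hVG.symm
    · rw [hGl f f.2, hVG]; simp
  · set g : Y := ⟨-V e, Y.neg_mem (hYe e hle)⟩
    set f := B g
    have hf : (f : Ell2 ι) + V (G f) = - V e := congrArg Subtype.val (hB g)
    refine ⟨e + G f, fun hz => ?_, fun i => ?_⟩
    · have := congrArg (fun z : Ell2 ι => z i₀) hz
      simp [he, hG, hY0 f f.2] at this
    · have h1 := congrArg (fun z : Ell2 ι => z i) hf
      simp only [lp.coeFn_add, Pi.add_apply, map_add, lp.coeFn_neg, Pi.neg_apply] at h1 ⊢
      linear_combination h1 + hle i + hGl f f.2 i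

end AbstractModes

/-! ### Absolutely convergent sums of permutation operators. -/

section ShiftOperators

variable {ι M : Type*}

lemma memℓp_comp_perm (σ : Equiv.Perm ι) (x : Ell2 ι) : Memℓp (fun i => x (σ i)) 2 := by
  rw [ell2_memℓp_iff]
  exact (σ.summable_iff (f := fun i => ‖x i‖ ^ 2)).2 (ell2_summable x)

/-- Composition with a permutation of the index set. -/
def permOp (σ : Equiv.Perm ι) : Ell2 ι →L[ℂ] Ell2 ι :=
  LinearMap.mkContinuous
    { toFun := fun x => ⟨fun i => x (σ i), memℓp_comp_perm σ x⟩
      map_add' := fun x y => rfl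
      map_smul' := fun c x => rfl } 1 (fun x => by
        refine lp.norm_le_of_tsum_le (by norm_num) (by positivity) ?_
        simp only [ENNReal.toReal_ofNat, Real.rpow_ofNat, one_mul]
        rw [ell2_norm_sq]
        exact (σ.tsum_eq fun i => ‖x i‖ ^ 2).le)

@[simp] lemma permOp_apply (σ : Equiv.Perm ι) (x : Ell2 ι) (i : ι) :
    permOp σ x i = x (σ i) := rfl

lemma norm_permOp_le (σ : Equiv.Perm ι) : ‖permOp σ‖ ≤ 1 :=
  LinearMap.mkContinuous_norm_le _ zero_le_one _

lemma adjoint_permOp (σ : Equiv.Perm ι) :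
    ContinuousLinearMap.adjoint (permOp σ) = permOp σ.symm := by
  symm
  rw [ContinuousLinearMap.eq_adjoint_iff]
  intro x y
  simp only [ell2_inner, permOp_apply]
  rw [← σ.tsum_eq]
  simp

/-- The operator `∑ₘ c(m) x ∘ σ(m)`. -/
def shiftOp (c : M → ℂ) (σ : M → Equiv.Perm ι) : Ell2 ι →L[ℂ] Ell2 ι :=
  ∑' m, c m • permOp (σ m)

lemma summable_shiftOp {c : M → ℂ} (hc : Summable fun m => ‖c m‖) (σ : M → Equiv.Perm ι) :
    Summable fun m => c m • permOp (σ m) := by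
  refine Summable.of_norm_bounded hc fun m => ?_
  rw [norm_smul]
  exact mul_le_of_le_one_right (norm_nonneg _) (norm_permOp_le _)

lemma shiftOp_apply {c : M → ℂ} (hc : Summable fun m => ‖c m‖) (σ : M → Equiv.Perm ι)
    (x : Ell2 ι) (i : ι) : shiftOp c σ x i = ∑' m, c m * x (σ m i) := by
  have h := (summable_shiftOp hc σ).hasSum
  have h1 := ((lp.evalCLM ℂ (fun _ : ι => ℂ) 2 i).comp
    (ContinuousLinearMap.apply ℂ (Ell2 ι) x)).hasSum h
  exact h1.tsum_eq.symm

/-- The adjoint of a permutation operator is its inverse, which for an involution is itself; only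
the coefficients get conjugated. -/
lemma adjoint_shiftOp {c : M → ℂ} (hc : Summable fun m => ‖c m‖) (σ : M → Equiv.Perm ι)
    (hσ : ∀ m i, σ m (σ m i) = i) :
    ContinuousLinearMap.adjoint (shiftOp c σ) = shiftOp (fun m => conj (c m)) σ := by
  have h := (summable_shiftOp hc σ).hasSum
  have h1 := (ContinuousLinearMap.adjoint (𝕜 := ℂ) (E := Ell2 ι)
    (F := Ell2 ι)).toContinuousLinearEquiv.toContinuousLinearMap.hasSum h
  rw [shiftOp, shiftOp]
  refine h1.tsum_eq.symm.trans ?_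
  refine tsum_congr fun m => ?_
  have h2 : (σ m).symm = σ m := by
    ext i; rw [Equiv.symm_apply_eq, hσ]
  change ContinuousLinearMap.adjoint (c m • permOp (σ m)) = _
  rw [map_smulₛₗ, adjoint_permOp, h2]

end ShiftOperators

/-! ### Bootstrapping decay of Fourier coefficients. -/

section Decay

/-- Elliptic regularity on the Fourier side: bounded solutions of a diagonally dominated
convolution inequality decay faster than every power of the weight. -/
lemma decay_bootstrap {ι M : Type*} (wt : ι → ℝ) (hwt : ∀ i, 0 ≤ wt i) (wtM : M → ℝ)
    (hwtM : ∀ m, 0 ≤ wtM m)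
    (a L : ι → ℝ) (ha : ∀ i, 0 ≤ a i) {B : ℝ} (hB : ∀ i, a i ≤ B)
    {C : ℝ} (hC : 0 ≤ C) (hL : ∀ i, wt i ≤ C * (1 + L i))
    (c : M → ℝ) (hc0 : ∀ m, 0 ≤ c m) (hc : ∀ s : ℕ, Summable fun m => c m * wtM m ^ s)
    (σ : M → ι → ι) (hσ : ∀ m i, wt i ≤ wtM m * wt (σ m i)) {E : ℝ} (hE : 0 ≤ E)
    (h : ∀ i, L i * a i ≤ E * a i + ∑' m, c m * a (σ m i)) (s : ℕ) :
    ∃ B, ∀ i, wt i ^ s * a i ≤ B := by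
  have hcs : ∀ i, Summable fun m => c m * a (σ m i) := fun i => by
    refine Summable.of_nonneg_of_le (fun m => mul_nonneg (hc0 m) (ha _)) (fun m => ?_)
      (((hc 0).mul_right B))
    have := mul_le_mul_of_nonneg_left (hB (σ m i)) (hc0 m)
    simpa using this
  induction s with
  | zero => exact ⟨B, by simpa using hB⟩
  | succ s ih =>
    obtain ⟨D, hD⟩ := ih
    refine ⟨C * ((1 + E) * D + ∑' m, c m * wtM m ^ s * D), fun i => ?_⟩
    -- Carrying the weight across a shift costs `wtM m ^ s`, absorbed by the decay of `c`. The
    -- additional power of the weight is gained from `wt ≤ C (1 + L)`.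
    have h1 : wt i ^ s * ∑' m, c m * a (σ m i) ≤ ∑' m, c m * wtM m ^ s * D := by
      rw [← tsum_mul_left]
      refine ((hcs i).mul_left _).tsum_le_tsum (fun m => ?_) ((hc s).mul_right D)
      calc wt i ^ s * (c m * a (σ m i))
          ≤ (wtM m * wt (σ m i)) ^ s * (c m * a (σ m i)) :=
            mul_le_mul_of_nonneg_right (pow_le_pow_left₀ (hwt i) (hσ m i) s)
              (mul_nonneg (hc0 m) (ha _))
        _ = c m * wtM m ^ s * (wt (σ m i) ^ s * a (σ m i)) := by ring
        _ ≤ c m * wtM m ^ s * D :=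
            mul_le_mul_of_nonneg_left (hD _) (mul_nonneg (hc0 m) (pow_nonneg (hwtM m) s))
    have hws : 0 ≤ wt i ^ s := pow_nonneg (hwt i) s
    have h2 : wt i ^ s * (L i * a i) ≤ wt i ^ s * (E * a i + ∑' m, c m * a (σ m i)) :=
      mul_le_mul_of_nonneg_left (h i) hws
    have h3 : E * (wt i ^ s * a i) ≤ E * D := mul_le_mul_of_nonneg_left (hD i) hE
    calc wt i ^ (s + 1) * a i = wt i * (wt i ^ s * a i) := by ring
      _ ≤ C * (1 + L i) * (wt i ^ s * a i) :=
          mul_le_mul_of_nonneg_right (hL i) (mul_nonneg hws (ha i))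
      _ = C * (wt i ^ s * a i + wt i ^ s * (L i * a i)) := by ring
      _ ≤ _ := by
          refine mul_le_mul_of_nonneg_left ?_ hC
          have := hD i
          nlinarith

end Decay

/-! ### The lattice, its dual, plane waves and weights. -/

section Geometry

lemma omega_eq : ω₃ = -1 / 2 + (Real.sqrt 3 / 2 : ℝ) * Complex.I := by
  have h : (2 * Real.pi * Complex.I / 3 : ℂ) = ((2 * Real.pi / 3 : ℝ) : ℂ) * Complex.I := by
    push_cast; ring
  have h3 : 2 * Real.pi / 3 = Real.pi - Real.pi / 3 := by ring
  rw [ω₃, h, Complex.exp_mul_I, ← Complex.ofReal_cos, ← Complex.ofReal_sin, h3, Real.cos_pi_sub,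
    Real.sin_pi_sub, Real.cos_pi_div_three, Real.sin_pi_div_three]
  push_cast; ring

lemma omega_re : ω₃.re = -1 / 2 := by rw [omega_eq]; simp

lemma omega_im : ω₃.im = Real.sqrt 3 / 2 := by rw [omega_eq]; simp

lemma omega_sq : ω₃ ^ 2 = -1 - ω₃ := by
  have h3 : ((Real.sqrt 3 : ℝ) : ℂ) ^ 2 = 3 := by
    rw [← Complex.ofReal_pow, Real.sq_sqrt (by norm_num)]; simp
  rw [omega_eq]
  push_cast
  linear_combination (1 / 4 : ℂ) * (Complex.I ^ 2) * h3 + (3 / 4 : ℂ) * Complex.I_sq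

lemma omega_ne_zero : ω₃ ≠ 0 := Complex.exp_ne_zero _

lemma omega_ne_one : ω₃ ≠ 1 := by
  intro h
  have := congrArg Complex.re h
  rw [omega_re] at this
  norm_num at this

lemma conj_omega_mul : conj ω₃ * ω₃ = 1 := by
  have := Real.sq_sqrt (show (0 : ℝ) ≤ 3 by norm_num)
  have h : Complex.normSq ω₃ = 1 := by
    rw [Complex.normSq_apply, omega_re, omega_im]
    linarith
  rw [mul_comm, Complex.mul_conj, h, Complex.ofReal_one]

lemma pair_eq (z w : ℂ) : pair z w = z.re * w.re + z.im * w.im := by simp [pair]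

lemma pair_comm (z w : ℂ) : pair z w = pair w z := by simp [pair_eq]; ring
lemma pair_add_left (a b c : ℂ) : pair (a + b) c = pair a c + pair b c := by
  simp [pair_eq]; ring
lemma pair_add_right (a b c : ℂ) : pair a (b + c) = pair a b + pair a c := by
  simp [pair_eq]; ring
lemma pair_neg_left (a b : ℂ) : pair (-a) b = -pair a b := by simp [pair_eq]; ring
lemma pair_neg_right (a b : ℂ) : pair a (-b) = -pair a b := by simp [pair_eq]; ring
lemma pair_zero_left (a : ℂ) : pair 0 a = 0 := by simp [pair_eq]

lemma pair_omega_mul (p z : ℂ) : pair (ω₃ * p) (ω₃ * z) = pair p z := by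
  have h : ω₃ * p * conj (ω₃ * z) = p * conj z := by
    rw [map_mul]; linear_combination (p * conj z) * conj_omega_mul
  rw [pair, h, pair]

/-- The plane wave `z ↦ e^{i⟨p, z⟩}`. -/
def ch (p z : ℂ) : ℂ := Complex.exp (Complex.I * pair p z)

lemma ch_add_left (p q z : ℂ) : ch (p + q) z = ch p z * ch q z := by
  rw [ch, ch, ch, ← Complex.exp_add, pair_add_left]; push_cast; ring_nf
lemma ch_add_right (p z w : ℂ) : ch p (z + w) = ch p z * ch p w := by
  rw [ch, ch, ch, ← Complex.exp_add, pair_add_right]; push_cast; ring_nf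
lemma ch_zero_left (z : ℂ) : ch 0 z = 1 := by simp [ch, pair_zero_left]
lemma ch_ne_zero (p z : ℂ) : ch p z ≠ 0 := Complex.exp_ne_zero _
lemma norm_ch (p z : ℂ) : ‖ch p z‖ = 1 := by
  rw [ch, mul_comm]; exact Complex.norm_exp_ofReal_mul_I _
lemma ch_neg_left (p z : ℂ) : ch (-p) z = (ch p z)⁻¹ := by
  rw [ch, ch, ← Complex.exp_neg, pair_neg_left]; push_cast; ring_nf
lemma ch_neg_right (p z : ℂ) : ch p (-z) = (ch p z)⁻¹ := by
  rw [ch, ch, ← Complex.exp_neg, pair_neg_right]; push_cast; ring_nf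
lemma ch_neg_mul_ch (p z : ℂ) : ch (-p) z * ch p z = 1 := by
  rw [ch_neg_left, inv_mul_cancel₀ (ch_ne_zero p z)]
lemma conj_ch (p z : ℂ) : conj (ch p z) = ch (-p) z := by
  rw [ch, ch, ← Complex.exp_conj, pair_neg_left]; simp
lemma ch_omega_mul (p z : ℂ) : ch (ω₃ * p) (ω₃ * z) = ch p z := by
  rw [ch, ch, pair_omega_mul]

/-- The linear form `v ↦ i⟨p, v⟩`, the logarithmic derivative of `ch p`. -/
def chForm (p : ℂ) : ℂ →L[ℝ] ℂ :=
  Complex.I • (Complex.ofRealCLM ∘L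
    (p.re • Complex.reCLM + p.im • Complex.imCLM))

lemma chForm_apply (p v : ℂ) : chForm p v = Complex.I * pair p v := by
  simp [chForm, pair_eq, mul_add]

lemma norm_chForm_le (p : ℂ) : ‖chForm p‖ ≤ 2 * ‖p‖ := by
  refine ContinuousLinearMap.opNorm_le_bound _ (by positivity) fun v => ?_
  rw [chForm_apply, norm_mul, Complex.norm_I, one_mul, Complex.norm_real, pair]
  refine (Complex.abs_re_le_norm _).trans ?_
  rw [norm_mul, RCLike.norm_conj]
  nlinarith [norm_nonneg p, norm_nonneg v, mul_nonneg (norm_nonneg p) (norm_nonneg v)]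

lemma hasFDerivAt_ch (p z : ℂ) : HasFDerivAt (ch p) (ch p z • chForm p) z := by
  have h1 : HasFDerivAt (fun w => chForm p w) (chForm p) z := (chForm p).hasFDerivAt
  have h2 := h1.cexp
  have h3 : (fun w => Complex.exp (chForm p w)) = ch p := by
    ext w; rw [chForm_apply]; rfl
  rw [h3] at h2
  have h4 : Complex.exp (chForm p z) = ch p z := by rw [← h3]
  rwa [h4] at h2

lemma contDiff_ch (p : ℂ) : ContDiff ℝ ∞ (ch p) := by
  have h3 : (fun w => Complex.exp (chForm p w)) = ch p := by
    ext w; rw [chForm_apply]; rfl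
  rw [← h3]
  exact Complex.contDiff_exp.comp (chForm p).contDiff

lemma continuous_ch (p : ℂ) : Continuous (ch p) := (contDiff_ch p).continuous

/-- The point of the dual lattice with `⟨freq n, s + t ω⟩ = 2π (n₁ s + n₂ t)`. -/
def freq (n : ℤ × ℤ) : ℂ :=
  4 * (Real.pi : ℂ) * Complex.I / (Real.sqrt 3 : ℂ) * ((-n.1 : ℂ) * ω₃ + n.2)

lemma dualLattice_eq_range : dualLattice = Set.range freq := by
  ext z
  constructor
  · rintro ⟨γ, ⟨m, n, rfl⟩, rfl⟩
    exact ⟨(-m, n), by simp [freq]⟩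
  · rintro ⟨n, rfl⟩
    exact ⟨_, ⟨-n.1, n.2, rfl⟩, by simp [freq]⟩

lemma freq_add (m n : ℤ × ℤ) : freq (m + n) = freq m + freq n := by
  simp [freq]; ring
lemma freq_neg (m : ℤ × ℤ) : freq (-m) = -freq m := by
  simp [freq]; ring
lemma freq_sub (m n : ℤ × ℤ) : freq (m - n) = freq m - freq n := by
  rw [sub_eq_add_neg, freq_add, freq_neg, sub_eq_add_neg]
lemma freq_zero : freq 0 = 0 := by simp [freq]

lemma sqrt3_pos : 0 < Real.sqrt 3 := Real.sqrt_pos.2 (by norm_num)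

lemma freq_re (n : ℤ × ℤ) : (freq n).re = 2 * Real.pi * n.1 := by
  have h := sqrt3_pos.ne'
  have e : freq n = ((4 * Real.pi / Real.sqrt 3 : ℝ) : ℂ) *
      (Complex.I * ((-n.1 : ℂ) * ω₃ + n.2)) := by
    rw [freq]; push_cast; ring
  rw [e, Complex.re_ofReal_mul]
  simp [omega_re, omega_im]
  field_simp
  ring

lemma freq_im (n : ℤ × ℤ) : (freq n).im = 2 * Real.pi * (n.1 + 2 * n.2) / Real.sqrt 3 := by
  have h := sqrt3_pos.ne'
  have e : freq n = ((4 * Real.pi / Real.sqrt 3 : ℝ) : ℂ) *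
      (Complex.I * ((-n.1 : ℂ) * ω₃ + n.2)) := by
    rw [freq]; push_cast; ring
  rw [e, Complex.im_ofReal_mul]
  simp [omega_re, omega_im]
  field_simp
  ring

/-- Lattice coordinates: `(s, t) ↦ s + t ω`. -/
def latPt (x : ℝ × ℝ) : ℂ := x.1 + x.2 * ω₃

lemma latPt_re (x : ℝ × ℝ) : (latPt x).re = x.1 - x.2 / 2 := by
  simp [latPt, omega_re]; ring
lemma latPt_im (x : ℝ × ℝ) : (latPt x).im = x.2 * (Real.sqrt 3 / 2) := by
  simp [latPt, omega_im]

lemma latPt_add (x y : ℝ × ℝ) : latPt (x + y) = latPt x + latPt y := by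
  simp [latPt]; ring

lemma pair_freq_latPt (n : ℤ × ℤ) (x : ℝ × ℝ) :
    pair (freq n) (latPt x) = 2 * Real.pi * (n.1 * x.1 + n.2 * x.2) := by
  have h := sqrt3_pos.ne'
  rw [pair_eq, freq_re, freq_im, latPt_re, latPt_im]
  field_simp
  ring

lemma latPt_int_mem (m n : ℤ) : latPt (m, n) ∈ lattice :=
  ⟨n, m, by simp [latPt]; ring⟩

lemma mem_lattice_iff (γ : ℂ) : γ ∈ lattice ↔ ∃ m n : ℤ, γ = latPt (m, n) := by
  constructor
  · rintro ⟨m, n, rfl⟩; exact ⟨n, m, by simp [latPt]; ring⟩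
  · rintro ⟨m, n, rfl⟩; exact latPt_int_mem m n

lemma one_mem_lattice : (1 : ℂ) ∈ lattice := ⟨0, 1, by simp⟩
lemma omega_mem_lattice : ω₃ ∈ lattice := ⟨1, 0, by simp⟩

lemma ch_freq_latPt (n : ℤ × ℤ) (x : ℝ × ℝ) :
    ch (freq n) (latPt x) = Complex.exp (2 * Real.pi * Complex.I * (n.1 * x.1 + n.2 * x.2)) := by
  rw [ch, pair_freq_latPt]; push_cast; ring_nf

lemma ch_freq_lattice (n : ℤ × ℤ) {γ : ℂ} (hγ : γ ∈ lattice) : ch (freq n) γ = 1 := by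
  obtain ⟨a, b, rfl⟩ := (mem_lattice_iff γ).1 hγ
  rw [ch_freq_latPt, Complex.exp_eq_one_iff]
  exact ⟨n.1 * a + n.2 * b, by push_cast; ring⟩

lemma mem_dualLattice_of_ch_eq_one {k : ℂ} (h1 : ch k 1 = 1) (h2 : ch k ω₃ = 1) :
    k ∈ dualLattice := by
  have key : ∀ z, ch k z = 1 → ∃ n : ℤ, pair k z = 2 * Real.pi * n := by
    intro z hz
    rw [ch, Complex.exp_eq_one_iff] at hz
    obtain ⟨n, hn⟩ := hz
    refine ⟨n, ?_⟩
    have : (pair k z : ℂ) = ((2 * Real.pi * n : ℝ) : ℂ) := by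
      push_cast
      linear_combination (-Complex.I) * hn + (pair k z - 2 * Real.pi * n : ℂ) * Complex.I_sq
    exact_mod_cast this
  obtain ⟨a, ha⟩ := key 1 h1
  obtain ⟨b, hb⟩ := key ω₃ h2
  rw [dualLattice_eq_range]
  refine ⟨(a, b), Complex.ext ?_ ?_⟩
  · rw [freq_re, ← ha]; simp [pair_eq]
  · rw [freq_im]
    rw [pair_eq] at ha hb
    simp only [Complex.one_re, Complex.one_im, omega_re, omega_im] at ha hb
    have h := sqrt3_pos.ne'
    field_simp
    linarith

lemma dualLattice_add {p q : ℂ} (hp : p ∈ dualLattice) (hq : q ∈ dualLattice) :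
    p + q ∈ dualLattice := by
  rw [dualLattice_eq_range] at *
  obtain ⟨m, rfl⟩ := hp
  obtain ⟨n, rfl⟩ := hq
  exact ⟨m + n, freq_add m n⟩

lemma dualLattice_neg {p : ℂ} (hp : p ∈ dualLattice) : -p ∈ dualLattice := by
  rw [dualLattice_eq_range] at *
  obtain ⟨m, rfl⟩ := hp
  exact ⟨-m, freq_neg m⟩

/-- The action of multiplication by `ω` on dual lattice indices. -/
def rotIdx : Equiv.Perm (ℤ × ℤ) where
  toFun n := (-(n.1 + n.2), n.1)
  invFun n := (n.2, -n.1 - n.2)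
  left_inv n := by ext <;> simp
  right_inv n := by ext <;> simp

lemma freq_rotIdx (n : ℤ × ℤ) : freq (rotIdx n) = ω₃ * freq n := by
  have := omega_sq
  simp only [freq, rotIdx, Equiv.coe_fn_mk]
  push_cast
  linear_combination (4 * (Real.pi : ℂ) * Complex.I / (Real.sqrt 3 : ℂ) * n.1) * this

lemma freq_injective : Function.Injective freq := by
  intro m n h
  have h1 := congrArg Complex.re h
  have h2 := congrArg Complex.im h
  have hs := sqrt3_pos.ne'
  have hp := Real.pi_pos.ne'
  rw [freq_re, freq_re] at h1
  rw [freq_im, freq_im] at h2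
  have e1 : (m.1 : ℝ) = n.1 := by
    have : 2 * Real.pi ≠ 0 := by positivity
    exact mul_left_cancel₀ this h1
  rw [e1] at h2
  field_simp at h2
  have e2 : (m.2 : ℝ) = n.2 := by linarith
  exact Prod.ext (by exact_mod_cast e1) (by exact_mod_cast e2)

lemma omega_dualLattice {p : ℂ} (hp : p ∈ dualLattice) : ω₃ * p ∈ dualLattice := by
  rw [dualLattice_eq_range] at *
  obtain ⟨m, rfl⟩ := hp
  exact ⟨rotIdx m, freq_rotIdx m⟩

/-- With `a = ωK - K ∈ Λ*`, the relation `1 + ω + ω² = 0` gives `2a + ωa = -3K`. Hence `K` and `-2K`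
define the same multiplier on `Λ`. -/
lemma IsDiracPoint.three_mul_mem {K : ℂ} (hK : IsDiracPoint K) : 3 * K ∈ dualLattice := by
  have h1 := hK.rot
  have h2 := omega_dualLattice h1
  have h3 := omega_dualLattice h2
  have : 3 * K = -((ω₃ * K - K) + ((ω₃ * K - K) + ω₃ * (ω₃ * K - K))) := by
    linear_combination K * omega_sq
  rw [this]
  exact dualLattice_neg (dualLattice_add h1 (dualLattice_add h1 h2))

/-- This ensures that in the sector `k = K` the second component has no zero frequency. -/
lemma IsDiracPoint.two_mul_notMem {K : ℂ} (hK : IsDiracPoint K) : 2 * K ∉ dualLattice := by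
  intro h
  apply hK.ne_zero
  have : K = 3 * K + -(2 * K) := by ring
  rw [this]
  exact dualLattice_add hK.three_mul_mem (dualLattice_neg h)

/-- The weight `1 + |n₁| + |n₂|`. -/
def wt (n : ℤ × ℤ) : ℝ := 1 + |(n.1 : ℝ)| + |(n.2 : ℝ)|

lemma one_le_wt (n : ℤ × ℤ) : 1 ≤ wt n := by
  have := abs_nonneg (n.1 : ℝ); have := abs_nonneg (n.2 : ℝ); unfold wt; linarith

lemma wt_pos (n : ℤ × ℤ) : 0 < wt n := zero_lt_one.trans_le (one_le_wt n)

/-- Submultiplicativity is what lets weights pass through convolutions. -/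
lemma wt_add_le (m n : ℤ × ℤ) : wt (m + n) ≤ wt m * wt n := by
  simp only [wt, Prod.fst_add, Prod.snd_add, Int.cast_add]
  have h1 := abs_add_le (m.1 : ℝ) n.1
  have h2 := abs_add_le (m.2 : ℝ) n.2
  have a := abs_nonneg (m.1 : ℝ); have b := abs_nonneg (m.2 : ℝ)
  have c := abs_nonneg (n.1 : ℝ); have d := abs_nonneg (n.2 : ℝ)
  nlinarith [mul_nonneg a c, mul_nonneg a d, mul_nonneg b c, mul_nonneg b d]

lemma wt_neg (m : ℤ × ℤ) : wt (-m) = wt m := by simp [wt]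

lemma wt_le_norm_freq (n : ℤ × ℤ) : wt n ≤ 1 + ‖freq n‖ := by
  have h1 := Complex.abs_re_le_norm (freq n)
  have h2 := Complex.abs_im_le_norm (freq n)
  rw [freq_re] at h1
  rw [freq_im] at h2
  have hs : Real.sqrt 3 ≤ 2 := by
    rw [Real.sqrt_le_left (by norm_num)]; norm_num
  have hp := Real.pi_gt_three
  rw [abs_mul, abs_of_pos (by positivity)] at h1
  rw [abs_div, abs_mul, abs_of_pos (show 0 < 2 * Real.pi by positivity), abs_of_pos sqrt3_pos,
    div_le_iff₀ sqrt3_pos] at h2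
  have h3 : |(n.2 : ℝ)| ≤ |(n.1 + 2 * n.2 : ℝ)| / 2 + |(n.1 : ℝ)| / 2 := by
    have : (n.2 : ℝ) = (n.1 + 2 * n.2) / 2 - n.1 / 2 := by ring
    calc |(n.2 : ℝ)| = |(n.1 + 2 * n.2 : ℝ) / 2 - n.1 / 2| := by rw [← this]
      _ ≤ |(n.1 + 2 * n.2 : ℝ) / 2| + |(n.1 : ℝ) / 2| := abs_sub _ _
      _ = _ := by rw [abs_div, abs_div]; simp
  have h4 : 6 * |(n.1 : ℝ)| ≤ ‖freq n‖ :=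
    (mul_le_mul_of_nonneg_right (by linarith) (abs_nonneg _)).trans h1
  have h5 : 6 * |(n.1 + 2 * n.2 : ℝ)| ≤ ‖freq n‖ * 2 :=
    (mul_le_mul_of_nonneg_right (by linarith) (abs_nonneg _)).trans
      (h2.trans (mul_le_mul_of_nonneg_left hs (norm_nonneg _)))
  unfold wt
  have := norm_nonneg (freq n)
  linarith

lemma wt_le_norm_freq_add (p : ℂ) (n : ℤ × ℤ) : wt n ≤ (1 + ‖p‖) * (1 + ‖freq n + p‖) := by
  have h1 := wt_le_norm_freq n
  have h2 : ‖freq n‖ ≤ ‖freq n + p‖ + ‖p‖ := by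
    calc ‖freq n‖ = ‖(freq n + p) - p‖ := by ring_nf
      _ ≤ _ := norm_sub_le _ _
  nlinarith [norm_nonneg p, norm_nonneg (freq n + p)]

lemma norm_freq_add_le (p : ℂ) : ∃ C, 0 ≤ C ∧ ∀ n, ‖freq n + p‖ ≤ C * wt n := by
  refine ⟨40 + ‖p‖, by positivity, fun n => ?_⟩
  have h1 : ‖freq n‖ ≤ 40 * wt n := by
    refine (Complex.norm_le_abs_re_add_abs_im _).trans ?_
    rw [freq_re, freq_im]
    have hp := Real.pi_lt_four
    have hp0 := Real.pi_pos
    have hs : 1 ≤ Real.sqrt 3 := by rw [Real.one_le_sqrt]; norm_num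
    rw [abs_mul, abs_of_pos (by positivity), abs_div, abs_mul,
      abs_of_pos (show 0 < 2 * Real.pi by positivity), abs_of_pos sqrt3_pos]
    have h3 : |(n.1 + 2 * n.2 : ℝ)| ≤ |(n.1 : ℝ)| + 2 * |(n.2 : ℝ)| := by
      refine (abs_add_le _ _).trans ?_
      rw [abs_mul]; simp
    have h4 : 2 * Real.pi * |(n.1 + 2 * n.2 : ℝ)| / Real.sqrt 3 ≤
        2 * Real.pi * |(n.1 + 2 * n.2 : ℝ)| := div_le_self (by positivity) hs
    have a := abs_nonneg (n.1 : ℝ); have b := abs_nonneg (n.2 : ℝ)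
    unfold wt
    have h5 : 2 * Real.pi * |(n.1 : ℝ)| ≤ 8 * |(n.1 : ℝ)| := by nlinarith
    have h6 : 2 * Real.pi * |(n.1 + 2 * n.2 : ℝ)| ≤ 8 * (|(n.1 : ℝ)| + 2 * |(n.2 : ℝ)|) := by
      have := abs_nonneg (n.1 + 2 * n.2 : ℝ)
      nlinarith
    linarith
  have h2 := norm_add_le (freq n) p
  have h3 := one_le_wt n
  nlinarith [norm_nonneg p]

lemma finite_wt_le (R : ℝ) : {n : ℤ × ℤ | wt n ≤ R}.Finite := by
  refine ((Set.finite_Icc (-⌈R⌉) ⌈R⌉).prod (Set.finite_Icc (-⌈R⌉) ⌈R⌉)).subset ?_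
  intro n hn
  simp only [wt, Set.mem_ofPred_eq] at hn
  have a := abs_nonneg (n.1 : ℝ); have b := abs_nonneg (n.2 : ℝ)
  have hR := Int.le_ceil R
  have h1 : |(n.1 : ℝ)| ≤ ⌈R⌉ := by linarith
  have h2 : |(n.2 : ℝ)| ≤ ⌈R⌉ := by linarith
  rw [abs_le] at h1 h2
  exact ⟨⟨by exact_mod_cast h1.1, by exact_mod_cast h1.2⟩,
    ⟨by exact_mod_cast h2.1, by exact_mod_cast h2.2⟩⟩

lemma tendsto_norm_freq_add (p : ℂ) :
    Filter.Tendsto (fun n => ‖freq n + p‖) Filter.cofinite Filter.atTop := by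
  rw [Filter.tendsto_atTop]
  intro R
  refine ((finite_wt_le ((1 + ‖p‖) * (1 + R))).subset ?_)
  intro n hn
  simp only [Set.mem_compl_iff, Set.mem_ofPred_eq, not_le] at hn ⊢
  refine (wt_le_norm_freq_add p n).trans ?_
  gcongr

lemma summable_wt_inv : Summable fun n : ℤ × ℤ => (wt n ^ 4)⁻¹ := by
  have h1 : Summable fun n : ℤ => ((1 + |(n : ℝ)|) ^ 2)⁻¹ := by
    have h := (Real.summable_one_div_int_pow (p := 2)).2 (by norm_num)
    rw [← (Set.finite_singleton (0 : ℤ)).summable_compl_iff] at h ⊢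
    refine Summable.of_nonneg_of_le (fun n => inv_nonneg.2 (sq_nonneg _)) (fun n => ?_) h
    have hn : (n : ℤ) ≠ 0 := n.2
    have hn' : 0 < |((n : ℤ) : ℝ)| := abs_pos.2 (by exact_mod_cast hn)
    simp only [Function.comp_apply]
    rw [one_div, ← sq_abs ((n : ℤ) : ℝ)]
    refine inv_anti₀ (by positivity) (pow_le_pow_left₀ hn'.le (by linarith) 2)
  have h2 := Summable.mul_of_nonneg h1 h1 (fun n => by positivity) (fun n => by positivity)
  refine Summable.of_nonneg_of_le (fun n => by have := wt_pos n; positivity) (fun n => ?_) h2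
  have a := abs_nonneg (n.1 : ℝ); have b := abs_nonneg (n.2 : ℝ)
  rw [← mul_inv, show wt n ^ 4 = wt n ^ 2 * wt n ^ 2 by ring]
  refine inv_anti₀ (by positivity) (mul_le_mul ?_ ?_ (by positivity) (by positivity))
  · exact pow_le_pow_left₀ (by linarith) (by unfold wt; linarith) 2
  · exact pow_le_pow_left₀ (by linarith) (by unfold wt; linarith) 2

end Geometry

/-! ### Fourier series on the unit square, transferred from the torus. -/

section TorusFourier

/-- The unit square `(0, 1] × (0, 1]`. -/
def unitSq : Set (ℝ × ℝ) := Set.Ioc 0 1 ×ˢ Set.Ioc 0 1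

lemma measurableSet_unitSq : MeasurableSet unitSq := measurableSet_Ioc.prod measurableSet_Ioc

/-- The monomial `(s, t) ↦ e^{2πi(n₁ s + n₂ t)}`. -/
def sqExp (n : ℤ × ℤ) (x : ℝ × ℝ) : ℂ :=
  Complex.exp (2 * Real.pi * Complex.I * (n.1 * x.1 + n.2 * x.2))

attribute [local instance] instMeasureSpaceUnitAddCircle

/-- The lift of a point of the torus to the unit square. -/
def torusLift (t : UnitAddTorus (Fin 2)) : ℝ × ℝ :=
  MeasurableEquiv.finTwoArrow (UnitAddTorus.measurableEquivPiIoc (fun _ => (0 : ℝ)) t : Fin 2 → ℝ)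

lemma measurePreserving_torusLift :
    MeasurePreserving torusLift volume (volume.restrict unitSq) := by
  have h1 := UnitAddTorus.measurePreserving_equivPiIoc (fun _ : Fin 2 => (0 : ℝ))
  have hm : MeasurableSet {x : Fin 2 → ℝ | ∀ i, x i ∈ Set.Ioc (0 : ℝ) (0 + 1)} :=
    MeasurableSet.univ_pi' fun i => measurableSet_Ioc
  have h2 := measurePreserving_subtype_coe (μa := (volume : Measure (Fin 2 → ℝ))) hm
  have h3 := (volume_preserving_finTwoArrow ℝ).restrict_preimage measurableSet_unitSq
  have h4 : (MeasurableEquiv.finTwoArrow (α := ℝ)) ⁻¹' unitSq =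
      {x : Fin 2 → ℝ | ∀ i, x i ∈ Set.Ioc (0 : ℝ) (0 + 1)} := by
    ext x
    simp [unitSq, MeasurableEquiv.finTwoArrow, Fin.forall_fin_two]
  rw [h4] at h3
  exact h3.comp (h2.comp h1)

lemma mFourier_eq_sqExp (n : Fin 2 → ℤ) (t : UnitAddTorus (Fin 2)) :
    UnitAddTorus.mFourier n t = sqExp (n 0, n 1) (torusLift t) := by
  have key : ∀ i, (((UnitAddTorus.measurableEquivPiIoc (fun _ : Fin 2 => (0 : ℝ)) t) :
      Fin 2 → ℝ) i : UnitAddCircle) = t i := by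
    intro i
    have := (UnitAddTorus.measurableEquivPiIoc (fun _ : Fin 2 => (0 : ℝ))).symm_apply_apply t
    exact congrFun this i
  rw [UnitAddTorus.mFourier, ContinuousMap.coe_mk, Fin.prod_univ_two, ← key 0, ← key 1,
    fourier_coe_apply, fourier_coe_apply, ← Complex.exp_add, sqExp]
  congr 1
  simp only [torusLift, MeasurableEquiv.finTwoArrow]
  simp
  ring

lemma mFourierCoeff_comp_torusLift {f : ℝ × ℝ → ℂ}
    (hf : AEStronglyMeasurable f (volume.restrict unitSq)) (n : Fin 2 → ℤ) :
    UnitAddTorus.mFourierCoeff (f ∘ torusLift) n =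
      ∫ x in unitSq, sqExp (-n 0, -n 1) x * f x := by
  have h : AEStronglyMeasurable (fun x => sqExp (-n 0, -n 1) x * f x)
      (volume.restrict unitSq) := by
    refine AEStronglyMeasurable.mul ?_ hf
    refine Continuous.aestronglyMeasurable ?_
    unfold sqExp; fun_prop
  have h1 := integral_map measurePreserving_torusLift.aemeasurable
    (by rw [measurePreserving_torusLift.map_eq]; exact h)
  rw [measurePreserving_torusLift.map_eq] at h1
  rw [h1]
  simp only [UnitAddTorus.mFourierCoeff, mFourier_eq_sqExp]
  rfl

lemma exists_torus_Lp {f : ℝ × ℝ → ℂ} (hf : MemLp f 2 (volume.restrict unitSq)) :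
    ∃ F : Lp ℂ 2 (volume : Measure (UnitAddTorus (Fin 2))),
      (F =ᵐ[volume] f ∘ torusLift) ∧
      ∀ n, UnitAddTorus.mFourierBasis.repr F n = ∫ x in unitSq, sqExp (-n 0, -n 1) x * f x := by
  have h := hf.comp_measurePreserving measurePreserving_torusLift
  refine ⟨h.toLp _, h.coeFn_toLp, fun n => ?_⟩
  rw [UnitAddTorus.mFourierBasis_repr, ← mFourierCoeff_comp_torusLift hf.1]
  refine integral_congr_ae ?_
  filter_upwards [h.coeFn_toLp] with t ht
  rw [ht]

/-- Completeness of the trigonometric system on the unit square. -/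
lemma ae_eq_zero_of_sqCoeff_eq_zero {f : ℝ × ℝ → ℂ} (hf : MemLp f 2 (volume.restrict unitSq))
    (h : ∀ n, ∫ x in unitSq, sqExp (-n) x * f x = 0) : f =ᵐ[volume.restrict unitSq] 0 := by
  obtain ⟨F, hF1, hF2⟩ := exists_torus_Lp hf
  have hF0 : F = 0 := by
    apply UnitAddTorus.mFourierBasis.repr.injective
    rw [map_zero]
    ext n
    rw [hF2]
    exact h (n 0, n 1)
  have h1 : f ∘ torusLift =ᵐ[volume] 0 := by
    refine hF1.symm.trans ?_
    rw [hF0]; exact Lp.coeFn_zero _ _ _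
  have h2 := eLpNorm_comp_measurePreserving (p := 2) hf.1 measurePreserving_torusLift
  rw [eLpNorm_congr_ae h1] at h2
  have h3 : eLpNorm f 2 (volume.restrict unitSq) = 0 := by rw [← h2]; simp
  exact (eLpNorm_eq_zero_iff hf.1 (by norm_num)).1 h3

/-- Square summability of the Fourier coefficients on the unit square. -/
lemma summable_sq_sqCoeff {f : ℝ × ℝ → ℂ} (hf : MemLp f 2 (volume.restrict unitSq)) :
    Summable fun n : ℤ × ℤ => ‖∫ x in unitSq, sqExp (-n) x * f x‖ ^ 2 := by
  obtain ⟨F, hF1, hF2⟩ := exists_torus_Lp hf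
  have h := ell2_summable (UnitAddTorus.mFourierBasis.repr F)
  have h1 := (finTwoArrowEquiv ℤ).symm.summable_iff.2 h
  refine h1.congr fun n => ?_
  simp only [Function.comp_apply, hF2]
  rfl

lemma integral_sqExp (n : ℤ × ℤ) : ∫ x in unitSq, sqExp n x = if n = 0 then 1 else 0 := by
  have h := mFourierCoeff_comp_torusLift (f := fun _ => 1) aestronglyMeasurable_const
    (fun i => if i = 0 then -n.1 else -n.2)
  simp only [Fin.isValue, ↓reduceIte, neg_neg, one_ne_zero, mul_one] at h
  rw [show n = (n.1, n.2) from rfl, ← h]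
  have h2 := orthonormal_iff_ite.1 (UnitAddTorus.orthonormal_mFourier (d := Fin 2))
    (fun i => if i = 0 then -n.1 else -n.2) 0
  simp only [ContinuousMap.inner_toLp, ← UnitAddTorus.mFourier_neg, UnitAddTorus.mFourier_zero] at h2
  simp only [UnitAddTorus.mFourierCoeff, Function.comp_apply, smul_eq_mul]
  simp only [ContinuousMap.one_apply, one_mul] at h2
  simp only [mul_one]
  rw [h2]
  congr 1
  rw [funext_iff, Fin.forall_fin_two]
  simp [Prod.ext_iff]

end TorusFourier

/-! ### Change of variables to lattice coordinates. -/

section LatticeCoordinates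

/-- `latPt` as a linear equivalence. -/
def latLin : (ℝ × ℝ) ≃ₗ[ℝ] ℂ where
  toFun := latPt
  map_add' := latPt_add
  map_smul' c x := by simp [latPt]; ring
  invFun z := (z.re + z.im / Real.sqrt 3, 2 * z.im / Real.sqrt 3)
  left_inv x := by
    have := sqrt3_pos.ne'
    ext
    · simp only [latPt_re, latPt_im]; field_simp; ring
    · simp only [latPt_im]; field_simp
  right_inv z := by
    have := sqrt3_pos.ne'
    apply Complex.ext
    · simp only [latPt_re]; field_simp; ring
    · simp only [latPt_im]; field_simp

/-- `latPt` as a continuous linear equivalence. -/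
def latEquiv : (ℝ × ℝ) ≃L[ℝ] ℂ := latLin.toContinuousLinearEquiv

@[simp] lemma latEquiv_apply (x : ℝ × ℝ) : latEquiv x = latPt x := rfl

lemma continuous_latPt : Continuous latPt := latEquiv.continuous

lemma hasFDerivAt_latPt (x : ℝ × ℝ) :
    HasFDerivAt latPt (latEquiv : ℝ × ℝ →L[ℝ] ℂ) x := latEquiv.hasFDerivAt

lemma measurableEmbedding_latPt : MeasurableEmbedding latPt :=
  latEquiv.toHomeomorph.measurableEmbedding

/-- The image of Lebesgue measure under a linear isomorphism is a Haar measure, hence a multiple of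
Lebesgue measure. Only positivity of the factor matters. -/
lemma exists_map_latPt : ∃ c : NNReal, 0 < c ∧
    Measure.map latPt volume = c • (volume : Measure ℂ) := by
  have : (Measure.map latPt (volume : Measure (ℝ × ℝ))).IsAddHaarMeasure :=
    latEquiv.isAddHaarMeasure_map volume
  exact ⟨_, Measure.addHaarScalarFactor_pos_of_isAddHaarMeasure _ _,
    Measure.isAddLeftInvariant_eq_smul _ _⟩

lemma ae_latPt_iff {p : ℂ → Prop} : (∀ᵐ x : ℝ × ℝ, p (latPt x)) ↔ ∀ᵐ z, p z := by
  obtain ⟨c, hc, h⟩ := exists_map_latPt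
  have h1 : (∀ᵐ z ∂(Measure.map latPt volume), p z) ↔ ∀ᵐ x : ℝ × ℝ, p (latPt x) :=
    measurableEmbedding_latPt.ae_map_iff
  rw [← h1, h]
  exact Measure.ae_smul_measure_iff (by simpa using hc.ne')

lemma exists_integral_latPt : ∃ c : ℝ, c ≠ 0 ∧
    ∀ F : ℂ → ℂ, ∫ x, F (latPt x) = c * ∫ z, F z := by
  obtain ⟨c, hc, h⟩ := exists_map_latPt
  refine ⟨c, by exact_mod_cast hc.ne', fun F => ?_⟩
  rw [← measurableEmbedding_latPt.integral_map, h, integral_smul_nnreal_measure]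
  rw [NNReal.smul_def, Complex.real_smul]

lemma memLp_comp_latPt {f : ℂ → ℂ} (hf : MemL2loc f) {s : Set (ℝ × ℝ)}
    (hs : Bornology.IsBounded s) : MemLp (f ∘ latPt) 2 (volume.restrict s) := by
  obtain ⟨c, hc, h⟩ := exists_map_latPt
  have hK : IsCompact (latPt '' closure s) :=
    (Metric.isCompact_of_isClosed_isBounded isClosed_closure hs.closure).image continuous_latPt
  have h1 := (hf _ hK).smul_measure (c := (c : ENNReal)) (by simp)
  have h2 : MeasurePreserving latPt volume (c • (volume : Measure ℂ)) :=
    ⟨continuous_latPt.measurable, h⟩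
  have h3 := h2.restrict_preimage hK.measurableSet
  have h4 : MemLp (f ∘ latPt) 2 (volume.restrict (latPt ⁻¹' (latPt '' closure s))) := by
    refine MemLp.comp_measurePreserving ?_ h3
    rw [Measure.restrict_smul]
    exact h1
  refine h4.mono_measure (Measure.restrict_mono ?_ le_rfl)
  exact fun x hx => ⟨x, subset_closure hx, rfl⟩

lemma isBounded_unitSq : Bornology.IsBounded unitSq :=
  (Metric.isBounded_Ioc 0 1).prod (Metric.isBounded_Ioc 0 1)

lemma volume_unitSq_lt_top : volume unitSq < ⊤ := isBounded_unitSq.measure_lt_top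

instance : IsFiniteMeasure (volume.restrict unitSq) :=
  ⟨by simpa using volume_unitSq_lt_top⟩

lemma Continuous.memL2loc {F : Type*} [NormedAddCommGroup F] {f : ℂ → F}
    (hf : _root_.Continuous f) [SecondCountableTopologyEither ℂ F] : MemL2loc f := by
  intro s hs
  have : IsFiniteMeasure (volume.restrict s) := ⟨by simpa using hs.measure_lt_top⟩
  obtain ⟨C, hC⟩ := hs.exists_bound_of_continuousOn hf.continuousOn
  exact MemLp.of_bound hf.aestronglyMeasurable C (ae_restrict_of_forall_mem hs.measurableSet hC)

end LatticeCoordinates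

/-! ### Floquet functions, their Fourier coefficients, and integration by parts. -/

section FloquetFourier

/-- Almost everywhere Floquet condition `f(z + γ) = e^{i⟨p, γ⟩} f(z)`. -/
def AEFloquet (p : ℂ) (f : ℂ → ℂ) : Prop :=
  ∀ γ ∈ lattice, ∀ᵐ z, f (z + γ) = ch p γ * f z

/-- Pointwise Floquet condition. -/
def IsFloquet (p : ℂ) (f : ℂ → ℂ) : Prop :=
  ∀ γ ∈ lattice, ∀ z, f (z + γ) = ch p γ * f z

lemma IsFloquet.ae {p : ℂ} {f : ℂ → ℂ} (h : IsFloquet p f) : AEFloquet p f :=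
  fun γ hγ => Filter.Eventually.of_forall (h γ hγ)

lemma isFloquet_ch (p : ℂ) : IsFloquet p (ch p) := fun γ _ z => by
  rw [ch_add_right, mul_comm]

lemma IsFloquet.mul {p q : ℂ} {f g : ℂ → ℂ} (hf : IsFloquet p f) (hg : IsFloquet q g) :
    IsFloquet (p + q) (fun z => f z * g z) := fun γ hγ z => by
  simp only [hf γ hγ, hg γ hγ, ch_add_left]; ring

lemma IsFloquet.add {p : ℂ} {f g : ℂ → ℂ} (hf : IsFloquet p f) (hg : IsFloquet p g) :
    IsFloquet p (fun z => f z + g z) := fun γ hγ z => by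
  simp only [hf γ hγ, hg γ hγ]; ring

lemma IsFloquet.const_mul {p : ℂ} {f : ℂ → ℂ} (c : ℂ) (hf : IsFloquet p f) :
    IsFloquet p (fun z => c * f z) := fun γ hγ z => by
  simp only [hf γ hγ]; ring

lemma IsFloquet.shift {p q : ℂ} {f : ℂ → ℂ} (hf : IsFloquet p f) (h : q - p ∈ dualLattice) :
    IsFloquet q f := by
  rw [dualLattice_eq_range] at h
  obtain ⟨n, hn⟩ := h
  intro γ hγ z
  have : q = freq n + p := by rw [hn]; ring
  rw [hf γ hγ, this, ch_add_left, ch_freq_lattice n hγ, one_mul]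

/-- The Fourier coefficient of `f` at the frequency `p`, over the fundamental cell. -/
def coef (p : ℂ) (f : ℂ → ℂ) : ℂ := ∫ x in unitSq, ch (-p) (latPt x) * f (latPt x)

lemma coef_eq_sqCoeff (p : ℂ) (n : ℤ × ℤ) (f : ℂ → ℂ) :
    coef (freq n + p) f = ∫ x in unitSq, sqExp (-n) x * (ch (-p) (latPt x) * f (latPt x)) := by
  unfold coef
  congr 1; ext x
  rw [neg_add, ch_add_left, ← freq_neg, ch_freq_latPt, mul_assoc]
  rfl

lemma memLp_ch_mul {f : ℂ → ℂ} (hf : MemL2loc f) (p : ℂ) :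
    MemLp (fun x => ch p (latPt x) * f (latPt x)) 2 (volume.restrict unitSq) := by
  have h := memLp_comp_latPt hf isBounded_unitSq
  refine h.of_le (((continuous_ch p).comp continuous_latPt).aestronglyMeasurable.mul h.1) ?_
  exact Filter.Eventually.of_forall fun x => by simp [norm_ch]

lemma integrable_ch_mul {f : ℂ → ℂ} (hf : MemL2loc f) (p : ℂ) :
    Integrable (fun x => ch p (latPt x) * f (latPt x)) (volume.restrict unitSq) :=
  (memLp_ch_mul hf p).integrable (by norm_num)

lemma summable_sq_coef {f : ℂ → ℂ} (hf : MemL2loc f) (p : ℂ) :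
    Summable fun n => ‖coef (freq n + p) f‖ ^ 2 := by
  simp only [coef_eq_sqCoeff]
  exact summable_sq_sqCoeff (memLp_ch_mul hf (-p))

lemma coef_congr_ae {f g : ℂ → ℂ} (h : f =ᵐ[volume] g) (p : ℂ) : coef p f = coef p g := by
  unfold coef
  refine integral_congr_ae (ae_restrict_of_ae ?_)
  filter_upwards [ae_latPt_iff.2 h] with x hx
  rw [hx]

lemma coef_add {f g : ℂ → ℂ} (hf : MemL2loc f) (hg : MemL2loc g) (p : ℂ) :
    coef p (fun z => f z + g z) = coef p f + coef p g := by
  unfold coef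
  rw [← integral_add (integrable_ch_mul hf _) (integrable_ch_mul hg _)]
  simp only [mul_add]

lemma coef_const_mul (c : ℂ) (f : ℂ → ℂ) (p : ℂ) :
    coef p (fun z => c * f z) = c * coef p f := by
  unfold coef
  rw [← integral_const_mul]
  congr 1; ext x; ring

lemma coef_ch (m n : ℤ × ℤ) (p : ℂ) :
    coef (freq n + p) (ch (freq m + p)) = if m = n then 1 else 0 := by
  rw [coef_eq_sqCoeff]
  have h : ∀ x, sqExp (-n) x * (ch (-p) (latPt x) * ch (freq m + p) (latPt x)) =
      sqExp (m - n) x := by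
    intro x
    rw [ch_add_left, mul_left_comm (ch (-p) _), ch_neg_mul_ch, mul_one, ch_freq_latPt, sqExp,
      sqExp, ← Complex.exp_add]
    congr 1
    simp
    ring
  simp only [h, integral_sqExp, sub_eq_zero]

/-- Multiplication by an absolutely convergent Fourier series acts on coefficients as a
convolution. -/
lemma coef_series_mul {b : ℤ × ℤ → ℂ} (hb : Summable fun m => ‖b m‖) (r : ℤ × ℤ → ℂ)
    {f : ℂ → ℂ} (hf : MemL2loc f) (q : ℂ) :
    coef q (fun z => (∑' m, b m * ch (r m) z) * f z) = ∑' m, b m * coef (q - r m) f := by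
  have e : ∀ m x, ch (-q) (latPt x) * (b m * ch (r m) (latPt x) * f (latPt x)) =
      b m * (ch (-(q - r m)) (latPt x) * f (latPt x)) := by
    intro m x
    rw [show -(q - r m) = -q + r m by ring, ch_add_left]; ring
  have h := hasSum_integral_of_summable_integral_norm (μ := volume.restrict unitSq)
    (F := fun m x => ch (-q) (latPt x) * (b m * ch (r m) (latPt x) * f (latPt x)))
    (fun m => by
      simp only [e]
      exact (integrable_ch_mul hf _).const_mul _) (by
      simp only [norm_mul, norm_ch, one_mul, mul_one]
      simp only [integral_const_mul]
      exact hb.mul_right _)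
  refine Eq.trans ?_ (h.tsum_eq.symm.trans ?_)
  · unfold coef
    congr 1; ext x
    rw [tsum_mul_left, tsum_mul_right]
  · refine tsum_congr fun m => ?_
    simp only [e, integral_const_mul, coef]

lemma AEFloquet.eq_zero_of_unitSq {p : ℂ} {f : ℂ → ℂ} (hf : AEFloquet p f)
    (h : ∀ᵐ x ∂(volume.restrict unitSq), f (latPt x) = 0) : f =ᵐ[volume] 0 := by
  rw [ae_restrict_iff' measurableSet_unitSq] at h
  have h1 : ∀ᵐ x : ℝ × ℝ, ∀ m : ℤ × ℤ, (x + ((m.1 : ℝ), (m.2 : ℝ)) ∈ unitSq →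
      f (latPt (x + ((m.1 : ℝ), (m.2 : ℝ)))) = 0) := by
    rw [ae_all_iff]
    intro m
    exact (measurePreserving_add_right (volume : Measure (ℝ × ℝ))
      ((m.1 : ℝ), (m.2 : ℝ))).quasiMeasurePreserving.ae h
  have h2 : ∀ᵐ x : ℝ × ℝ, ∀ m : ℤ × ℤ, f (latPt x + latPt ((m.1 : ℝ), (m.2 : ℝ))) =
      ch p (latPt ((m.1 : ℝ), (m.2 : ℝ))) * f (latPt x) := by
    rw [ae_all_iff]
    intro m
    exact ae_latPt_iff.2 (hf _ (latPt_int_mem m.1 m.2))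
  refine ae_latPt_iff.1 ?_
  filter_upwards [h1, h2] with x hx1 hx2
  -- The integer `1 - ⌈s⌉` is the translation bringing `s` into the half-open interval `(0, 1]`.
  have key : ∀ s : ℝ, s + ((1 - ⌈s⌉ : ℤ) : ℝ) ∈ Set.Ioc (0 : ℝ) 1 := by
    intro s
    have := Int.ceil_lt_add_one s
    have := Int.le_ceil s
    constructor <;> push_cast <;> linarith
  have h3 := hx1 (1 - ⌈x.1⌉, 1 - ⌈x.2⌉) ⟨key _, key _⟩
  rw [latPt_add, hx2] at h3
  exact (mul_eq_zero.1 h3).resolve_left (ch_ne_zero _ _)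

/-- A Floquet function in `L²_loc` all of whose Fourier coefficients vanish is zero. -/
lemma AEFloquet.eq_zero_of_coef {p : ℂ} {f : ℂ → ℂ} (hf : AEFloquet p f) (hL : MemL2loc f)
    (h : ∀ n, coef (freq n + p) f = 0) : f =ᵐ[volume] 0 := by
  refine hf.eq_zero_of_unitSq ?_
  have h1 := ae_eq_zero_of_sqCoeff_eq_zero (memLp_ch_mul hL (-p)) (fun n => by
    rw [← coef_eq_sqCoeff, h])
  filter_upwards [h1] with x hx
  exact (mul_eq_zero.1 hx).resolve_left (ch_ne_zero _ _)

/-- The first order operator `a ∂_x + b ∂_y`. -/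
def dop (a b : ℂ) (g : ℂ → ℂ) (z : ℂ) : ℂ := a * fderiv ℝ g z 1 + b * fderiv ℝ g z Complex.I

/-- The symbol of `a ∂_x + b ∂_y`. -/
def sym (a b p : ℂ) : ℂ := Complex.I * (a * p.re + b * p.im)

lemma dop_ch (a b p z : ℂ) : dop a b (ch p) z = sym a b p * ch p z := by
  rw [dop, (hasFDerivAt_ch p z).fderiv, sym]
  simp [chForm_apply, pair_eq]
  ring

lemma dop_mul (a b : ℂ) {f g : ℂ → ℂ} {z : ℂ} (hf : DifferentiableAt ℝ f z)
    (hg : DifferentiableAt ℝ g z) :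
    dop a b (fun w => f w * g w) z = dop a b f z * g z + f z * dop a b g z := by
  have h : HasFDerivAt (fun w => f w * g w) _ z := hf.hasFDerivAt.mul hg.hasFDerivAt
  rw [dop, dop, dop, h.fderiv]
  simp
  ring

lemma sym_neg (a b p : ℂ) : sym a b (-p) = -sym a b p := by simp [sym]; ring

/-- Integration by parts on the fundamental cell for continuous Floquet functions that are
differentiable off a countable set. -/
lemma coef_dop {a b p q : ℂ} {g G : ℂ → ℂ} (hg : Continuous g) (hG : Continuous G)
    {s : Set ℂ} (hs : s.Countable) (hd : ∀ z ∉ s, DifferentiableAt ℝ g z)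
    (hgG : ∀ z ∉ s, G z = dop a b g z) (hF : IsFloquet p g) (hq : q - p ∈ dualLattice) :
    coef q G = sym a b q * coef q g := by
  have h3 := sqrt3_pos.ne'
  have h3c : (Real.sqrt 3 : ℂ) ≠ 0 := by exact_mod_cast h3
  have hper : ∀ γ ∈ lattice, ∀ z, ch (-q) (z + γ) * g (z + γ) = ch (-q) z * g z := by
    intro γ hγ z
    have := ((isFloquet_ch (-q)).mul (hF.shift hq)) γ hγ z
    simpa [ch_zero_left] using this
  -- Since `q - p ∈ Λ*`, the function `H` is `Λ`-periodic, and `Q = (a ∂_x + b ∂_y) H` off `s`. The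
  -- claim is that `Q` has zero integral over the cell.
  set H : ℂ → ℂ := fun z => ch (-q) z * g z with hH
  have hHc : Continuous H := (continuous_ch _).mul hg
  have hHd : ∀ z ∉ s, DifferentiableAt ℝ H z := fun z hz =>
    (hasFDerivAt_ch _ z).differentiableAt.mul (hd z hz)
  set Q : ℂ → ℂ := fun z => ch (-q) z * (G z - sym a b q * g z) with hQ
  have hQc : Continuous Q := (continuous_ch _).mul (hG.sub (continuous_const.mul hg))
  have hHQ : ∀ z ∉ s, Q z = dop a b H z := by
    intro z hz
    rw [hH, dop_mul a b (hasFDerivAt_ch _ z).differentiableAt (hd z hz), dop_ch, sym_neg,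
      ← hgG z hz, hQ]
    ring
  set S : Set (ℝ × ℝ) := latPt ⁻¹' s with hS
  have hSc : S.Countable := hs.preimage latEquiv.injective
  -- From `∂_s = ∂_x` and `∂_t = -½ ∂_x + (√3/2) ∂_y` one gets `a ∂_x + b ∂_y = A ∂_s + B ∂_t`.
  set A : ℂ := a + b / Real.sqrt 3 with hA
  set B : ℂ := 2 * b / Real.sqrt 3 with hB
  have hder : ∀ (c : ℂ) (x), x ∉ S → HasFDerivAt (fun y => c * H (latPt y))
      (c • ((fderiv ℝ H (latPt x)).comp (latEquiv : ℝ × ℝ →L[ℝ] ℂ))) x := by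
    intro c x hx
    exact ((hHd _ hx).hasFDerivAt.comp x (hasFDerivAt_latPt x)).const_mul c
  have hint : ∀ x, x ∉ S →
      (A • ((fderiv ℝ H (latPt x)).comp (latEquiv : ℝ × ℝ →L[ℝ] ℂ))) (1, 0) +
      (B • ((fderiv ℝ H (latPt x)).comp (latEquiv : ℝ × ℝ →L[ℝ] ℂ))) (0, 1) =
      Q (latPt x) := by
    intro x hx
    have e1 : latPt (1, 0) = 1 := by simp [latPt]
    have e2 : latPt (0, 1) = (-1 / 2 : ℝ) • (1 : ℂ) + (Real.sqrt 3 / 2 : ℝ) • Complex.I := by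
      simp [latPt, omega_eq]
    rw [hHQ _ hx, dop]
    simp only [_root_.smul_apply, ContinuousLinearMap.comp_apply, ContinuousLinearEquiv.coe_coe,
      latEquiv_apply, smul_eq_mul, e1, e2, map_add, map_smul]
    rw [Complex.real_smul, Complex.real_smul, hA, hB]
    push_cast
    field_simp
    ring
  have hQi : IntegrableOn (fun x => Q (latPt x)) (Set.Icc (0, 0) (1, 1)) :=
    (hQc.comp continuous_latPt).continuousOn.integrableOn_compact isCompact_Icc
  have hae : (fun x => (A • ((fderiv ℝ H (latPt x)).comp (latEquiv : ℝ × ℝ →L[ℝ] ℂ))) (1, 0) +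
      (B • ((fderiv ℝ H (latPt x)).comp (latEquiv : ℝ × ℝ →L[ℝ] ℂ))) (0, 1)) =ᵐ[volume]
      fun x => Q (latPt x) := by
    filter_upwards [hSc.ae_notMem volume] with x hx
    exact hint x hx
  have hc1 : ∀ c : ℂ, ContinuousOn (fun y => c * H (latPt y)) (Set.Icc (0, 0) (1, 1)) :=
    fun c => (continuous_const.mul (hHc.comp continuous_latPt)).continuousOn
  -- This form of the divergence theorem tolerates a countable set of points without
  -- differentiability, which later accommodates the translated lattice of poles.
  have key := integral_divergence_prod_Icc_of_hasFDerivAt_off_countable_of_le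
    (fun y => A * H (latPt y)) (fun y => B * H (latPt y)) _ _ (0, 0) (1, 1)
    (by simp [Prod.le_def]) S hSc (hc1 A) (hc1 B) (fun x hx => hder A x hx.2)
    (fun x hx => hder B x hx.2) (hQi.congr (ae_restrict_of_ae hae.symm))
  rw [integral_congr_ae (ae_restrict_of_ae hae)] at key
  -- By periodicity the fluxes through opposite sides cancel.
  have p1 : ∀ x : ℝ, H (latPt (x, 1)) = H (latPt (x, 0)) := by
    intro x
    have := hper ω₃ omega_mem_lattice (latPt (x, 0))
    rw [show latPt (x, 1) = latPt (x, 0) + ω₃ by simp [latPt]]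
    exact this
  have p2 : ∀ y : ℝ, H (latPt (1, y)) = H (latPt (0, y)) := by
    intro y
    have := hper 1 one_mem_lattice (latPt (0, y))
    rw [show latPt (1, y) = latPt (0, y) + 1 by simp [latPt]; ring]
    exact this
  simp only [p1, p2] at key
  have hsq : unitSq =ᵐ[volume] Set.Icc ((0 : ℝ), (0 : ℝ)) (1, 1) := by
    rw [← Set.Icc_prod_Icc]
    exact Measure.set_prod_ae_eq Ioc_ae_eq_Icc Ioc_ae_eq_Icc
  rw [← setIntegral_congr_set hsq] at key
  have hfin : ∫ x in unitSq, Q (latPt x) = coef q G - sym a b q * coef q g := by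
    unfold coef
    rw [← integral_const_mul, ← integral_sub]
    · congr 1; ext x; simp only [hQ]; ring
    · exact integrable_ch_mul (Continuous.memL2loc hG) _
    · exact (integrable_ch_mul (Continuous.memL2loc hg) _).const_mul _
  rw [hfin] at key
  have : coef q G - sym a b q * coef q g = 0 := by rw [key]; ring
  exact sub_eq_zero.1 this

end FloquetFourier

/-! ### Periodic partition of unity and Fourier coefficients of weak solutions. -/

section WeakDerivatives

/-- A smooth step from `0` to `1`, constant near the integers. -/
def stepFn (s : ℝ) : ℝ := Real.smoothTransition (2 * s - 1 / 2)

lemma stepFn_of_le {s : ℝ} (h : s ≤ 1 / 4) : stepFn s = 0 :=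
  Real.smoothTransition.zero_of_nonpos (by linarith)

lemma stepFn_of_ge {s : ℝ} (h : 3 / 4 ≤ s) : stepFn s = 1 :=
  Real.smoothTransition.one_of_one_le (by linarith)

lemma contDiff_stepFn : ContDiff ℝ ∞ stepFn :=
  Real.smoothTransition.contDiff.comp (by fun_prop)

/-- A smooth bump whose integer translates form a partition of unity. -/
def bumpFn (s : ℝ) : ℝ := stepFn s - stepFn (s - 1)

lemma contDiff_bumpFn : ContDiff ℝ ∞ bumpFn :=
  contDiff_stepFn.sub (contDiff_stepFn.comp (by fun_prop))

lemma bumpFn_eq_zero {s : ℝ} (h : s ∉ Set.Icc (1 / 4 : ℝ) (7 / 4)) : bumpFn s = 0 := by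
  rw [Set.mem_Icc, not_and_or, not_le, not_le] at h
  rcases h with h | h
  · rw [bumpFn, stepFn_of_le h.le, stepFn_of_le (by linarith), sub_zero]
  · rw [bumpFn, stepFn_of_ge (by linarith), stepFn_of_ge (by linarith), sub_self]

lemma bumpFn_add_bumpFn {s : ℝ} (h1 : -1 / 4 ≤ s) (h2 : s ≤ 5 / 4) :
    bumpFn s + bumpFn (s + 1) = 1 := by
  rw [bumpFn, bumpFn, stepFn_of_ge (s := s + 1) (by linarith),
    stepFn_of_le (s := s - 1) (by linarith), show s + 1 - 1 = s by ring]
  ring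

lemma differentiable_bumpFn : Differentiable ℝ bumpFn :=
  contDiff_bumpFn.differentiable (by simp)

lemma continuous_deriv_bumpFn : Continuous (deriv bumpFn) :=
  contDiff_bumpFn.continuous_deriv (by simp)

lemma deriv_bumpFn_eq_zero {s : ℝ} (h : s ∉ Set.Icc (1 / 4 : ℝ) (7 / 4)) :
    deriv bumpFn s = 0 := by
  have : bumpFn =ᶠ[nhds s] fun _ => 0 := by
    filter_upwards [isClosed_Icc.isOpen_compl.mem_nhds h] with t ht
    exact bumpFn_eq_zero ht
  rw [this.deriv_eq, deriv_const]

lemma deriv_bumpFn_add {s : ℝ} (h1 : 0 ≤ s) (h2 : s ≤ 1) :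
    deriv bumpFn s + deriv bumpFn (s + 1) = 0 := by
  have h : (fun t => bumpFn t + bumpFn (t + 1)) =ᶠ[nhds s] fun _ => 1 := by
    filter_upwards [Icc_mem_nhds (a := -1 / 4) (b := 5 / 4) (x := s) (by linarith) (by linarith)]
      with t ht
    exact bumpFn_add_bumpFn ht.1 ht.2
  have h3 := h.deriv_eq
  have h4 : HasDerivAt (fun t => bumpFn t + bumpFn (t + 1))
      (deriv bumpFn s + deriv bumpFn (s + 1)) s :=
    (differentiable_bumpFn s).hasDerivAt.add
      ((differentiable_bumpFn (s + 1)).hasDerivAt.comp_add_const s 1)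
  rwa [deriv_const, h4.deriv] at h3

lemma integral_add_three {α : Type*} [MeasurableSpace α] {μ : Measure α} {f g h : α → ℂ}
    (hf : Integrable f μ) (hg : Integrable g μ) (hh : Integrable h μ) :
    ∫ x, (f x + g x + h x) ∂μ = ∫ x, f x ∂μ + ∫ x, g x ∂μ + ∫ x, h x ∂μ := by
  rw [integral_add (f := fun x => f x + g x) (hf.add hg) hh, integral_add hf hg]

lemma setIntegral_translate_unitSq (F : ℝ × ℝ → ℂ) (a b : ℝ) :
    ∫ x in Set.Ioc a (a + 1) ×ˢ Set.Ioc b (b + 1), F x = ∫ x in unitSq, F (x + (a, b)) := by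
  have h := (measurePreserving_add_right (volume : Measure (ℝ × ℝ)) (a, b)).setIntegral_preimage_emb
    (measurableEmbedding_addRight _) F (Set.Ioc a (a + 1) ×ˢ Set.Ioc b (b + 1))
  rw [← h]
  congr 2
  ext x
  simp only [unitSq, Set.mem_preimage, Set.mem_prod, Set.mem_Ioc, Prod.fst_add, Prod.snd_add]
  constructor
  · rintro ⟨⟨_, _⟩, _, _⟩; refine ⟨⟨?_, ?_⟩, ?_, ?_⟩ <;> linarith
  · rintro ⟨⟨_, _⟩, _, _⟩; refine ⟨⟨?_, ?_⟩, ?_, ?_⟩ <;> linarith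

lemma integral_unfold {F : ℝ × ℝ → ℂ} (hF : Integrable F)
    (h0 : ∀ x, x ∉ Set.Ioc (0 : ℝ) 2 ×ˢ Set.Ioc (0 : ℝ) 2 → F x = 0) :
    ∫ x, F x = ∫ x in unitSq,
      (F (x + (0, 0)) + F (x + (0, 1)) + F (x + (1, 0)) + F (x + (1, 1))) := by
  have hI : ∀ v : ℝ × ℝ, Integrable (fun x => F (x + v)) (volume.restrict unitSq) := fun v =>
    (hF.comp_add_right v).integrableOn
  rw [integral_add (f := fun x => F (x + (0, 0)) + F (x + (0, 1)) + F (x + (1, 0)))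
    (((hI _).add (hI _)).add (hI _)) (hI _), integral_add_three (hI _) (hI _) (hI _)]
  have hu : Set.Ioc (0 : ℝ) 2 = Set.Ioc (0 : ℝ) (0 + 1) ∪ Set.Ioc 1 (1 + 1) := by
    rw [zero_add, Set.Ioc_union_Ioc_eq_Ioc] <;> norm_num
  have hd : Disjoint (Set.Ioc (0 : ℝ) (0 + 1)) (Set.Ioc 1 (1 + 1)) := by
    rw [zero_add]; exact Set.Ioc_disjoint_Ioc_of_le le_rfl
  have m : ∀ a b : ℝ, MeasurableSet (Set.Ioc a (a + 1) ×ˢ Set.Ioc b (b + 1)) := fun a b =>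
    measurableSet_Ioc.prod measurableSet_Ioc
  rw [← setIntegral_eq_integral_of_forall_compl_eq_zero h0, hu, Set.union_prod,
    setIntegral_union (Set.disjoint_prod.2 (Or.inl hd))
      (measurableSet_Ioc.prod (measurableSet_Ioc.union measurableSet_Ioc))
      hF.integrableOn hF.integrableOn, Set.prod_union, Set.prod_union,
    setIntegral_union (Set.disjoint_prod.2 (Or.inr hd)) (m _ _) hF.integrableOn hF.integrableOn,
    setIntegral_union (Set.disjoint_prod.2 (Or.inr hd)) (m _ _) hF.integrableOn hF.integrableOn]
  simp only [setIntegral_translate_unitSq]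
  ring

/-- The factor `ch (-q) * f` is `Λ`-periodic almost everywhere because `q - p ∈ Λ*`, and the cutoff
lives in four unit squares. Folding them onto one square leaves the sums of translates of the
cutoffs. -/
lemma integral_bump_mul {η₁ η₂ : ℝ → ℝ} (h1 : Continuous η₁) (h2 : Continuous η₂)
    (h1' : ∀ s, s ∉ Set.Icc (1 / 4 : ℝ) (7 / 4) → η₁ s = 0)
    (h2' : ∀ s, s ∉ Set.Icc (1 / 4 : ℝ) (7 / 4) → η₂ s = 0)
    {p q : ℂ} {f : ℂ → ℂ} (hL : MemL2loc f) (hf : AEFloquet p f) (hq : q - p ∈ dualLattice) :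
    Integrable (fun x : ℝ × ℝ => (η₁ x.1 * η₂ x.2 : ℂ) * (ch (-q) (latPt x) * f (latPt x))) ∧
    ∫ x : ℝ × ℝ, (η₁ x.1 * η₂ x.2 : ℂ) * (ch (-q) (latPt x) * f (latPt x)) =
      ∫ x in unitSq, ((η₁ x.1 + η₁ (x.1 + 1)) * (η₂ x.2 + η₂ (x.2 + 1)) : ℂ) *
        (ch (-q) (latPt x) * f (latPt x)) := by
  set F : ℝ × ℝ → ℂ := fun x => (η₁ x.1 * η₂ x.2 : ℂ) * (ch (-q) (latPt x) * f (latPt x)) with hF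
  have hF0 : ∀ x, x ∉ Set.Icc (1 / 4 : ℝ) (7 / 4) ×ˢ Set.Icc (1 / 4 : ℝ) (7 / 4) → F x = 0 := by
    intro x hx
    rw [Set.mem_prod, not_and_or] at hx
    rcases hx with hx | hx
    · simp [hF, h1' _ hx]
    · simp [hF, h2' _ hx]
  have hFI : Integrable F := by
    set s := Set.Icc (1 / 4 : ℝ) (7 / 4) ×ˢ Set.Icc (1 / 4 : ℝ) (7 / 4) with hs
    have hsc : IsCompact s := isCompact_Icc.prod isCompact_Icc
    have : IsFiniteMeasure (volume.restrict s) := ⟨by simpa using hsc.measure_lt_top⟩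
    have hon : IntegrableOn F s := by
      have hfi : Integrable (f ∘ latPt) (volume.restrict s) :=
        (memLp_comp_latPt hL hsc.isBounded).integrable (by norm_num)
      have hc : Continuous fun x : ℝ × ℝ => (η₁ x.1 * η₂ x.2 : ℂ) * ch (-q) (latPt x) := by
        have := (continuous_ch (-q)).comp continuous_latPt
        fun_prop
      obtain ⟨C, hC⟩ := hsc.exists_bound_of_continuousOn hc.continuousOn
      refine (hfi.bdd_mul hc.aestronglyMeasurable
        (ae_restrict_of_forall_mem hsc.measurableSet hC)).congr ?_
      exact Filter.Eventually.of_forall fun x => by simp [hF]; ring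
    rw [integrableOn_iff_integrable_of_support_subset] at hon
    · exact hon
    · intro x hx
      by_contra h
      exact hx (hF0 x h)
  refine ⟨hFI, ?_⟩
  rw [integral_unfold hFI]
  · refine integral_congr_ae (ae_restrict_of_ae ?_)
    have hper : ∀ v : ℝ × ℝ, latPt v ∈ lattice → ∀ᵐ x : ℝ × ℝ,
        ch (-q) (latPt (x + v)) * f (latPt (x + v)) = ch (-q) (latPt x) * f (latPt x) := by
      intro v hv
      filter_upwards [ae_latPt_iff.2 (hf _ hv)] with x hx
      rw [latPt_add, hx, ch_add_right]
      have : ch (-q) (latPt v) * ch p (latPt v) = 1 := by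
        rw [← ch_add_left, show -q + p = -(q - p) by ring]
        rw [dualLattice_eq_range] at hq
        obtain ⟨n, hn⟩ := hq
        rw [← hn, ← freq_neg, ch_freq_lattice _ hv]
      linear_combination (ch (-q) (latPt x) * f (latPt x)) * this
    have m1 : latPt (0, 1) ∈ lattice := by exact_mod_cast latPt_int_mem 0 1
    have m2 : latPt (1, 0) ∈ lattice := by exact_mod_cast latPt_int_mem 1 0
    have m3 : latPt (1, 1) ∈ lattice := by exact_mod_cast latPt_int_mem 1 1
    filter_upwards [hper _ m1, hper _ m2, hper _ m3] with x e1 e2 e3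
    simp only [hF, e1, e2, e3, Prod.mk_zero_zero, add_zero, Prod.fst_add, Prod.snd_add]
    ring
  · intro x hx
    refine hF0 x fun h => hx ⟨?_, ?_⟩
    · exact ⟨by linarith [h.1.1], by linarith [h.1.2]⟩
    · exact ⟨by linarith [h.2.1], by linarith [h.2.2]⟩

/-- The real linear form giving the first lattice coordinate. -/
def coordS : ℂ →L[ℝ] ℝ := (ContinuousLinearMap.fst ℝ ℝ ℝ).comp (latEquiv.symm : ℂ →L[ℝ] ℝ × ℝ)

/-- The real linear form giving the second lattice coordinate. -/
def coordT : ℂ →L[ℝ] ℝ := (ContinuousLinearMap.snd ℝ ℝ ℝ).comp (latEquiv.symm : ℂ →L[ℝ] ℝ × ℝ)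

lemma coordS_latPt (x : ℝ × ℝ) : coordS (latPt x) = x.1 :=
  congrArg Prod.fst (latEquiv.symm_apply_apply x)

lemma coordT_latPt (x : ℝ × ℝ) : coordT (latPt x) = x.2 :=
  congrArg Prod.snd (latEquiv.symm_apply_apply x)

lemma latPt_coord (z : ℂ) : latPt (coordS z, coordT z) = z := latEquiv.apply_symm_apply z

/-- A smooth compactly supported cutoff whose lattice translates form a partition of unity. -/
def cutoff (z : ℂ) : ℂ := ((bumpFn (coordS z) * bumpFn (coordT z) : ℝ) : ℂ)

lemma contDiff_cutoff : ContDiff ℝ ∞ cutoff :=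
  Complex.ofRealCLM.contDiff.comp
    ((contDiff_bumpFn.comp coordS.contDiff).mul (contDiff_bumpFn.comp coordT.contDiff))

lemma hasCompactSupport_cutoff : HasCompactSupport cutoff := by
  refine HasCompactSupport.intro (K := latPt '' (Set.Icc (1 / 4 : ℝ) (7 / 4) ×ˢ
    Set.Icc (1 / 4 : ℝ) (7 / 4)))
    ((isCompact_Icc.prod isCompact_Icc).image continuous_latPt) fun z hz => ?_
  have h : ¬ (coordS z ∈ Set.Icc (1 / 4 : ℝ) (7 / 4) ∧ coordT z ∈ Set.Icc (1 / 4 : ℝ) (7 / 4)) :=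
    fun h => hz ⟨(coordS z, coordT z), h, latPt_coord z⟩
  rw [not_and_or] at h
  rcases h with h | h
  · simp [cutoff, bumpFn_eq_zero h]
  · simp [cutoff, bumpFn_eq_zero h]

lemma dop_cutoff_latPt (a b : ℂ) (x : ℝ × ℝ) :
    dop a b cutoff (latPt x) =
      (a * coordS 1 + b * coordS Complex.I) * (deriv bumpFn x.1 * bumpFn x.2) +
      (a * coordT 1 + b * coordT Complex.I) * (bumpFn x.1 * deriv bumpFn x.2) := by
  have hS : HasFDerivAt (fun z => bumpFn (coordS z)) (deriv bumpFn x.1 • coordS) (latPt x) := by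
    have := (differentiable_bumpFn (coordS (latPt x))).hasDerivAt.comp_hasFDerivAt (latPt x)
      coordS.hasFDerivAt
    rwa [coordS_latPt] at this
  have hT : HasFDerivAt (fun z => bumpFn (coordT z)) (deriv bumpFn x.2 • coordT) (latPt x) := by
    have := (differentiable_bumpFn (coordT (latPt x))).hasDerivAt.comp_hasFDerivAt (latPt x)
      coordT.hasFDerivAt
    rwa [coordT_latPt] at this
  have h := Complex.ofRealCLM.hasFDerivAt.comp (latPt x) (hS.mul hT)
  have h2 : HasFDerivAt cutoff _ (latPt x) := h
  rw [dop, h2.fderiv]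
  simp [coordS_latPt, coordT_latPt]
  ring

/-- Weak solutions of `(a ∂_x + b ∂_y) f = g` satisfy the corresponding identity between Fourier
coefficients. -/
lemma coef_of_weak {a b p q : ℂ} {f g : ℂ → ℂ} (hf : MemL2loc f) (hg : MemL2loc g)
    (hFf : AEFloquet p f) (hFg : AEFloquet p g)
    (hw : ∀ Φ : ℂ → ℂ, ContDiff ℝ ∞ Φ → HasCompactSupport Φ →
      ∫ z, dop a b Φ z * f z = -∫ z, Φ z * g z)
    (hq : q - p ∈ dualLattice) : coef q g = sym a b q * coef q f := by
  obtain ⟨c, hc0, hc⟩ := exists_integral_latPt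
  -- Plane waves are not compactly supported; multiplied by a partition of unity they become test
  -- functions whose integrals over the plane reduce to integrals over one cell.
  set Φ : ℂ → ℂ := fun z => cutoff z * ch (-q) z with hΦ
  have h1 := hw Φ (contDiff_cutoff.mul (contDiff_ch _)) hasCompactSupport_cutoff.mul_right
  have cb := contDiff_bumpFn.continuous
  have cd := continuous_deriv_bumpFn
  have zb : ∀ s, s ∉ Set.Icc (1 / 4 : ℝ) (7 / 4) → bumpFn s = 0 := fun s => bumpFn_eq_zero
  have zd : ∀ s, s ∉ Set.Icc (1 / 4 : ℝ) (7 / 4) → deriv bumpFn s = 0 :=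
    fun s => deriv_bumpFn_eq_zero
  have hmass : ∀ {h : ℂ → ℂ}, MemL2loc h → AEFloquet p h →
      ∫ x : ℝ × ℝ, (bumpFn x.1 * bumpFn x.2 : ℂ) * (ch (-q) (latPt x) * h (latPt x)) =
        coef q h := by
    intro h hL hh
    rw [(integral_bump_mul cb cb zb zb hL hh hq).2, coef]
    refine setIntegral_congr_fun measurableSet_unitSq fun x hx => ?_
    have e1 : (bumpFn x.1 + bumpFn (x.1 + 1) : ℂ) = 1 := by
      exact_mod_cast bumpFn_add_bumpFn (s := x.1) (by linarith [hx.1.1]) (by linarith [hx.1.2])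
    have e2 : (bumpFn x.2 + bumpFn (x.2 + 1) : ℂ) = 1 := by
      exact_mod_cast bumpFn_add_bumpFn (s := x.2) (by linarith [hx.2.1]) (by linarith [hx.2.2])
    simp only [e1, e2, one_mul]
  -- Where the derivative falls on the cutoff the contribution vanishes, because the translates of
  -- the bump sum to a constant.
  have hz1 : ∫ x : ℝ × ℝ, (deriv bumpFn x.1 * bumpFn x.2 : ℂ) *
      (ch (-q) (latPt x) * f (latPt x)) = 0 := by
    rw [(integral_bump_mul cd cb zd zb hf hFf hq).2]
    refine setIntegral_eq_zero_of_forall_eq_zero fun x hx => ?_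
    have e1 : (deriv bumpFn x.1 + deriv bumpFn (x.1 + 1) : ℂ) = 0 := by
      exact_mod_cast deriv_bumpFn_add hx.1.1.le hx.1.2
    simp only [e1, zero_mul]
  have hz2 : ∫ x : ℝ × ℝ, (bumpFn x.1 * deriv bumpFn x.2 : ℂ) *
      (ch (-q) (latPt x) * f (latPt x)) = 0 := by
    rw [(integral_bump_mul cb cd zb zd hf hFf hq).2]
    refine setIntegral_eq_zero_of_forall_eq_zero fun x hx => ?_
    have e1 : (deriv bumpFn x.2 + deriv bumpFn (x.2 + 1) : ℂ) = 0 := by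
      exact_mod_cast deriv_bumpFn_add hx.2.1.le hx.2.2
    simp only [e1, zero_mul, mul_zero]
  have hcut : ∀ x, cutoff (latPt x) = (bumpFn x.1 * bumpFn x.2 : ℂ) := by
    intro x; rw [cutoff, coordS_latPt, coordT_latPt]; push_cast; rfl
  have hR : c * ∫ z, Φ z * g z = coef q g := by
    rw [← hc (fun z => Φ z * g z), ← hmass hg hFg]
    congr 1; ext x
    simp only [hΦ, hcut]; ring
  have hLft : c * ∫ z, dop a b Φ z * f z = - (sym a b q * coef q f) := by
    rw [← hc (fun z => dop a b Φ z * f z), ← hmass hf hFf]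
    have e : ∀ x, dop a b Φ (latPt x) * f (latPt x) =
        (a * coordS 1 + b * coordS Complex.I) * ((deriv bumpFn x.1 * bumpFn x.2 : ℂ) *
          (ch (-q) (latPt x) * f (latPt x))) +
        (a * coordT 1 + b * coordT Complex.I) * ((bumpFn x.1 * deriv bumpFn x.2 : ℂ) *
          (ch (-q) (latPt x) * f (latPt x))) +
        (-sym a b q) * ((bumpFn x.1 * bumpFn x.2 : ℂ) *
          (ch (-q) (latPt x) * f (latPt x))) := by
      intro x
      rw [hΦ, dop_mul a b ((contDiff_cutoff.differentiable (by simp)) _)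
        (hasFDerivAt_ch _ _).differentiableAt, dop_cutoff_latPt, dop_ch, sym_neg, hcut]
      ring
    simp only [e]
    have i1 := (integral_bump_mul cd cb zd zb hf hFf hq).1
    have i2 := (integral_bump_mul cb cd zb zd hf hFf hq).1
    have i3 := (integral_bump_mul cb cb zb zb hf hFf hq).1
    rw [integral_add_three (i1.const_mul _) (i2.const_mul _) (i3.const_mul _),
      integral_const_mul, integral_const_mul,
      integral_const_mul, hz1, hz2]
    ring
  rw [h1, mul_neg, hR] at hLft
  exact neg_injective hLft

end WeakDerivatives

/-! ### Rapidly decaying coefficients and smooth series. -/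

section SmoothSeries

/-- Sequences on `ℤ²` decaying faster than every power. -/
def RapidDecay (x : ℤ × ℤ → ℂ) : Prop := ∀ s : ℕ, ∃ B, ∀ n, wt n ^ s * ‖x n‖ ≤ B

lemma RapidDecay.summable_mul {x : ℤ × ℤ → ℂ} (hx : RapidDecay x) (s : ℕ) :
    Summable fun n => ‖x n‖ * wt n ^ s := by
  obtain ⟨B, hB⟩ := hx (s + 4)
  refine Summable.of_nonneg_of_le (fun n => by have := wt_pos n; positivity) (fun n => ?_)
    (summable_wt_inv.mul_left B)
  have h := wt_pos n
  rw [← div_eq_mul_inv, le_div_iff₀ (by positivity)]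
  calc ‖x n‖ * wt n ^ s * wt n ^ 4 = wt n ^ (s + 4) * ‖x n‖ := by ring
    _ ≤ B := hB n

lemma RapidDecay.summable {x : ℤ × ℤ → ℂ} (hx : RapidDecay x) : Summable fun n => ‖x n‖ := by
  simpa using hx.summable_mul 0

lemma RapidDecay.mul_of_le {x d : ℤ × ℤ → ℂ} (hx : RapidDecay x) {C : ℝ} (hC : 0 ≤ C)
    (hd : ∀ n, ‖d n‖ ≤ C * wt n) : RapidDecay fun n => d n * x n := by
  intro s
  obtain ⟨B, hB⟩ := hx (s + 1)
  refine ⟨C * B, fun n => ?_⟩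
  have h := wt_pos n
  rw [norm_mul]
  calc wt n ^ s * (‖d n‖ * ‖x n‖) ≤ wt n ^ s * (C * wt n * ‖x n‖) := by
        have := hd n
        gcongr
    _ = C * (wt n ^ (s + 1) * ‖x n‖) := by ring
    _ ≤ C * B := by have := hB n; gcongr

/-- The Floquet function with Fourier coefficients `x` at the frequencies `freq n + p`. -/
def ser (p : ℂ) (x : ℤ × ℤ → ℂ) (z : ℂ) : ℂ := ∑' n, x n * ch (freq n + p) z

lemma summable_ser {x : ℤ × ℤ → ℂ} (hx : Summable fun n => ‖x n‖) (p z : ℂ) :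
    Summable fun n => x n * ch (freq n + p) z :=
  Summable.of_norm (by simpa [norm_ch] using hx)

lemma continuous_ser {x : ℤ × ℤ → ℂ} (hx : Summable fun n => ‖x n‖) (p : ℂ) :
    Continuous (ser p x) :=
  continuous_tsum (fun n => continuous_const.mul (continuous_ch _)) hx
    (fun n z => by simp [norm_ch])

lemma isFloquet_ser (p : ℂ) (x : ℤ × ℤ → ℂ) : IsFloquet p (ser p x) := by
  intro γ hγ z
  rw [ser, ser, ← tsum_mul_left]
  refine tsum_congr fun n => ?_
  rw [ch_add_right, ch_add_left (freq n) p γ, ch_freq_lattice n hγ]; ring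

lemma coef_ser {x : ℤ × ℤ → ℂ} (hx : Summable fun n => ‖x n‖) (p : ℂ) (n : ℤ × ℤ) :
    coef (freq n + p) (ser p x) = x n := by
  have h := coef_series_mul hx (fun m => freq m + p) (f := fun _ => 1)
    (Continuous.memL2loc continuous_const) (freq n + p)
  simp only [mul_one] at h
  have h1 : (fun _ : ℂ => (1 : ℂ)) = ch (freq 0 + 0) := by
    ext z; rw [freq_zero, add_zero, ch_zero_left]
  have h2 : ∀ m, coef (freq n + p - (freq m + p)) (fun _ => 1) = if m = n then 1 else 0 := by
    intro m
    rw [h1, show freq n + p - (freq m + p) = freq (n - m) + 0 by rw [freq_sub]; ring, coef_ch]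
    simp [eq_comm, sub_eq_zero]
  simp only [h2] at h
  refine Eq.trans h ?_
  simp

lemma norm_sym_le (a b p : ℂ) : ‖sym a b p‖ ≤ (‖a‖ + ‖b‖) * ‖p‖ := by
  rw [sym, norm_mul, Complex.norm_I, one_mul]
  refine (norm_add_le _ _).trans ?_
  rw [norm_mul, norm_mul, Complex.norm_real, Complex.norm_real, add_mul]
  gcongr
  · exact Complex.abs_re_le_norm p
  · exact Complex.abs_im_le_norm p

lemma RapidDecay.sym_mul {x : ℤ × ℤ → ℂ} (hx : RapidDecay x) (a b p : ℂ) :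
    RapidDecay fun n => sym a b (freq n + p) * x n := by
  obtain ⟨C, hC0, hC⟩ := norm_freq_add_le p
  refine hx.mul_of_le (C := (‖a‖ + ‖b‖) * C) (by positivity) fun n => ?_
  refine (norm_sym_le _ _ _).trans ?_
  rw [mul_assoc]
  exact mul_le_mul_of_nonneg_left (hC n) (by positivity)

lemma hasFDerivAt_ser {x : ℤ × ℤ → ℂ} (hx : RapidDecay x) (p z : ℂ) :
    HasFDerivAt (ser p x) (∑' n, x n • (ch (freq n + p) z • chForm (freq n + p))) z ∧
      Summable fun n => x n • (ch (freq n + p) z • chForm (freq n + p)) := by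
  obtain ⟨C, hC0, hC⟩ := norm_freq_add_le p
  have hu : Summable fun n => 2 * C * (‖x n‖ * wt n ^ 1) := (hx.summable_mul 1).mul_left _
  have hb : ∀ n (w : ℂ), ‖x n • (ch (freq n + p) w • chForm (freq n + p))‖ ≤
      2 * C * (‖x n‖ * wt n ^ 1) := by
    intro n w
    rw [norm_smul, norm_smul, norm_ch, one_mul, pow_one]
    calc ‖x n‖ * ‖chForm (freq n + p)‖ ≤ ‖x n‖ * (2 * (C * wt n)) := by
          refine mul_le_mul_of_nonneg_left ((norm_chForm_le _).trans ?_) (norm_nonneg _)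
          exact mul_le_mul_of_nonneg_left (hC n) (by norm_num)
      _ = _ := by ring
  refine ⟨?_, Summable.of_norm_bounded hu fun n => hb n z⟩
  exact hasFDerivAt_tsum hu (fun n w => (hasFDerivAt_ch _ w).const_mul (x n)) hb
    (summable_ser hx.summable p 0) z

lemma differentiable_ser {x : ℤ × ℤ → ℂ} (hx : RapidDecay x) (p : ℂ) :
    Differentiable ℝ (ser p x) := fun z => (hasFDerivAt_ser hx p z).1.differentiableAt

lemma dop_ser {x : ℤ × ℤ → ℂ} (hx : RapidDecay x) (a b p z : ℂ) :
    dop a b (ser p x) z = ser p (fun n => sym a b (freq n + p) * x n) z := by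
  obtain ⟨h1, h2⟩ := hasFDerivAt_ser hx p z
  have e : ∀ v, (∑' n, x n • (ch (freq n + p) z • chForm (freq n + p))) v =
      ∑' n, x n * (ch (freq n + p) z * (Complex.I * pair (freq n + p) v)) := by
    intro v
    have := (ContinuousLinearMap.apply ℝ ℂ v).map_tsum h2
    refine Eq.trans this (tsum_congr fun n => ?_)
    simp [chForm_apply]
  have s : ∀ v, Summable fun n => x n * (ch (freq n + p) z * (Complex.I * pair (freq n + p) v)) := by
    intro v
    refine ((ContinuousLinearMap.apply ℝ ℂ v).summable h2).congr fun n => ?_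
    simp [chForm_apply]
  rw [dop, h1.fderiv, e, e, ← tsum_mul_left, ← tsum_mul_left,
    ← ((s 1).mul_left a).tsum_add ((s Complex.I).mul_left b), ser]
  refine tsum_congr fun n => ?_
  simp [sym, pair_eq]
  ring

lemma continuous_fderiv_ser {x : ℤ × ℤ → ℂ} (hx : RapidDecay x) (p v : ℂ) :
    Continuous fun z => fderiv ℝ (ser p x) z v := by
  have h : ∀ z, fderiv ℝ (ser p x) z v = dop v.re v.im (ser p x) z := by
    intro z
    have hv : v = v.re • (1 : ℂ) + v.im • Complex.I := by simp [Complex.re_add_im]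
    conv_lhs => rw [hv]
    rw [map_add, map_smul, map_smul, dop, Complex.real_smul, Complex.real_smul]
  simp only [h, dop_ser hx]
  exact continuous_ser (hx.sym_mul _ _ _).summable p

end SmoothSeries

/-! ### Rapid decay of the coefficients of smooth Floquet functions. -/

section SmoothCoefficients

lemma norm_coef_le {f : ℂ → ℂ} (p : ℂ) : ‖coef p f‖ ≤ ∫ x in unitSq, ‖f (latPt x)‖ := by
  refine (norm_integral_le_integral_norm _).trans_eq ?_
  simp [norm_ch]

lemma IsFloquet.fderiv {p : ℂ} {g : ℂ → ℂ} (hF : IsFloquet p g) {γ : ℂ} (hγ : γ ∈ lattice)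
    (hg : Differentiable ℝ g) (z : ℂ) :
    fderiv ℝ g (z + γ) = ch p γ • fderiv ℝ g z := by
  have h1 : (fun w => g (w + γ)) = fun w => ch p γ * g w := by ext w; exact hF γ hγ w
  have h2 := congrArg (fun f => _root_.fderiv ℝ f z) h1
  simp only [fderiv_comp_add_right] at h2
  rw [h2]
  exact ((hg z).hasFDerivAt.const_mul (ch p γ)).fderiv

lemma IsFloquet.dop {p a b : ℂ} {g : ℂ → ℂ} (hF : IsFloquet p g) (hg : Differentiable ℝ g) :
    IsFloquet p (dop a b g) := by
  intro γ hγ z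
  rw [ChiralTBG.dop, hF.fderiv hγ hg, ChiralTBG.dop]
  simp; ring

lemma contDiff_dop {g : ℂ → ℂ} (hg : ContDiff ℝ ∞ g) (a b : ℂ) : ContDiff ℝ ∞ (dop a b g) := by
  have h : ContDiff ℝ ∞ (fderiv ℝ g) := hg.fderiv_right (by simp)
  exact (contDiff_const.mul (h.clm_apply contDiff_const)).add
    (contDiff_const.mul (h.clm_apply contDiff_const))

lemma norm_sym_one_I (p : ℂ) : ‖sym 1 Complex.I p‖ = ‖p‖ := by
  have : sym 1 Complex.I p = Complex.I * p := by
    rw [sym]; congr 1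
    conv_rhs => rw [← Complex.re_add_im p]
    ring
  rw [this, norm_mul, Complex.norm_I, one_mul]

/-- The symbol of `∂_x + i ∂_y` at `q` is `i q`, so each application of this operator gains one
factor `‖freq n + p‖`. The derivative is again smooth with the same multiplier, hence the induction.
-/
lemma norm_pow_mul_coef_le {p : ℂ} (s : ℕ) : ∀ {g : ℂ → ℂ}, ContDiff ℝ ∞ g → IsFloquet p g →
    ∃ B, ∀ n, ‖freq n + p‖ ^ s * ‖coef (freq n + p) g‖ ≤ B := by
  induction s with
  | zero => exact fun {g} _ _ => ⟨_, fun n => by simpa using norm_coef_le _⟩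
  | succ s ih =>
    intro g hg hF
    have hd : Differentiable ℝ g := hg.differentiable (by simp)
    obtain ⟨B, hB⟩ := ih (contDiff_dop hg 1 Complex.I) (hF.dop hd)
    refine ⟨B, fun n => ?_⟩
    have h1 := coef_dop (a := 1) (b := Complex.I) (q := freq n + p) hg.continuous
      (contDiff_dop hg 1 Complex.I).continuous Set.countable_empty (fun z _ => hd z)
      (fun z _ => rfl) hF (by rw [dualLattice_eq_range]; exact ⟨n, by ring⟩)
    have h2 := hB n
    rw [h1, norm_mul, norm_sym_one_I] at h2
    calc _ = ‖freq n + p‖ ^ s * (‖freq n + p‖ * ‖coef (freq n + p) g‖) := by ring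
      _ ≤ B := h2

/-- Fourier coefficients of smooth Floquet functions decay rapidly. -/
lemma rapidDecay_coef {p : ℂ} {g : ℂ → ℂ} (hg : ContDiff ℝ ∞ g) (hF : IsFloquet p g) :
    RapidDecay fun n => coef (freq n + p) g := by
  intro s
  obtain ⟨B0, hB0⟩ := norm_pow_mul_coef_le 0 hg hF
  obtain ⟨B, hB⟩ := norm_pow_mul_coef_le s hg hF
  refine ⟨(1 + ‖p‖) ^ s * (2 ^ (s - 1) * (B0 + B)), fun n => ?_⟩
  have h1 := wt_le_norm_freq_add p n
  have h2 : wt n ^ s ≤ (1 + ‖p‖) ^ s * (2 ^ (s - 1) * (1 ^ s + ‖freq n + p‖ ^ s)) := by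
    calc wt n ^ s ≤ ((1 + ‖p‖) * (1 + ‖freq n + p‖)) ^ s :=
          pow_le_pow_left₀ (wt_pos n).le h1 s
      _ = (1 + ‖p‖) ^ s * (1 + ‖freq n + p‖) ^ s := mul_pow _ _ _
      _ ≤ _ := by
          gcongr
          exact add_pow_le zero_le_one (norm_nonneg _) s
  calc wt n ^ s * ‖coef (freq n + p) g‖
      ≤ (1 + ‖p‖) ^ s * (2 ^ (s - 1) * (1 ^ s + ‖freq n + p‖ ^ s)) * ‖coef (freq n + p) g‖ := by
        gcongr
    _ = (1 + ‖p‖) ^ s * (2 ^ (s - 1) * (‖freq n + p‖ ^ 0 * ‖coef (freq n + p) g‖ +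
          ‖freq n + p‖ ^ s * ‖coef (freq n + p) g‖)) := by rw [one_pow, pow_zero]; ring
    _ ≤ _ := by
        have := hB0 n
        have := hB n
        gcongr

/-- A continuous Floquet function with vanishing coefficients is zero. -/
lemma IsFloquet.eq_zero_of_coef {p : ℂ} {f : ℂ → ℂ} (hF : IsFloquet p f) (hf : Continuous f)
    (h : ∀ n, coef (freq n + p) f = 0) (z : ℂ) : f z = 0 := by
  have h1 := hF.ae.eq_zero_of_coef (Continuous.memL2loc hf) h
  exact congrFun ((hf.ae_eq_iff_eq volume continuous_const).1 h1) z

lemma eq_ser_of_contDiff {p : ℂ} {g : ℂ → ℂ} (hg : ContDiff ℝ ∞ g) (hF : IsFloquet p g) (z : ℂ) :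
    g z = ser p (fun n => coef (freq n + p) g) z := by
  have hs := (rapidDecay_coef hg hF).summable
  have hc := continuous_ser hs p
  have hc' : MemL2loc fun z => (-1) * ser p (fun n => coef (freq n + p) g) z :=
    Continuous.memL2loc (continuous_const.mul hc)
  have h : ∀ z, g z + (-1) * ser p (fun n => coef (freq n + p) g) z = 0 := by
    refine IsFloquet.eq_zero_of_coef (p := p) (hF.add ((isFloquet_ser p _).const_mul _))
      (hg.continuous.add (continuous_const.mul hc)) fun n => ?_
    rw [coef_add (Continuous.memL2loc hg.continuous) hc', coef_const_mul, coef_ser hs]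
    ring
  linear_combination h z

end SmoothCoefficients

/-! ### Fourier series of the potential. -/

section Potential

variable {K : ℂ} {U : ℂ → ℂ}

lemma IsChiralPotential.contDiff (hU : IsChiralPotential K U) : ContDiff ℝ ∞ U :=
  contDiff_iff_contDiffAt.2 fun z => (hU.analytic z).contDiffAt

/-- The multiplier `K` is rewritten as `-2K`, using `3K ∈ Λ*`, because `-2K = (k - K) - (k + K)` is
exactly the difference between the quasimomenta of the two components. -/
lemma IsChiralPotential.isFloquet (hU : IsChiralPotential K U) (hK : IsDiracPoint K) :
    IsFloquet (-(2 * K)) U := by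
  have h : IsFloquet K U := fun γ hγ z => by
    rw [hU.translation γ hγ z, ch, pair_comm]
  refine h.shift ?_
  rw [show -(2 * K) - K = -(3 * K) by ring]
  exact dualLattice_neg hK.three_mul_mem

/-- The Fourier coefficients of the potential, at the frequencies `freq m - 2K`. -/
def potCoef (K : ℂ) (U : ℂ → ℂ) (m : ℤ × ℤ) : ℂ := coef (freq m + -(2 * K)) U

lemma rapidDecay_potCoef (hU : IsChiralPotential K U) (hK : IsDiracPoint K) :
    RapidDecay (potCoef K U) := rapidDecay_coef hU.contDiff (hU.isFloquet hK)

lemma potential_eq_ser (hU : IsChiralPotential K U) (hK : IsDiracPoint K) (z : ℂ) :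
    U z = ser (-(2 * K)) (potCoef K U) z :=
  eq_ser_of_contDiff hU.contDiff (hU.isFloquet hK) z

/-- Rotation symmetry of the Fourier coefficients of the potential. -/
lemma potCoef_rot (hU : IsChiralPotential K U) (hK : IsDiracPoint K) {τ : Equiv.Perm (ℤ × ℤ)}
    (hτ : ∀ m, freq (τ m) + -(2 * K) = ω₃ * (freq m + -(2 * K))) (m : ℤ × ℤ) :
    potCoef K U (τ m) = ω₃ * potCoef K U m := by
  have hs := (rapidDecay_potCoef hU hK).summable
  have hs' : Summable fun m => ‖potCoef K U (τ m)‖ := τ.summable_iff.2 hs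
  have h : (fun z => ω₃ * U z) = ser (-(2 * K)) (fun m => potCoef K U (τ m)) := by
    ext z
    rw [← hU.rotation, potential_eq_ser hU hK (ω₃ * z), ser, ser, ← τ.tsum_eq]
    refine tsum_congr fun m => ?_
    rw [hτ, ch_omega_mul]
  rw [← coef_ser hs' (-(2 * K)) m, ← h, coef_const_mul]
  rfl

end Potential

/-! ### The first order system for two components in Fourier variables. -/

section FourierSystem

/-- Index set for the Fourier coefficients of `ℂ²`-valued functions. -/
abbrev Idx : Type := (ℤ × ℤ) × Fin 2

/-- The quasimomentum of the `j`-th component. -/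
def shiftK (K k : ℂ) (j : Fin 2) : ℂ := if j = 0 then k - K else k + K

/-- The frequencies of the `j`-th component. -/
def lam (K k : ℂ) (i : Idx) : ℂ := freq i.1 + shiftK K k i.2

lemma shiftIdx_involutive (m : ℤ × ℤ) :
    Function.Involutive fun i : Idx => (if i.2 = 0 then i.1 - m else i.1 + m, i.2 + 1) := by
  rintro ⟨n, j⟩
  fin_cases j <;> simp

/-- The involution of the index set induced by multiplication with the `m`-th Fourier mode of
the potential. -/
def shiftIdx (m : ℤ × ℤ) : Equiv.Perm Idx := (shiftIdx_involutive m).toPerm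

lemma shiftIdx_apply (m : ℤ × ℤ) (i : Idx) :
    shiftIdx m i = (if i.2 = 0 then i.1 - m else i.1 + m, i.2 + 1) := rfl

lemma shiftIdx_shiftIdx (m : ℤ × ℤ) (i : Idx) : shiftIdx m (shiftIdx m i) = i :=
  shiftIdx_involutive m i

/-- The multiplier of the `j`-th potential. -/
def potShift (K : ℂ) (j : Fin 2) : ℂ := if j = 0 then -(2 * K) else 2 * K

/-- The frequencies of the `j`-th potential. -/
def potFreq (K : ℂ) (j : Fin 2) (m : ℤ × ℤ) : ℂ := freq (if j = 0 then m else -m) + potShift K j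

/-- The `j`-th off-diagonal potential with Fourier coefficients `c`. -/
def pser (K : ℂ) (c : ℤ × ℤ → ℂ) (j : Fin 2) (z : ℂ) : ℂ := ∑' m, c m * ch (potFreq K j m) z

/-- This identity dictates `shiftIdx`: the frequency `lam K k i` in one component is fed by the
frequency at `shiftIdx m i` in the other. Both potentials use the same coefficients since `U (-z)`
has the opposite frequencies. -/
lemma lam_sub_potFreq (K k : ℂ) (m : ℤ × ℤ) (i : Idx) :
    lam K k i - potFreq K i.2 m = lam K k (shiftIdx m i) := by
  obtain ⟨n, j⟩ := i
  fin_cases j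
  · simp [lam, potFreq, shiftIdx_apply, shiftK, potShift, freq_sub]; ring
  · simp [lam, potFreq, shiftIdx_apply, shiftK, potShift, freq_add, freq_neg]; ring

lemma potShift_add_shiftK (K k : ℂ) (j : Fin 2) :
    potShift K j + shiftK K k (j + 1) = shiftK K k j := by
  fin_cases j
  · simp [potShift, shiftK]; ring
  · simp [potShift, shiftK]; ring

lemma continuous_pser (K : ℂ) {c : ℤ × ℤ → ℂ} (hc : Summable fun m => ‖c m‖) (j : Fin 2) :
    Continuous (pser K c j) :=
  continuous_tsum (fun _ => continuous_const.mul (continuous_ch _)) hc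
    (fun n z => by simp [norm_ch])

lemma isFloquet_pser (K : ℂ) (c : ℤ × ℤ → ℂ) (j : Fin 2) :
    IsFloquet (potShift K j) (pser K c j) := by
  intro γ hγ z
  rw [pser, pser, ← tsum_mul_left]
  refine tsum_congr fun n => ?_
  rw [potFreq, ch_add_right, ch_add_left _ _ γ, ch_freq_lattice _ hγ]; ring

lemma AEFloquet.pser_mul {K k : ℂ} {c : ℤ × ℤ → ℂ} {j : Fin 2} {f : ℂ → ℂ}
    (hf : AEFloquet (shiftK K k (j + 1)) f) :
    AEFloquet (shiftK K k j) fun z => pser K c j z * f z := by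
  intro γ hγ
  filter_upwards [hf γ hγ] with z hz
  rw [hz, isFloquet_pser K c j γ hγ, ← potShift_add_shiftK K k j, ch_add_left]
  ring

lemma IsFloquet.pser_mul {K k : ℂ} {c : ℤ × ℤ → ℂ} {j : Fin 2} {f : ℂ → ℂ}
    (hf : IsFloquet (shiftK K k (j + 1)) f) :
    IsFloquet (shiftK K k j) fun z => pser K c j z * f z := by
  intro γ hγ z
  simp only [hf γ hγ, isFloquet_pser K c j γ hγ]
  rw [← potShift_add_shiftK K k j, ch_add_left]
  ring

lemma MemL2loc.continuous_mul {f g : ℂ → ℂ} (hf : MemL2loc f) (hg : Continuous g) :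
    MemL2loc fun z => g z * f z := by
  intro s hs
  obtain ⟨C, hC⟩ := hs.exists_bound_of_continuousOn hg.continuousOn
  refine (hf s hs).of_le_mul (c := C) (hg.aestronglyMeasurable.mul (hf s hs).1) ?_
  refine ae_restrict_of_forall_mem hs.measurableSet fun z hz => ?_
  rw [norm_mul]
  exact mul_le_mul_of_nonneg_right (hC z hz) (norm_nonneg _)

lemma MemL2loc.add {f g : ℂ → ℂ} (hf : MemL2loc f) (hg : MemL2loc g) :
    MemL2loc fun z => f z + g z := fun s hs => (hf s hs).add (hg s hs)

lemma MemL2loc.const_mul {f : ℂ → ℂ} (hf : MemL2loc f) (c : ℂ) :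
    MemL2loc fun z => c * f z := fun s hs => (hf s hs).const_mul c

/-- The vector of Fourier coefficients of a `ℂ²`-valued Floquet function. -/
def coefVec (K k : ℂ) (f : Fin 2 → ℂ → ℂ) (i : Idx) : ℂ := coef (lam K k i) (f i.2)

lemma memℓp_coefVec {K k : ℂ} {f : Fin 2 → ℂ → ℂ} (hf : ∀ j, MemL2loc (f j)) :
    Memℓp (coefVec K k f) 2 := by
  rw [ell2_memℓp_iff, summable_prod_of_nonneg (fun i => by positivity)]
  refine ⟨fun n => Summable.of_finite, ?_⟩
  simp only [tsum_fintype, Fin.sum_univ_two]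
  exact (summable_sq_coef (hf 0) _).add (summable_sq_coef (hf 1) _)

lemma coef_rhs {K k E : ℂ} {c : ℤ × ℤ → ℂ} (hc : Summable fun m => ‖c m‖)
    {f h : Fin 2 → ℂ → ℂ} (hf : ∀ j, MemL2loc (f j)) (hh : ∀ j, MemL2loc (h j)) (i : Idx) :
    coef (lam K k i) (fun z => E * h i.2 z + (-1) * (pser K c i.2 z * f (i.2 + 1) z)) =
      E * coefVec K k h i - ∑' m, c m * coefVec K k f (shiftIdx m i) := by
  have h1 := (hf (i.2 + 1)).continuous_mul (continuous_pser K hc i.2)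
  rw [coef_add ((hh _).const_mul E) (h1.const_mul (-1)), coef_const_mul, coef_const_mul]
  have h2 := coef_series_mul hc (potFreq K i.2) (hf (i.2 + 1)) (lam K k i)
  have h3 : (fun z => (∑' m, c m * ch (potFreq K i.2 m) z) * f (i.2 + 1) z) =
      fun z => pser K c i.2 z * f (i.2 + 1) z := rfl
  rw [← h3, h2]
  simp only [lam_sub_potFreq]
  rw [coefVec, neg_one_mul, ← sub_eq_add_neg]
  rfl

/-- Fourier coefficients of a square integrable Floquet solution of the weak system. -/
lemma coefVec_of_weak {K k E a b : ℂ} {c : ℤ × ℤ → ℂ} (hc : Summable fun m => ‖c m‖)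
    {f h : Fin 2 → ℂ → ℂ} (hf : ∀ j, MemL2loc (f j)) (hh : ∀ j, MemL2loc (h j))
    (hFf : ∀ j, AEFloquet (shiftK K k j) (f j)) (hFh : ∀ j, AEFloquet (shiftK K k j) (h j))
    (hw : ∀ j, ∀ Φ : ℂ → ℂ, ContDiff ℝ ∞ Φ → HasCompactSupport Φ →
      ∫ z, dop a b Φ z * f j z =
        -∫ z, Φ z * (E * h j z + (-1) * (pser K c j z * f (j + 1) z))) (i : Idx) :
    sym a b (lam K k i) * coefVec K k f i + ∑' m, c m * coefVec K k f (shiftIdx m i) =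
      E * coefVec K k h i := by
  have hF : AEFloquet (shiftK K k i.2)
      (fun z => E * h i.2 z + (-1) * (pser K c i.2 z * f (i.2 + 1) z)) := by
    intro γ hγ
    filter_upwards [hFh i.2 γ hγ, (hFf (i.2 + 1)).pser_mul (c := c) γ hγ] with z h1 h2
    rw [h1, h2]; ring
  have h1 := (hf (i.2 + 1)).continuous_mul (continuous_pser K hc i.2)
  have key := coef_of_weak (q := lam K k i) (hf i.2)
    (((hh i.2).const_mul E).add (h1.const_mul (-1))) (hFf i.2) hF (hw i.2)
    (by rw [dualLattice_eq_range]; exact ⟨i.1, by simp [lam]⟩)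
  rw [coef_rhs hc hf hh] at key
  change _ = sym a b (lam K k i) * coefVec K k f i at key
  linear_combination -key

/-- Fourier coefficients of a continuous Floquet solution off a countable set. -/
lemma coefVec_of_off_countable {K k a b : ℂ} {c : ℤ × ℤ → ℂ} (hc : Summable fun m => ‖c m‖)
    {f : Fin 2 → ℂ → ℂ} (hf : ∀ j, Continuous (f j)) (hFf : ∀ j, IsFloquet (shiftK K k j) (f j))
    {s : Set ℂ} (hs : s.Countable) (hd : ∀ j, ∀ z ∉ s, DifferentiableAt ℝ (f j) z)
    (he : ∀ j, ∀ z ∉ s, dop a b (f j) z + pser K c j z * f (j + 1) z = 0) (i : Idx) :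
    sym a b (lam K k i) * coefVec K k f i + ∑' m, c m * coefVec K k f (shiftIdx m i) = 0 := by
  have hL := fun j => Continuous.memL2loc (hf j)
  have h0 : ∀ _ : Fin 2, MemL2loc fun _ : ℂ => (0 : ℂ) :=
    fun _ => Continuous.memL2loc continuous_const
  have key := coef_dop (a := a) (b := b) (p := shiftK K k i.2) (q := lam K k i) (hf i.2)
    (G := fun z => 0 * (fun (_ : Fin 2) (_ : ℂ) => (0 : ℂ)) i.2 z +
      (-1) * (pser K c i.2 z * f (i.2 + 1) z))
    (by have := continuous_pser K hc i.2; have := hf (i.2 + 1); fun_prop) hs (hd i.2)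
    (fun z hz => by have := he i.2 z hz; linear_combination -this) (hFf i.2)
    (by rw [dualLattice_eq_range]; exact ⟨i.1, by simp [lam]⟩)
  rw [coef_rhs (h := fun _ _ => 0) hc hL h0] at key
  change _ = sym a b (lam K k i) * coefVec K k f i at key
  linear_combination -key

/-- The smooth functions with prescribed Fourier coefficients. -/
def serVec (K k : ℂ) (x : Idx → ℂ) (j : Fin 2) : ℂ → ℂ := ser (shiftK K k j) fun n => x (n, j)

lemma coefVec_serVec {K k : ℂ} {x : Idx → ℂ} (hx : ∀ j, RapidDecay fun n => x (n, j)) :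
    coefVec K k (serVec K k x) = x := by
  ext i
  exact coef_ser (hx i.2).summable _ i.1

/-- Rapidly decaying solutions of the Fourier system give classical solutions. -/
lemma serVec_solves {K k E a b : ℂ} {c : ℤ × ℤ → ℂ} (hc : Summable fun m => ‖c m‖)
    {x y : Idx → ℂ} (hx : ∀ j, RapidDecay fun n => x (n, j))
    (hy : ∀ j, RapidDecay fun n => y (n, j))
    (he : ∀ i, sym a b (lam K k i) * x i + ∑' m, c m * x (shiftIdx m i) = E * y i)
    (j : Fin 2) (z : ℂ) :
    dop a b (serVec K k x j) z + pser K c j z * serVec K k x (j + 1) z =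
      E * serVec K k y j z := by
  have cx : ∀ j, Continuous (serVec K k x j) := fun j => continuous_ser (hx j).summable _
  have cy : ∀ j, Continuous (serVec K k y j) := fun j => continuous_ser (hy j).summable _
  have Fx : ∀ j, IsFloquet (shiftK K k j) (serVec K k x j) := fun j => isFloquet_ser _ _
  have Fy : ∀ j, IsFloquet (shiftK K k j) (serVec K k y j) := fun j => isFloquet_ser _ _
  have dx : ∀ z, dop a b (serVec K k x j) z =
      ser (shiftK K k j) (fun n => sym a b (lam K k (n, j)) * x (n, j)) z :=
    fun z => dop_ser (hx j) a b _ z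
  have hds := ((hx j).sym_mul a b (shiftK K k j)).summable
  have cdx : Continuous (ser (shiftK K k j) fun n => sym a b (lam K k (n, j)) * x (n, j)) :=
    continuous_ser hds _
  have cp := continuous_pser K hc j
  have hR : Continuous fun z => E * serVec K k y j z +
      (-1) * (pser K c j z * serVec K k x (j + 1) z) := by
    have := cx (j + 1); have := cy j; fun_prop
  -- The difference of the two sides is a continuous Floquet function whose coefficients vanish by
  -- the mode equations, so it is zero everywhere.
  have hzero := IsFloquet.eq_zero_of_coef (p := shiftK K k j)
    (f := fun z => ser (shiftK K k j) (fun n => sym a b (lam K k (n, j)) * x (n, j)) z +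
      (-1) * (E * serVec K k y j z + (-1) * (pser K c j z * serVec K k x (j + 1) z)))
    ((isFloquet_ser _ _).add (IsFloquet.const_mul _ (((Fy j).const_mul E).add
      (IsFloquet.const_mul _ (Fx (j + 1)).pser_mul))))
    (cdx.add (continuous_const.mul hR)) (fun n => by
      have hR' : MemL2loc fun z => (-1) * (E * serVec K k y j z +
          (-1) * (pser K c j z * serVec K k x (j + 1) z)) :=
        Continuous.memL2loc (continuous_const.mul hR)
      have h1 := coef_rhs (K := K) (k := k) (E := E) hc (fun j => Continuous.memL2loc (cx j))
        (fun j => Continuous.memL2loc (cy j)) (n, j)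
      rw [coefVec_serVec hx, coefVec_serVec hy] at h1
      have h2 := coef_ser hds (shiftK K k j) n
      simp only [lam] at h1
      rw [coef_add (Continuous.memL2loc cdx) hR', coef_const_mul, h1]
      have h3 := he (n, j)
      refine Eq.trans (congrArg (· + _) h2) ?_
      simp only [lam] at h3
      linear_combination h3) z
  rw [dx]
  linear_combination hzero

end FourierSystem

/-! ### Weak derivatives of components and complex test functions. -/

section WeakProjection

variable {F : Type*} [NormedAddCommGroup F]

lemma MemL2loc.locallyIntegrable {f : ℂ → F} (hf : MemL2loc f) : LocallyIntegrable f := by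
  rw [locallyIntegrable_iff]
  intro s hs
  have : IsFiniteMeasure (volume.restrict s) := ⟨by simpa using hs.measure_lt_top⟩
  exact (hf s hs).integrable (by norm_num)

variable [NormedSpace ℝ F]

lemma MemL2loc.integrable_smul {f : ℂ → F} (hf : MemL2loc f) {φ : ℂ → ℝ} (hφ : Continuous φ)
    (hc : HasCompactSupport φ) : Integrable fun z => φ z • f z :=
  hf.locallyIntegrable.integrable_smul_left_of_hasCompactSupport hφ hc

lemma continuous_fderiv_apply_of_contDiff {G : Type*} [NormedAddCommGroup G] [NormedSpace ℝ G]
    {φ : ℂ → G} (hφ : ContDiff ℝ ∞ φ) (v : ℂ) : Continuous fun z => fderiv ℝ φ z v :=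
  (hφ.continuous_fderiv (by simp)).clm_apply continuous_const

lemma MemL2loc.clm_comp {f : ℂ → F} (hf : MemL2loc f) (L : F →L[ℝ] ℂ) :
    MemL2loc fun z => L (f z) := fun s hs => L.comp_memLp' (hf s hs)

lemma IsWeakDeriv.clm_comp [CompleteSpace F] {v : ℂ} {f g : ℂ → F} (h : IsWeakDeriv v f g)
    (hf : MemL2loc f) (hg : MemL2loc g) (L : F →L[ℝ] ℂ) :
    IsWeakDeriv v (fun z => L (f z)) fun z => L (g z) := by
  intro φ hφ hc
  have h1 := L.integral_comp_comm (hf.integrable_smul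
    (continuous_fderiv_apply_of_contDiff hφ v) (hc.fderiv_apply (𝕜 := ℝ) v))
  have h2 := L.integral_comp_comm (hg.integrable_smul hφ.continuous hc)
  simp only [map_smul] at h1 h2
  rw [h1, h2, h φ hφ hc, map_neg]

/-- Real and imaginary parts of `Φ` are admissible real test functions. Complex ones are needed
because plane waves are used for testing. -/
lemma IsWeakDeriv.complex_test {v : ℂ} {f g : ℂ → ℂ} (h : IsWeakDeriv v f g)
    (hf : MemL2loc f) (hg : MemL2loc g) {Φ : ℂ → ℂ} (hΦ : ContDiff ℝ ∞ Φ)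
    (hc : HasCompactSupport Φ) :
    Integrable (fun z => fderiv ℝ Φ z v * f z) ∧ Integrable (fun z => Φ z * g z) ∧
      ∫ z, fderiv ℝ Φ z v * f z = -∫ z, Φ z * g z := by
  set φ : ℂ → ℝ := fun z => (Φ z).re
  set ψ : ℂ → ℝ := fun z => (Φ z).im
  have hφ : ContDiff ℝ ∞ φ := Complex.reCLM.contDiff.comp hΦ
  have hψ : ContDiff ℝ ∞ ψ := Complex.imCLM.contDiff.comp hΦ
  have cφ : HasCompactSupport φ := hc.comp_left (g := Complex.re) (by simp)
  have cψ : HasCompactSupport ψ := hc.comp_left (g := Complex.im) (by simp)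
  have dφ : ∀ z, fderiv ℝ φ z v = (fderiv ℝ Φ z v).re := by
    intro z
    have := Complex.reCLM.hasFDerivAt.comp z ((hΦ.differentiable (by simp)) z).hasFDerivAt
    have h2 : HasFDerivAt φ _ z := this
    rw [h2.fderiv]; rfl
  have dψ : ∀ z, fderiv ℝ ψ z v = (fderiv ℝ Φ z v).im := by
    intro z
    have := Complex.imCLM.hasFDerivAt.comp z ((hΦ.differentiable (by simp)) z).hasFDerivAt
    have h2 : HasFDerivAt ψ _ z := this
    rw [h2.fderiv]; rfl
  have i1 := hf.integrable_smul (continuous_fderiv_apply_of_contDiff hφ v)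
    (cφ.fderiv_apply (𝕜 := ℝ) v)
  have i2 := hf.integrable_smul (continuous_fderiv_apply_of_contDiff hψ v)
    (cψ.fderiv_apply (𝕜 := ℝ) v)
  have i3 := hg.integrable_smul hφ.continuous cφ
  have i4 := hg.integrable_smul hψ.continuous cψ
  have e1 : (fun z => fderiv ℝ Φ z v * f z) = fun z => fderiv ℝ φ z v • f z +
      Complex.I * (fderiv ℝ ψ z v • f z) := by
    ext z
    rw [dφ, dψ, Complex.real_smul, Complex.real_smul]
    conv_lhs => rw [← Complex.re_add_im (fderiv ℝ Φ z v)]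
    ring
  have e2 : (fun z => Φ z * g z) = fun z => φ z • g z + Complex.I * (ψ z • g z) := by
    ext z
    rw [Complex.real_smul, Complex.real_smul]
    conv_lhs => rw [← Complex.re_add_im (Φ z)]
    ring
  rw [e1, e2]
  refine ⟨i1.add (i2.const_mul _), i3.add (i4.const_mul _), ?_⟩
  rw [integral_add i1 (i2.const_mul _), integral_add i3 (i4.const_mul _), integral_const_mul,
    integral_const_mul, h φ hφ cφ, h ψ hψ cψ]
  ring

lemma dop_test_of_weakDeriv {a b : ℂ} {f fx fy G : ℂ → ℂ} (hf : MemL2loc f) (hx : MemL2loc fx)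
    (hy : MemL2loc fy) (h1 : IsWeakDeriv 1 f fx) (h2 : IsWeakDeriv Complex.I f fy)
    (hG : ∀ᵐ z, a * fx z + b * fy z = G z) {Φ : ℂ → ℂ} (hΦ : ContDiff ℝ ∞ Φ)
    (hc : HasCompactSupport Φ) :
    ∫ z, dop a b Φ z * f z = -∫ z, Φ z * G z := by
  obtain ⟨i1, j1, e1⟩ := h1.complex_test hf hx hΦ hc
  obtain ⟨i2, j2, e2⟩ := h2.complex_test hf hy hΦ hc
  have l : (fun z => dop a b Φ z * f z) = fun z => a * (fderiv ℝ Φ z 1 * f z) +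
      b * (fderiv ℝ Φ z Complex.I * f z) := by ext z; rw [dop]; ring
  have r : (fun z => Φ z * G z) =ᵐ[volume] fun z => a * (Φ z * fx z) + b * (Φ z * fy z) := by
    filter_upwards [hG] with z hz
    rw [← hz]; ring
  rw [l, integral_congr_ae r, integral_add (i1.const_mul _) (i2.const_mul _),
    integral_add (j1.const_mul _) (j2.const_mul _), integral_const_mul, integral_const_mul,
    integral_const_mul, integral_const_mul, e1, e2]
  ring

lemma IsWeakDeriv.of_differentiable {f : ℂ → F} (hf : Differentiable ℝ f) (v : ℂ)
    (hc : Continuous fun z => fderiv ℝ f z v) [SecondCountableTopologyEither ℂ F] :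
    IsWeakDeriv v f fun z => fderiv ℝ f z v := by
  intro φ hφ hcs
  have hL : MemL2loc f := Continuous.memL2loc hf.continuous
  have hL' : MemL2loc fun z => fderiv ℝ f z v := Continuous.memL2loc hc
  have := integral_smul_fderiv_eq_neg_fderiv_smul_of_integrable (𝕜 := ℝ) (μ := volume) (v := v)
    (hL.integrable_smul (continuous_fderiv_apply_of_contDiff hφ v)
      (hcs.fderiv_apply (𝕜 := ℝ) v))
    (hL'.integrable_smul hφ.continuous hcs) (hL.integrable_smul hφ.continuous hcs)
    (fun z _ => (hφ.differentiable (by simp)) z) (fun z _ => hf z)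
  rw [this, neg_neg]

end WeakProjection

/-! ### Scalar components of the translation condition and of the equation. -/

section Components

/-- The coordinate forms on `ℂ⁴`. -/
def comp4 (b : Bool) (j : Fin 2) : C4 →L[ℝ] ℂ :=
  (ContinuousLinearMap.proj j).comp
    (if b then ContinuousLinearMap.fst ℝ C2 C2 else ContinuousLinearMap.snd ℝ C2 C2)

lemma comp4_true (j : Fin 2) (u : C4) : comp4 true j u = u.1 j := rfl
lemma comp4_false (j : Fin 2) (u : C4) : comp4 false j u = u.2 j := rfl

/-- The diagonal twist only shifts quasimomenta: in both halves of `ℂ⁴` the two components are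
ordinary Floquet functions for `k - K` and `k + K`. -/
lemma transl_comp (K k γ : ℂ) (u : ℂ → C4) (z : ℂ) :
    transl K γ u z = Complex.exp (Complex.I * pair k γ) • u z ↔
      ∀ b j, comp4 b j (u (z + γ)) = ch (shiftK K k j) γ * comp4 b j (u z) := by
  have e1 : Complex.exp (Complex.I * pair γ K) = ch K γ := by rw [ch, pair_comm]
  have e2 : Complex.exp (-(Complex.I * pair γ K)) = ch (-K) γ := by
    rw [ch, pair_neg_left, pair_comm γ]; push_cast; ring_nf
  have e3 : Complex.exp (Complex.I * pair k γ) = ch k γ := rfl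
  have hs0 : ch (shiftK K k 0) γ = ch k γ * ch (-K) γ := by
    rw [shiftK, if_pos rfl, sub_eq_add_neg, ch_add_left]
  have hs1 : ch (shiftK K k 1) γ = ch k γ * ch K γ := by
    rw [shiftK, if_neg (by simp), ch_add_left]
  have hK := ch_neg_mul_ch K γ
  have hne := ch_ne_zero K γ
  have hne' := ch_ne_zero (-K) γ
  have a0 : ∀ s t : ℂ, ch K γ * s = ch k γ * t ↔ s = ch k γ * ch (-K) γ * t := by
    intro s t
    constructor
    · intro h
      linear_combination ch (-K) γ * h - s * hK
    · rintro rfl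
      linear_combination ch k γ * t * hK
  have a1 : ∀ s t : ℂ, ch (-K) γ * s = ch k γ * t ↔ s = ch k γ * ch K γ * t := by
    intro s t
    constructor
    · intro h
      linear_combination ch K γ * h - s * hK
    · rintro rfl
      linear_combination ch k γ * t * hK
  rw [Prod.ext_iff, funext_iff, funext_iff]
  simp only [transl, twist, e1, e2, e3, Matrix.mulVec_diagonal, Fin.forall_fin_two, Prod.smul_fst,
    Prod.smul_snd, Pi.smul_apply, smul_eq_mul, Bool.forall_bool, comp4_true, comp4_false, hs0, hs1,
    Matrix.cons_val_zero, Matrix.cons_val_one, a0, a1]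
  tauto

/-- The components of `opH` in terms of `dop`-type combinations. -/
lemma opH_eq_iff (U : ℂ → ℂ) (α z : ℂ) (E : ℝ) (u ux uy : C4) :
    opH U α z u ux uy = (E : ℂ) • u ↔
      ((-Complex.I) * ux.1 0 + 1 * uy.1 0 + α * U z * u.1 1 = E * u.2 0 ∧
       (-Complex.I) * ux.1 1 + 1 * uy.1 1 + α * U (-z) * u.1 0 = E * u.2 1) ∧
      ((-Complex.I) * ux.2 0 + (-1) * uy.2 0 + conj (α * U (-z)) * u.2 1 = E * u.1 0 ∧
       (-Complex.I) * ux.2 1 + (-1) * uy.2 1 + conj (α * U z) * u.2 0 = E * u.1 1) := by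
  have hI : ∀ s t : ℂ, -Complex.I * (s + Complex.I * t) = (-Complex.I) * s + 1 * t := by
    intro s t; linear_combination (-t) * Complex.I_sq
  have hI' : ∀ s t : ℂ, -Complex.I * (s - Complex.I * t) = (-Complex.I) * s + (-1) * t := by
    intro s t; linear_combination t * Complex.I_sq
  rw [Prod.ext_iff, funext_iff, funext_iff]
  simp only [opH, opD, opDstar, potMatrix, Fin.forall_fin_two, Pi.add_apply, Pi.smul_apply,
    smul_eq_mul, Pi.sub_apply, Prod.smul_fst, Prod.smul_snd, hI, hI',
    Matrix.mulVec, dotProduct, Fin.sum_univ_two, Matrix.conjTranspose_apply, Matrix.of_apply,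
    Matrix.cons_val', Matrix.cons_val_zero, Matrix.cons_val_one, Matrix.cons_val_fin_one,
    star_zero, zero_mul, zero_add, add_zero]
  exact and_comm

end Components

/-! ### Equivalence of Bloch eigenvalues and eigenvalues of the mode system. -/

/-- The Fourier coefficients of `αU`. -/
def potSeq (K : ℂ) (U : ℂ → ℂ) (α : ℂ) (m : ℤ × ℤ) : ℂ := α * potCoef K U m

/-- Multiplication by the potential on the Fourier side. -/
def potOp (K : ℂ) (U : ℂ → ℂ) (α : ℂ) : Ell2 Idx →L[ℂ] Ell2 Idx :=
  shiftOp (potSeq K U α) shiftIdx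

lemma sym_dbar (p : ℂ) : sym (-Complex.I) 1 p = p := by
  rw [sym]
  conv_rhs => rw [← Complex.re_add_im p]
  linear_combination (-(p.re : ℂ)) * Complex.I_sq

lemma sym_d (p : ℂ) : sym (-Complex.I) (-1) p = conj p := by
  rw [sym]
  conv_rhs => rw [← Complex.re_add_im p]
  simp only [map_add, map_mul, Complex.conj_ofReal, Complex.conj_I]
  linear_combination (-(p.re : ℂ)) * Complex.I_sq

lemma tendsto_norm_lam (K k : ℂ) :
    Filter.Tendsto (fun i => ‖lam K k i‖) Filter.cofinite Filter.atTop := by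
  rw [Filter.tendsto_atTop]
  intro R
  have h := fun j : Fin 2 => Filter.tendsto_atTop.1 (tendsto_norm_freq_add (shiftK K k j)) R
  simp only [Filter.eventually_cofinite] at h ⊢
  have h2 := Set.Finite.union ((h 0).image fun n => ((n, 0) : Idx))
    ((h 1).image fun n => ((n, 1) : Idx))
  refine h2.subset ?_
  rintro ⟨n, j⟩ hn
  fin_cases j
  · exact Or.inl ⟨n, hn, rfl⟩
  · exact Or.inr ⟨n, hn, rfl⟩

lemma exists_wt_le_lam (K k : ℂ) : ∃ C, 0 ≤ C ∧ ∀ i : Idx, wt i.1 ≤ C * (1 + ‖lam K k i‖) := by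
  refine ⟨(1 + ‖shiftK K k 0‖) + (1 + ‖shiftK K k 1‖), by positivity, ?_⟩
  rintro ⟨n, j⟩
  refine (wt_le_norm_freq_add (shiftK K k j) n).trans ?_
  refine mul_le_mul_of_nonneg_right ?_ (by positivity)
  fin_cases j <;> simp <;> positivity

lemma wt_le_shiftIdx (m : ℤ × ℤ) (i : Idx) : wt i.1 ≤ wt m * wt (shiftIdx m i).1 := by
  obtain ⟨n, j⟩ := i
  rw [shiftIdx_apply]
  fin_cases j
  · simpa using wt_add_le m (n - m)
  · simpa [wt_neg] using wt_add_le (-m) (n + m)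

section

variable {K : ℂ} {U : ℂ → ℂ}

lemma rapidDecay_potSeq (hU : IsChiralPotential K U) (hK : IsDiracPoint K) (α : ℂ) :
    RapidDecay (potSeq K U α) :=
  (rapidDecay_potCoef hU hK).mul_of_le (d := fun _ => α) (norm_nonneg α) fun n =>
    le_mul_of_one_le_right (norm_nonneg _) (one_le_wt n)

lemma summable_potSeq (hU : IsChiralPotential K U) (hK : IsDiracPoint K) (α : ℂ) :
    Summable fun m => ‖potSeq K U α m‖ := (rapidDecay_potSeq hU hK α).summable

lemma potOp_apply (hU : IsChiralPotential K U) (hK : IsDiracPoint K) (α : ℂ) (x : Ell2 Idx)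
    (i : Idx) : potOp K U α x i = ∑' m, potSeq K U α m * x (shiftIdx m i) :=
  shiftOp_apply (summable_potSeq hU hK α) _ _ _

lemma adjoint_potOp_apply (hU : IsChiralPotential K U) (hK : IsDiracPoint K) (α : ℂ)
    (x : Ell2 Idx) (i : Idx) : ContinuousLinearMap.adjoint (potOp K U α) x i =
      ∑' m, conj (potSeq K U α m) * x (shiftIdx m i) := by
  rw [potOp, adjoint_shiftOp (summable_potSeq hU hK α) _ shiftIdx_shiftIdx, shiftOp_apply]
  simpa using summable_potSeq hU hK α

lemma pser_zero (hU : IsChiralPotential K U) (hK : IsDiracPoint K) (α z : ℂ) :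
    pser K (potSeq K U α) 0 z = α * U z := by
  rw [potential_eq_ser hU hK z, pser, ser, ← tsum_mul_left]
  refine tsum_congr fun m => ?_
  simp [potSeq, potFreq, potShift, mul_assoc]

lemma potFreq_one (K : ℂ) (m : ℤ × ℤ) : potFreq K 1 m = -potFreq K 0 m := by
  simp [potFreq, potShift, freq_neg]; ring

lemma pser_one (hU : IsChiralPotential K U) (hK : IsDiracPoint K) (α z : ℂ) :
    pser K (potSeq K U α) 1 z = α * U (-z) := by
  rw [← pser_zero hU hK, pser, pser]
  refine tsum_congr fun m => ?_
  rw [potFreq_one, ch_neg_left, ch_neg_right]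

lemma conj_pser (c : ℤ × ℤ → ℂ) (j : Fin 2) (z : ℂ) :
    conj (pser K c j z) = pser K (fun m => conj (c m)) (j + 1) z := by
  rw [pser, pser, Complex.conj_tsum]
  refine tsum_congr fun m => ?_
  rw [map_mul, conj_ch]
  fin_cases j
  · simp [potFreq_one]
  · simp [potFreq_one]

/-- Square summable eigenvectors on the Fourier side decay rapidly. -/
lemma rapidDecay_of_mode (hU : IsChiralPotential K U) (hK : IsDiracPoint K) {α k : ℂ} {E : ℝ}
    {x y : Ell2 Idx} (h1 : ∀ i, lam K k i * x i + potOp K U α x i = E * y i)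
    (h2 : ∀ i, conj (lam K k i) * y i + ContinuousLinearMap.adjoint (potOp K U α) y i = E * x i)
    (j : Fin 2) : RapidDecay (fun n => x (n, j)) ∧ RapidDecay fun n => y (n, j) := by
  obtain ⟨C, hC0, hC⟩ := exists_wt_le_lam K k
  have hs := summable_potSeq hU hK α
  have hB : ∀ (x : Ell2 Idx) i, ‖x i‖ ≤ ‖x‖ := fun x i => lp.norm_apply_le_norm (by simp) x i
  have hsum : ∀ (x : Ell2 Idx) i, Summable fun m => ‖potSeq K U α m‖ * ‖x (shiftIdx m i)‖ :=
    fun x i => Summable.of_nonneg_of_le (fun m => by positivity)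
      (fun m => mul_le_mul_of_nonneg_left (hB x _) (norm_nonneg _)) (hs.mul_right ‖x‖)
  -- The bootstrap is run on `‖x i‖ + ‖y i‖`, so that the coupling of the two equations through `E`
  -- stays within the quantity being estimated.
  have key : ∀ s : ℕ, ∃ B, ∀ i : Idx, wt i.1 ^ s * (‖x i‖ + ‖y i‖) ≤ B := by
    refine decay_bootstrap (fun i : Idx => wt i.1) (fun i => (wt_pos _).le) wt
      (fun m => (wt_pos _).le) (fun i => ‖x i‖ + ‖y i‖) (fun i => ‖lam K k i‖)
      (fun i => by positivity) (fun i => add_le_add (hB x i) (hB y i)) hC0 hC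
      (fun m => ‖potSeq K U α m‖) (fun m => norm_nonneg _)
      (fun s => (rapidDecay_potSeq hU hK α).summable_mul s) (fun m => shiftIdx m)
      wt_le_shiftIdx (abs_nonneg E) fun i => ?_
    have e1 : ‖lam K k i‖ * ‖x i‖ ≤ |E| * ‖y i‖ +
        ∑' m, ‖potSeq K U α m‖ * ‖x (shiftIdx m i)‖ := by
      have e : lam K k i * x i = E * y i - ∑' m, potSeq K U α m * x (shiftIdx m i) := by
        rw [← potOp_apply hU hK, ← h1 i]; ring
      rw [← norm_mul, e]
      refine (norm_sub_le _ _).trans (add_le_add (by simp) ?_)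
      have h3 : Summable fun m => ‖potSeq K U α m * x (shiftIdx m i)‖ := by
        simpa only [norm_mul] using hsum x i
      simpa only [norm_mul] using norm_tsum_le_tsum_norm h3
    have e2 : ‖lam K k i‖ * ‖y i‖ ≤ |E| * ‖x i‖ +
        ∑' m, ‖potSeq K U α m‖ * ‖y (shiftIdx m i)‖ := by
      have e : conj (lam K k i) * y i =
          E * x i - ∑' m, conj (potSeq K U α m) * y (shiftIdx m i) := by
        rw [← adjoint_potOp_apply hU hK, ← h2 i]; ring
      have e' : ‖lam K k i‖ * ‖y i‖ = ‖conj (lam K k i) * y i‖ := by simp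
      rw [e', e]
      refine (norm_sub_le _ _).trans (add_le_add (by simp) ?_)
      have h3 : Summable fun m => ‖conj (potSeq K U α m) * y (shiftIdx m i)‖ := by
        simpa only [norm_mul, RCLike.norm_conj] using hsum y i
      simpa only [norm_mul, RCLike.norm_conj] using norm_tsum_le_tsum_norm h3
    simp only [mul_add]
    rw [(hsum x i).tsum_add (hsum y i)]
    linarith
  constructor
  · intro s
    obtain ⟨B, hB⟩ := key s
    refine ⟨B, fun n => le_trans ?_ (hB (n, j))⟩
    have := wt_pos n
    exact mul_le_mul_of_nonneg_left (by simp) (by positivity)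
  · intro s
    obtain ⟨B, hB⟩ := key s
    refine ⟨B, fun n => le_trans ?_ (hB (n, j))⟩
    have := wt_pos n
    exact mul_le_mul_of_nonneg_left (by simp) (by positivity)

end

lemma AEFloquet.eq_zero_of_coefVec {K k : ℂ} {f : Fin 2 → ℂ → ℂ} (hL : ∀ j, MemL2loc (f j))
    (hF : ∀ j, AEFloquet (shiftK K k j) (f j)) (h : coefVec K k f = 0) (j : Fin 2) :
    f j =ᵐ[volume] 0 :=
  (hF j).eq_zero_of_coef (hL j) fun n => congrFun h (n, j)

lemma comp4_fderiv {u : ℂ → C4} (hu : Differentiable ℝ u) (b : Bool) (j : Fin 2) (z v : ℂ) :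
    comp4 b j (fderiv ℝ u z v) = fderiv ℝ (fun z => comp4 b j (u z)) z v := by
  have := ((comp4 b j).hasFDerivAt.comp z (hu z).hasFDerivAt).fderiv
  rw [show (fun z => comp4 b j (u z)) = comp4 b j ∘ u from rfl, this]
  rfl

lemma continuous_C4_iff {X : Type*} [TopologicalSpace X] {u : X → C4} :
    Continuous u ↔ ∀ b j, Continuous fun x => comp4 b j (u x) := by
  refine ⟨fun h b j => (comp4 b j).continuous.comp h, fun h => ?_⟩
  exact (continuous_pi fun j => h true j).prodMk (continuous_pi fun j => h false j)

lemma differentiable_C4_iff {u : ℂ → C4} :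
    Differentiable ℝ u ↔ ∀ b j, Differentiable ℝ fun x => comp4 b j (u x) := by
  refine ⟨fun h b j => (comp4 b j).differentiable.comp h, fun h => ?_⟩
  exact (differentiable_pi.2 fun j => h true j).prodMk (differentiable_pi.2 fun j => h false j)

lemma ae_eq_zero_C4 {u : ℂ → C4} (h : ∀ b j, (fun x => comp4 b j (u x)) =ᵐ[volume] 0) :
    u =ᵐ[volume] 0 := by
  filter_upwards [h true 0, h true 1, h false 0, h false 1] with z h1 h2 h3 h4
  refine Prod.ext (funext fun j => ?_) (funext fun j => ?_)
  · fin_cases j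
    · exact h1
    · exact h2
  · fin_cases j
    · exact h3
    · exact h4

section

variable {K : ℂ} {U : ℂ → ℂ}

/-- Testing the weak equations against localized plane waves gives the mode equations; completeness
of the Fourier system keeps the eigenvector nonzero. -/
lemma IsBlochEigenvalue.mode (hU : IsChiralPotential K U) (hK : IsDiracPoint K) {α k : ℂ} {E : ℝ}
    (h : IsBlochEigenvalue K U α k E) : IsModeEigenvalue (lam K k) (potOp K U α) E := by
  obtain ⟨u, ux, uy, ⟨⟨hL, hF⟩, hLx, hLy, hx, hy⟩, hne, he⟩ := h
  set f : Bool → Fin 2 → ℂ → ℂ := fun b j z => comp4 b j (u z) with hf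
  have hLf : ∀ b j, MemL2loc (f b j) := fun b j => hL.clm_comp _
  have hFf : ∀ b j, AEFloquet (shiftK K k j) (f b j) := by
    intro b j γ hγ
    filter_upwards [hF γ hγ] with z hz
    exact (transl_comp K k γ u z).1 hz b j
  have hs := summable_potSeq hU hK α
  have hs' : Summable fun m => ‖conj (potSeq K U α m)‖ := by simpa using hs
  have he' := he.mono fun z hz => (opH_eq_iff U α z E (u z) (ux z) (uy z)).1 hz
  have h1 := coefVec_of_weak (E := E) (a := -Complex.I) (b := 1) hs (hLf true) (hLf false)
    (hFf true) (hFf false) (fun j Φ hΦ hc => by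
      refine dop_test_of_weakDeriv (hLf true j) (hLx.clm_comp _) (hLy.clm_comp _)
        (hx.clm_comp hL hLx (comp4 true j)) (hy.clm_comp hL hLy (comp4 true j)) ?_ hΦ hc
      filter_upwards [he'] with z hz
      fin_cases j
      · have h0 := hz.1.1
        have hp := pser_zero hU hK α z
        simp only [hf, Fin.zero_eta, zero_add, comp4_true, comp4_false, Fin.isValue] at h0 ⊢
        rw [hp]; linear_combination h0
      · have h0 := hz.1.2
        have hp := pser_one hU hK α z
        simp only [hf, Fin.mk_one, Fin.isValue, comp4_true, comp4_false,
          show (1 : Fin 2) + 1 = 0 from rfl] at h0 ⊢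
        rw [hp]; linear_combination h0)
  have h2 := coefVec_of_weak (E := E) (a := -Complex.I) (b := -1) hs' (hLf false) (hLf true)
    (hFf false) (hFf true) (fun j Φ hΦ hc => by
      refine dop_test_of_weakDeriv (hLf false j) (hLx.clm_comp _) (hLy.clm_comp _)
        (hx.clm_comp hL hLx (comp4 false j)) (hy.clm_comp hL hLy (comp4 false j)) ?_ hΦ hc
      filter_upwards [he'] with z hz
      fin_cases j
      · have h0 := hz.2.1
        have hp := conj_pser (K := K) (potSeq K U α) 1 z
        rw [pser_one hU hK] at hp
        simp only [hf, Fin.zero_eta, zero_add, comp4_true, comp4_false, Fin.isValue,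
          show (1 : Fin 2) + 1 = 0 from rfl] at h0 hp ⊢
        rw [← hp]; linear_combination h0
      · have h0 := hz.2.2
        have hp := conj_pser (K := K) (potSeq K U α) 0 z
        rw [pser_zero hU hK] at hp
        simp only [hf, Fin.mk_one, Fin.isValue, comp4_true, comp4_false, zero_add,
          show (1 : Fin 2) + 1 = 0 from rfl] at h0 hp ⊢
        rw [← hp]; linear_combination h0)
  simp only [sym_dbar] at h1
  simp only [sym_d] at h2
  refine ⟨⟨_, memℓp_coefVec (K := K) (k := k) (hLf true)⟩,
    ⟨_, memℓp_coefVec (K := K) (k := k) (hLf false)⟩, ?_, fun i => ?_, fun i => ?_⟩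
  · by_contra! hc
    refine hne (ae_eq_zero_C4 fun b j => ?_)
    refine AEFloquet.eq_zero_of_coefVec (hLf b) (hFf b) ?_ j
    cases b
    · exact congrArg Subtype.val hc.2
    · exact congrArg Subtype.val hc.1
  · rw [potOp_apply hU hK]; exact h1 i
  · rw [adjoint_potOp_apply hU hK]; exact h2 i

/-- By rapid decay the Fourier series converge to continuously differentiable functions, so the weak
derivatives may be taken to be the classical ones. -/
lemma IsModeEigenvalue.bloch (hU : IsChiralPotential K U) (hK : IsDiracPoint K) {α k : ℂ} {E : ℝ}
    (h : IsModeEigenvalue (lam K k) (potOp K U α) E) : IsBlochEigenvalue K U α k E := by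
  obtain ⟨x, y, hne, h1, h2⟩ := h
  have hs := summable_potSeq hU hK α
  have hs' : Summable fun m => ‖conj (potSeq K U α m)‖ := by simpa using hs
  have hd := rapidDecay_of_mode hU hK h1 h2
  have hx : ∀ j, RapidDecay fun n => x (n, j) := fun j => (hd j).1
  have hy : ∀ j, RapidDecay fun n => y (n, j) := fun j => (hd j).2
  have s1 := serVec_solves (k := k) (E := E) (a := -Complex.I) (b := 1) hs hx hy
    (fun i => by rw [sym_dbar, ← potOp_apply hU hK]; exact h1 i)
  have s2 := serVec_solves (k := k) (E := E) (a := -Complex.I) (b := -1) hs' hy hx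
    (fun i => by rw [sym_d, ← adjoint_potOp_apply hU hK]; exact h2 i)
  let w : Bool → Idx → ℂ := fun b => if b then x else y
  have hw : ∀ b j, RapidDecay fun n => w b (n, j) := by
    rintro (_ | _) j
    · exact hy j
    · exact hx j
  let u : ℂ → C4 := fun z => (fun j => serVec K k x j z, fun j => serVec K k y j z)
  have hcomp : ∀ b j, (fun z => comp4 b j (u z)) = serVec K k (w b) j := by
    rintro (_ | _) j <;> rfl
  have hud : Differentiable ℝ u := differentiable_C4_iff.2 fun b j => by
    rw [hcomp]; exact differentiable_ser (hw b j) _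
  have hcf : ∀ v, Continuous fun z => fderiv ℝ u z v := fun v =>
    continuous_C4_iff.2 fun b j => by
      simp only [comp4_fderiv hud, hcomp]
      exact continuous_fderiv_ser (hw b j) _ v
  have hdc : ∀ b j z v, fderiv ℝ (serVec K k (w b) j) z v = comp4 b j (fderiv ℝ u z v) := by
    intro b j z v
    rw [comp4_fderiv hud, hcomp]
  refine ⟨u, fun z => fderiv ℝ u z 1, fun z => fderiv ℝ u z Complex.I,
    ⟨⟨Continuous.memL2loc hud.continuous, fun γ hγ => ?_⟩, Continuous.memL2loc (hcf 1),
      Continuous.memL2loc (hcf Complex.I), IsWeakDeriv.of_differentiable hud _ (hcf _),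
      IsWeakDeriv.of_differentiable hud _ (hcf _)⟩, fun h0 => ?_, ?_⟩
  · refine Filter.Eventually.of_forall fun z => (transl_comp K k γ u z).2 fun b j => ?_
    have := isFloquet_ser (shiftK K k j) (fun n => w b (n, j)) γ hγ z
    have e := congrFun (hcomp b j)
    rw [e z, e (z + γ)]
    exact this
  · have hz : ∀ b j, serVec K k (w b) j =ᵐ[volume] 0 := fun b j => by
      rw [← hcomp]
      filter_upwards [h0] with z hz
      rw [hz]; exact map_zero _
    have hw0 : ∀ b, w b = 0 := fun b => by
      rw [← coefVec_serVec (K := K) (k := k) (hw b)]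
      ext i
      rw [coefVec, coef_congr_ae (hz b i.2)]
      have := coef_const_mul (0 : ℂ) (0 : ℂ → ℂ) (lam K k i)
      simpa [Pi.zero_def] using this
    rcases hne with h | h
    · exact h (by ext i; exact congrFun (hw0 true) i)
    · exact h (by ext i; exact congrFun (hw0 false) i)
  · refine Filter.Eventually.of_forall fun z => (opH_eq_iff U α z E _ _ _).2 ?_
    have p0 := pser_zero hU hK α z
    have p1 := pser_one hU hK α z
    have q0 := conj_pser (K := K) (potSeq K U α) 1 z
    have q1 := conj_pser (K := K) (potSeq K U α) 0 z
    rw [pser_one hU hK] at q0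
    rw [pser_zero hU hK] at q1
    simp only [zero_add, show (1 : Fin 2) + 1 = 0 from rfl] at q0 q1
    have d1 := fun j v => hdc true j z v
    have d2 := fun j v => hdc false j z v
    have a0 := s1 0 z
    have a1 := s1 1 z
    have b0 := s2 0 z
    have b1 := s2 1 z
    simp only [zero_add, show (1 : Fin 2) + 1 = 0 from rfl] at a0 a1 b0 b1
    rw [p0, dop] at a0
    rw [p1, dop] at a1
    rw [← q0, dop] at b0
    rw [← q1, dop] at b1
    change ∀ j v, fderiv ℝ (serVec K k x j) z v = (fderiv ℝ u z v).1 j at d1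
    change ∀ j v, fderiv ℝ (serVec K k y j) z v = (fderiv ℝ u z v).2 j at d2
    simp only [d1] at a0 a1
    simp only [d2] at b0 b1
    exact ⟨⟨a0, a1⟩, b0, b1⟩

lemma isBlochEigenvalue_iff (hU : IsChiralPotential K U) (hK : IsDiracPoint K) {α k : ℂ} {E : ℝ} :
    IsBlochEigenvalue K U α k E ↔ IsModeEigenvalue (lam K k) (potOp K U α) E :=
  ⟨fun h => h.mode hU hK, fun h => h.bloch hU hK⟩

/-- The smallest nonnegative Bloch eigenvalue exists. -/
lemma isLeast_E₁ (hU : IsChiralPotential K U) (hK : IsDiracPoint K) (α k : ℂ) :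
    IsLeast {E : ℝ | 0 ≤ E ∧ IsBlochEigenvalue K U α k E} (E₁ K U α k) := by
  obtain ⟨E, hE⟩ := exists_isLeast_modeEigenvalue (lam K k) (tendsto_norm_lam K k) (potOp K U α)
  simp only [← isBlochEigenvalue_iff hU hK] at hE
  rw [E₁, hE.csInf_eq]
  exact hE

lemma E₁_eq_zero_iff (hU : IsChiralPotential K U) (hK : IsDiracPoint K) (α k : ℂ) :
    E₁ K U α k = 0 ↔ IsModeEigenvalue (lam K k) (potOp K U α) 0 := by
  have h := isLeast_E₁ hU hK α k
  rw [← isBlochEigenvalue_iff hU hK]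
  constructor
  · intro h0
    rw [h0] at h
    exact h.1.2
  · intro h0
    exact le_antisymm (h.2 ⟨le_rfl, h0⟩) h.1.1

end

/-! ### Rotation symmetry and the protected state in the sector `K`. -/

lemma rotIdx_add (m n : ℤ × ℤ) : rotIdx (m + n) = rotIdx m + rotIdx n := by
  apply freq_injective
  simp only [freq_add, freq_rotIdx]; ring

lemma rotIdx_sub (m n : ℤ × ℤ) : rotIdx (m - n) = rotIdx m - rotIdx n := by
  apply freq_injective
  simp only [freq_sub, freq_rotIdx]; ring

lemma rotIdx_zero : rotIdx 0 = 0 := by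
  apply freq_injective
  simp only [freq_zero, freq_rotIdx]; ring

/-- The permutation of the frequencies of the sector `k = K` induced by the rotation; here
`freq b = 2 (ωK - K)`. -/
def rotPerm (b : ℤ × ℤ) : Equiv.Perm Idx where
  toFun i := if i.2 = 0 then (rotIdx i.1, 0) else (rotIdx i.1 + b, 1)
  invFun i := if i.2 = 0 then (rotIdx.symm i.1, 0) else (rotIdx.symm (i.1 - b), 1)
  left_inv := by
    rintro ⟨n, j⟩
    fin_cases j <;> simp
  right_inv := by
    rintro ⟨n, j⟩
    fin_cases j <;> simp

/-- The corresponding permutation of the frequencies of the potential. -/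
def rotPotPerm (b : ℤ × ℤ) : Equiv.Perm (ℤ × ℤ) := rotIdx.trans (Equiv.subRight b)

lemma shiftIdx_rotPerm (b m : ℤ × ℤ) (i : Idx) :
    shiftIdx (rotPotPerm b m) (rotPerm b i) = rotPerm b (shiftIdx m i) := by
  obtain ⟨n, j⟩ := i
  fin_cases j
  · simp [shiftIdx_apply, rotPerm, rotPotPerm, rotIdx_sub]; abel
  · simp [shiftIdx_apply, rotPerm, rotPotPerm, rotIdx_add]

section

variable {K : ℂ} {U : ℂ → ℂ}

lemma lam_rotPerm {b : ℤ × ℤ} (hb : freq b = 2 * (ω₃ * K - K)) (i : Idx) :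
    lam K K (rotPerm b i) = ω₃ * lam K K i := by
  obtain ⟨n, j⟩ := i
  fin_cases j
  · simp [lam, rotPerm, shiftK, freq_rotIdx]
  · simp [lam, rotPerm, shiftK, freq_rotIdx, freq_add, hb]; ring

lemma potOp_rot (hU : IsChiralPotential K U) (hK : IsDiracPoint K) (α : ℂ) {b : ℤ × ℤ}
    (hb : freq b = 2 * (ω₃ * K - K)) {s : ℂ} {x : Ell2 Idx}
    (hx : ∀ i, x (rotPerm b i) = s * x i) (i : Idx) :
    potOp K U α x (rotPerm b i) = ω₃ * s * potOp K U α x i := by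
  rw [potOp_apply hU hK, potOp_apply hU hK, ← (rotPotPerm b).tsum_eq, ← tsum_mul_left]
  refine tsum_congr fun m => ?_
  have h := potCoef_rot hU hK (τ := rotPotPerm b) (fun m => by
    simp only [rotPotPerm, Equiv.trans_apply, Equiv.subRight_apply, freq_sub, freq_rotIdx, hb]
    ring) m
  rw [shiftIdx_rotPerm, hx, potSeq, potSeq, h]
  ring

/-- The protected state: for every `α`, `D(α)` has a nontrivial kernel in the sector `k = K`. -/
lemma exists_kernel_at_K (hU : IsChiralPotential K U) (hK : IsDiracPoint K) (α : ℂ) :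
    ∃ x : Ell2 Idx, x ≠ 0 ∧ ∀ i, lam K K i * x i + potOp K U α x i = 0 := by
  obtain ⟨b, hb⟩ : ∃ b, freq b = 2 * (ω₃ * K - K) := by
    have h := dualLattice_add hK.rot hK.rot
    rw [dualLattice_eq_range] at h
    obtain ⟨b, hb⟩ := h
    exact ⟨b, by rw [hb]; ring⟩
  -- At `k = K` the unperturbed operator has a one-dimensional kernel: the constants in the first
  -- component.
  have h0 : ∀ i : Idx, lam K K i = 0 ↔ i = (0, 0) := by
    rintro ⟨n, j⟩
    fin_cases j
    · simp only [lam, shiftK, Fin.zero_eta, if_true, sub_self, add_zero, Prod.mk.injEq, and_true]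
      exact ⟨fun h => freq_injective (h.trans freq_zero.symm), fun h => h ▸ freq_zero⟩
    · simp only [lam, shiftK, Fin.mk_one, Prod.mk.injEq, one_ne_zero, if_false, and_false,
        iff_false]
      intro h
      refine hK.two_mul_notMem ?_
      rw [dualLattice_eq_range]
      exact ⟨-n, by rw [freq_neg]; linear_combination -h⟩
  have hρ0 : rotPerm b (0, 0) = (0, 0) := by simp [rotPerm, rotIdx_zero]
  -- The class `Y` consists of sequences picking up the factor `ω` under the rotation. The potential
  -- sends invariant sequences into `Y`, and dividing by `lam`, which itself picks up `ω`, leads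
  -- back to invariant ones.
  refine exists_kernel_of_symmetry_class (lam K K) (tendsto_norm_lam K K) (potOp K U α) (0, 0) h0
    { carrier := {x | ∀ i, x (rotPerm b i) = ω₃ * x i}
      add_mem' := fun {x y} hx hy i => by
        simp only [lp.coeFn_add, Pi.add_apply, hx i, hy i]; ring
      zero_mem' := fun i => by simp
      smul_mem' := fun c x hx i => by
        simp only [lp.coeFn_smul, Pi.smul_apply, hx i, smul_eq_mul]; ring } ?_ ?_ ?_ ?_
  · change IsClosed {x : Ell2 Idx | ∀ i, x (rotPerm b i) = ω₃ * x i}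
    rw [Set.ofPred_forall]
    exact isClosed_iInter fun i => isClosed_eq
      (lp.evalCLM ℂ (fun _ : Idx => ℂ) 2 (rotPerm b i)).continuous
      (continuous_const.mul (lp.evalCLM ℂ (fun _ : Idx => ℂ) 2 i).continuous)
  -- The zero frequency is fixed by the rotation, so its entry satisfies `f = ω f` and must vanish.
  · intro f hf
    have h : f (rotPerm b (0, 0)) = ω₃ * f (0, 0) := hf (0, 0)
    rw [hρ0] at h
    have h1 : (1 - ω₃) * f (0, 0) = 0 := by linear_combination h
    exact (mul_eq_zero.1 h1).resolve_left (sub_ne_zero.2 omega_ne_one.symm)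
  -- Such an `e` is supported at the fixed index `(0, 0)`, hence rotation invariant.
  · intro e he i
    rw [potOp_rot hU hK α hb (s := 1) (fun i => ?_) i, mul_one]
    rw [one_mul]
    by_cases hi : i = (0, 0)
    · rw [hi, hρ0]
    · have hi' : lam K K i ≠ 0 := fun h => hi ((h0 i).1 h)
      have h1 := (mul_eq_zero.1 (he i)).resolve_left hi'
      have h2 := (mul_eq_zero.1 (he (rotPerm b i))).resolve_left
        (by rw [lam_rotPerm hb]; exact mul_ne_zero omega_ne_zero hi')
      rw [h1, h2]
  · intro f hf x hx i
    rw [potOp_rot hU hK α hb (s := 1) (fun i => ?_) i, mul_one]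
    have h : f (rotPerm b i) = ω₃ * f i := hf i
    rw [hx, hx, lam_rotPerm hb, h, mul_inv]
    field_simp [omega_ne_zero]

end

/-! ### Theta functions and meromorphic functions with unitary multipliers. -/

/-- The infinite product `∏ (1 - q^n x)`. -/
def qProd (q x : ℂ) : ℂ := ∏' n : ℕ, (1 + -(q ^ n * x))

section

variable {q : ℂ}

lemma summable_qProd (hq : ‖q‖ < 1) (x : ℂ) : Summable fun n : ℕ => ‖-(q ^ n * x)‖ := by
  simpa using (summable_geometric_of_lt_one (norm_nonneg _) hq).mul_right ‖x‖

lemma qProd_eq (hq : ‖q‖ < 1) (x : ℂ) : qProd q x = (1 - x) * qProd q (q * x) := by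
  have h : (fun n : ℕ => 1 + -(q ^ (n + 1) * x)) = fun n => 1 + -(q ^ n * (q * x)) := by
    ext n; ring
  rw [qProd, tprod_eq_zero_mul', h, qProd]
  · ring
  · rw [h]; exact multipliable_one_add_of_summable (summable_qProd hq _)

lemma qProd_ne_zero (hq : ‖q‖ < 1) {x : ℂ} (hx : ∀ n : ℕ, q ^ n * x ≠ 1) : qProd q x ≠ 0 := by
  refine tprod_one_add_ne_zero_of_summable (fun n h => hx n ?_) (summable_qProd hq x)
  linear_combination -h

lemma differentiable_qProd (hq : ‖q‖ < 1) : Differentiable ℂ (qProd q) := by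
  intro x
  have hu : Summable fun n : ℕ => ‖q‖ ^ n * (‖x‖ + 1) :=
    (summable_geometric_of_lt_one (norm_nonneg _) hq).mul_right _
  have h := Summable.hasProdLocallyUniformlyOn_one_add (f := fun (n : ℕ) (x : ℂ) => -(q ^ n * x))
    (K := Metric.ball 0 (‖x‖ + 1)) Metric.isOpen_ball hu
    (.of_forall fun n y hy => by
      rw [norm_neg, norm_mul, norm_pow]
      exact mul_le_mul_of_nonneg_left (by simpa using (mem_ball_zero_iff.1 hy).le) (by positivity))
    (fun n => by fun_prop)
  exact (h.differentiableOn (.of_forall fun _ => by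
    simpa [Finset.prod_fn] using DifferentiableOn.finsetProd (fun _ _ => by fun_prop))
    Metric.isOpen_ball).differentiableAt (Metric.isOpen_ball.mem_nhds (by simp))

end

/-- The nome of the lattice. -/
def nome : ℂ := Complex.exp (2 * Real.pi * Complex.I * ω₃)

lemma norm_nome_lt_one : ‖nome‖ < 1 := by
  rw [nome, Complex.norm_exp]
  have : (2 * (Real.pi : ℂ) * Complex.I * ω₃).re = -(Real.pi * Real.sqrt 3) := by
    simp [omega_im]; ring
  rw [this, Real.exp_lt_one_iff]
  have := sqrt3_pos
  have := Real.pi_pos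
  nlinarith

/-- The variable `e^{2πiz}`. -/
def qexp (z : ℂ) : ℂ := Complex.exp (2 * Real.pi * Complex.I * z)

lemma qexp_add (z w : ℂ) : qexp (z + w) = qexp z * qexp w := by
  rw [qexp, mul_add, Complex.exp_add]; rfl
lemma qexp_neg (z : ℂ) : qexp (-z) = (qexp z)⁻¹ := by
  rw [qexp, mul_neg, Complex.exp_neg]; rfl
lemma qexp_ne_zero (z : ℂ) : qexp z ≠ 0 := Complex.exp_ne_zero _
lemma qexp_zero : qexp 0 = 1 := by simp [qexp]
lemma qexp_one : qexp 1 = 1 := by simp [qexp, Complex.exp_two_pi_mul_I]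
lemma qexp_omega : qexp ω₃ = nome := rfl
lemma qexp_eq_one {z : ℂ} (h : qexp z = 1) : ∃ n : ℤ, z = n := by
  rw [qexp, Complex.exp_eq_one_iff] at h
  obtain ⟨n, hn⟩ := h
  refine ⟨n, mul_left_cancel₀ Complex.two_pi_I_ne_zero ?_⟩
  linear_combination hn
lemma nome_pow_mul_qexp (n : ℕ) (z : ℂ) : nome ^ n * qexp z = qexp (n * ω₃ + z) := by
  rw [qexp_add, nome, ← Complex.exp_nat_mul, qexp, qexp]
  ring_nf
lemma differentiable_qexp : Differentiable ℂ qexp := by unfold qexp; fun_prop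

/-- The theta function of the lattice, in product form. -/
def theta (z : ℂ) : ℂ := qProd nome (qexp z) * qProd nome (nome * qexp (-z))

/-- The theta function without the factor vanishing at the origin. -/
def thetaRed (z : ℂ) : ℂ := qProd nome (nome * qexp z) * qProd nome (nome * qexp (-z))

lemma theta_eq (z : ℂ) : theta z = (1 - qexp z) * thetaRed z := by
  rw [theta, thetaRed, qProd_eq norm_nome_lt_one (qexp z)]; ring

lemma differentiable_theta : Differentiable ℂ theta := by
  have h1 := differentiable_qProd norm_nome_lt_one
  have h2 := differentiable_qexp
  unfold theta
  fun_prop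

lemma differentiable_thetaRed : Differentiable ℂ thetaRed := by
  have h1 := differentiable_qProd norm_nome_lt_one
  have h2 := differentiable_qexp
  unfold thetaRed
  fun_prop

lemma thetaRed_zero_ne_zero : thetaRed 0 ≠ 0 := by
  have h : qProd nome nome ≠ 0 := qProd_ne_zero norm_nome_lt_one fun n h => by
    have h1 := congrArg norm h
    rw [← pow_succ, norm_pow, norm_one] at h1
    exact (pow_lt_one₀ (norm_nonneg _) norm_nome_lt_one (Nat.succ_ne_zero n)).ne h1
  simpa [thetaRed, qexp_zero] using h

lemma theta_add_one (z : ℂ) : theta (z + 1) = theta z := by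
  rw [theta, theta, neg_add, qexp_add, qexp_add, qexp_neg 1, qexp_one]; simp

/-- The translation moves one factor from one product to the other: `1 - qexp z` is replaced by `1 -
qexp (-z)`, and their ratio is `-qexp (-z)`. -/
lemma theta_add_omega (z : ℂ) : theta (z + ω₃) = -qexp (-z) * theta z := by
  have h0 := qexp_ne_zero z
  have hn : nome ≠ 0 := Complex.exp_ne_zero _
  have e1 : qexp (z + ω₃) = nome * qexp z := by rw [qexp_add, qexp_omega, mul_comm]
  have e2 : nome * qexp (-(z + ω₃)) = qexp (-z) := by
    rw [neg_add, qexp_add, qexp_neg ω₃, qexp_omega]; field_simp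
  rw [theta, theta, e1, e2, qProd_eq norm_nome_lt_one (qexp (-z)),
    qProd_eq norm_nome_lt_one (qexp z), qexp_neg]
  field_simp
  ring

lemma mem_lattice_of_theta_eq_zero {z : ℂ} (h : theta z = 0) : z ∈ lattice := by
  by_contra hz
  refine mul_ne_zero (qProd_ne_zero norm_nome_lt_one fun n hn => hz ?_)
    (qProd_ne_zero norm_nome_lt_one fun n hn => hz ?_) h
  · rw [nome_pow_mul_qexp] at hn
    obtain ⟨m, hm⟩ := qexp_eq_one hn
    exact ⟨-n, m, by push_cast; linear_combination hm⟩
  · rw [← mul_assoc, ← pow_succ, nome_pow_mul_qexp] at hn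
    obtain ⟨m, hm⟩ := qexp_eq_one hn
    exact ⟨n + 1, -m, by push_cast at hm ⊢; linear_combination -hm⟩

/-- A property of translations which is stable under composition and inversion holds for the
lattice if it holds for the generators. -/
lemma lattice_induction {P : ℂ → Prop} (h1 : P 1) (hω : P ω₃) (hadd : ∀ a b, P a → P b → P (a + b))
    (hneg : ∀ a, P a → P (-a)) {γ : ℂ} (hγ : γ ∈ lattice) : P γ := by
  let S : AddSubgroup ℂ :=
    { carrier := {γ | P γ}
      add_mem' := fun {a b} ha hb => hadd a b ha hb
      zero_mem' := by simpa using hadd _ _ h1 (hneg _ h1)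
      neg_mem' := fun {a} ha => hneg a ha }
  obtain ⟨m, n, rfl⟩ := hγ
  have h := S.add_mem (S.zsmul_mem (x := ω₃) hω m) (S.zsmul_mem (x := 1) h1 n)
  simp only [zsmul_eq_mul, mul_one] at h
  exact h

lemma theta_eq_zero_iff (z : ℂ) : theta z = 0 ↔ z ∈ lattice := by
  refine ⟨mem_lattice_of_theta_eq_zero, fun hz => ?_⟩
  have h : ∀ w, theta (w + z) = 0 ↔ theta w = 0 := by
    refine lattice_induction (P := fun γ => ∀ w, theta (w + γ) = 0 ↔ theta w = 0) (fun w => ?_)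
      (fun w => ?_) (fun a b ha hb w => ?_) (fun a ha w => ?_) hz
    · rw [theta_add_one]
    · rw [theta_add_omega]; simp [qexp_ne_zero]
    · rw [← add_assoc, hb, ha]
    · rw [← ha (w + -a), neg_add_cancel_right]
  have := (h 0).2 (by rw [theta_eq, qexp_zero]; ring)
  simpa using this

lemma isClosed_lattice : IsClosed lattice := by
  have : lattice = theta ⁻¹' {0} := by ext z; simp [theta_eq_zero_iff]
  rw [this]
  exact isClosed_singleton.preimage differentiable_theta.continuous

lemma countable_lattice : lattice.Countable := by
  refine (Set.countable_range fun n : ℤ × ℤ => (n.1 : ℂ) * ω₃ + n.2).mono ?_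
  rintro _ ⟨m, n, rfl⟩
  exact ⟨(m, n), rfl⟩

lemma IsFloquet.of_generators {p : ℂ} {f : ℂ → ℂ} (h1 : ∀ z, f (z + 1) = ch p 1 * f z)
    (hω : ∀ z, f (z + ω₃) = ch p ω₃ * f z) : IsFloquet p f := fun γ hγ => by
  refine lattice_induction (P := fun γ => ∀ z, f (z + γ) = ch p γ * f z) h1 hω
    (fun a b ha hb w => ?_) (fun a ha w => ?_) hγ
  · rw [← add_assoc, hb, ha, ch_add_right]; ring
  · have h := ha (w + -a)
    rw [neg_add_cancel_right] at h
    rw [h, ch_neg_right, inv_mul_cancel_left₀ (ch_ne_zero p a)]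

/-- Meromorphic functions with a simple pole on the lattice and a given multiplier. -/
lemma exists_meromorphic_multiplier (p : ℂ) : ∃ F : ℂ → ℂ, IsFloquet p F ∧
    (∀ z ∉ lattice, DifferentiableAt ℂ F z) ∧
    (∃ L, Filter.Tendsto (fun z => z * F z) (nhdsWithin 0 {0}ᶜ) (nhds L)) ∧
    {z | F z = 0}.Countable := by
  set a : ℂ := Complex.I * pair p 1 with ha
  -- For `e^{az} θ(z - c) / θ(z)` the constant `a` fixes the multiplier of the translation `1`. The
  -- translation `ω` contributes `e^{aω} qexp c`, which determines `qexp c`.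
  obtain ⟨c, hc⟩ : ∃ c, qexp c = ch p ω₃ * Complex.exp (-(a * ω₃)) := by
    have h := Complex.exp_log (mul_ne_zero (ch_ne_zero p ω₃) (Complex.exp_ne_zero (-(a * ω₃))))
    refine ⟨(2 * Real.pi * Complex.I)⁻¹ * Complex.log (ch p ω₃ * Complex.exp (-(a * ω₃))), ?_⟩
    rw [qexp, mul_inv_cancel_left₀ Complex.two_pi_I_ne_zero, h]
  refine ⟨fun z => Complex.exp (a * z) * theta (z - c) / theta z, ?_, fun z hz => ?_, ?_, ?_⟩
  · refine IsFloquet.of_generators (fun z => ?_) fun z => ?_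
    · rw [theta_add_one, add_sub_right_comm, theta_add_one, mul_add, Complex.exp_add, mul_one, ch]
      ring
    · have h1 := qexp_ne_zero (-z)
      have h2 : qexp (-(z - c)) = qexp (-z) * qexp c := by rw [← qexp_add]; ring_nf
      have h3 : Complex.exp (a * ω₃) * Complex.exp (-(a * ω₃)) = 1 := by
        rw [← Complex.exp_add]; simp
      rw [theta_add_omega, add_sub_right_comm, theta_add_omega, mul_add, Complex.exp_add, h2, hc]
      have : Complex.exp (a * z) * Complex.exp (a * ω₃) *
          (-(qexp (-z) * (ch p ω₃ * Complex.exp (-(a * ω₃)))) * theta (z - c)) =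
          -qexp (-z) * (ch p ω₃ * (Complex.exp (a * z) * theta (z - c))) := by
        linear_combination (-Complex.exp (a * z) * qexp (-z) * ch p ω₃ * theta (z - c)) * h3
      rw [this, mul_div_mul_left _ _ (neg_ne_zero.2 h1), mul_div_assoc]
  · have h1 := differentiable_theta
    have h2 : theta z ≠ 0 := fun h => hz ((theta_eq_zero_iff z).1 h)
    exact DifferentiableAt.div (by fun_prop) (h1 z) h2
  · have hd : HasDerivAt (fun z => 1 - qexp z) (-(2 * Real.pi * Complex.I)) 0 := by
      have h := (((hasDerivAt_id (0 : ℂ)).const_mul (2 * Real.pi * Complex.I)).cexp).const_sub 1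
      simpa [qexp] using h
    -- The zero of `θ` at the origin comes from the factor `1 - qexp z`, which has nonzero
    -- derivative there; thus `z / (1 - qexp z)` has a limit.
    have h1 := hd.tendsto_slope.inv₀ (neg_ne_zero.2 Complex.two_pi_I_ne_zero)
    have hcont : ContinuousAt (fun z => Complex.exp (a * z) * theta (z - c) / thetaRed z) 0 := by
      have h3 := differentiable_theta
      exact ContinuousAt.div (Differentiable.continuous (𝕜 := ℂ) (by fun_prop)).continuousAt
        differentiable_thetaRed.continuous.continuousAt thetaRed_zero_ne_zero
    have h2 := h1.mul (hcont.tendsto.mono_left (nhdsWithin_le_nhds (s := {0}ᶜ)))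
    refine ⟨_, h2.congr fun z => ?_⟩
    simp only [slope, vsub_eq_sub, smul_eq_mul, theta_eq z, sub_zero, qexp_zero, sub_self, mul_inv,
      inv_inv, div_eq_mul_inv]
    ring
  · refine (countable_lattice.union ((countable_lattice.image fun w => w + c))).mono ?_
    intro z hz
    rcases div_eq_zero_iff.1 hz with h | h
    · exact Or.inr ⟨z - c, (theta_eq_zero_iff _).1
        ((mul_eq_zero.1 h).resolve_left (Complex.exp_ne_zero _)), by simp⟩
    · exact Or.inl ((theta_eq_zero_iff z).1 h)

/-! ### Liouville theorem for Floquet functions and the Cauchy–Riemann operator. -/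

lemma exists_latPt_reduce (z : ℂ) : ∃ γ ∈ lattice, ∃ x ∈ Set.Icc (0 : ℝ) 1 ×ˢ Set.Icc (0 : ℝ) 1,
    z = latPt x + γ := by
  set y := latEquiv.symm z with hy
  refine ⟨latPt (⌊y.1⌋, ⌊y.2⌋), latPt_int_mem _ _, (Int.fract y.1, Int.fract y.2),
    ⟨⟨Int.fract_nonneg _, (Int.fract_lt_one _).le⟩, ⟨Int.fract_nonneg _, (Int.fract_lt_one _).le⟩⟩,
    ?_⟩
  rw [← latPt_add]
  have : z = latPt y := (latEquiv.apply_symm_apply z).symm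
  rw [this]
  congr 1
  ext <;> simp

lemma IsFloquet.bounded {p : ℂ} {f : ℂ → ℂ} (hF : IsFloquet p f) (hf : Continuous f) :
    ∃ C, ∀ z, ‖f z‖ ≤ C := by
  obtain ⟨C, hC⟩ := (isCompact_Icc.prod isCompact_Icc).exists_bound_of_continuousOn
    (hf.comp continuous_latPt).continuousOn (s := Set.Icc (0 : ℝ) 1 ×ˢ Set.Icc (0 : ℝ) 1)
  refine ⟨C, fun z => ?_⟩
  obtain ⟨γ, hγ, x, hx, rfl⟩ := exists_latPt_reduce z
  rw [hF γ hγ, norm_mul, norm_ch, one_mul]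
  exact hC x hx

/-- Entire functions with a nontrivial unitary multiplier vanish. -/
lemma IsFloquet.eq_zero_of_entire {p : ℂ} {f : ℂ → ℂ} (hF : IsFloquet p f)
    (hf : Differentiable ℂ f) (hp : p ∉ dualLattice) (z : ℂ) : f z = 0 := by
  obtain ⟨C, hC⟩ := hF.bounded hf.continuous
  have hb : Bornology.IsBounded (Set.range f) :=
    isBounded_iff_forall_norm_le.2 ⟨C, by rintro _ ⟨z, rfl⟩; exact hC z⟩
  have hconst := fun z w => hf.apply_eq_apply_of_bounded hb z w
  by_contra h
  have key : ∀ γ ∈ lattice, ch p γ = 1 := by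
    intro γ hγ
    have h1 := hF γ hγ z
    rw [hconst (z + γ) z] at h1
    exact mul_right_cancel₀ h (by rw [← h1, one_mul])
  exact hp (mem_dualLattice_of_ch_eq_one (key _ one_mem_lattice) (key _ omega_mem_lattice))

/-- With coefficients `-i` and `1`, `dop` is `2 D_z̄`, so its vanishing is the Cauchy–Riemann
equation. -/
lemma differentiableAt_complex_of_dop {f : ℂ → ℂ} {z : ℂ} (hf : DifferentiableAt ℝ f z)
    (h : dop (-Complex.I) 1 f z = 0) : DifferentiableAt ℂ f z := by
  refine differentiableAt_complex_iff_differentiableAt_real.2 ⟨hf, ?_⟩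
  rw [dop] at h
  rw [smul_eq_mul]
  linear_combination h

lemma dop_of_differentiableAt_complex {f : ℂ → ℂ} {z : ℂ} (hf : DifferentiableAt ℂ f z) :
    dop (-Complex.I) 1 f z = 0 := by
  have h := (differentiableAt_complex_iff_differentiableAt_real.1 hf).2
  rw [dop, h, smul_eq_mul]
  ring

lemma dop_congr {a b : ℂ} {f g : ℂ → ℂ} {z : ℂ} (h : f =ᶠ[nhds z] g) :
    dop a b f z = dop a b g z := by rw [dop, dop, h.fderiv_eq]

/-- A classical nonzero solution of `D u = 0` in the sector `k`, where the potential has the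
Fourier coefficients `c`. -/
structure IsKernelState (K : ℂ) (c : ℤ × ℤ → ℂ) (k : ℂ) (u : Fin 2 → ℂ → ℂ) : Prop where
  diff : ∀ j, Differentiable ℝ (u j)
  floquet : ∀ j, IsFloquet (shiftK K k j) (u j)
  eq : ∀ j z, dop (-Complex.I) 1 (u j) z + pser K c j z * u (j + 1) z = 0
  ne : ∃ j z, u j z ≠ 0

/-! ### The Wronskian argument: kernel states off the conic points have zeros. -/

section Wronskian

variable {K k : ℂ} {c : ℤ × ℤ → ℂ} {u v : Fin 2 → ℂ → ℂ}

/-- In `D_z̄ (u₀ v₁ - u₁ v₀)` the potential terms cancel, as the potential matrix has zero trace.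
The Wronskian is thus entire, and its quasimomentum `(k - K) + 2K = k + K` is not in `Λ*`. -/
lemma IsKernelState.wronskian (hu : IsKernelState K c k u) (hv : IsKernelState K c K v)
    (hk : k + K ∉ dualLattice) (z : ℂ) : u 0 z * v 1 z = u 1 z * v 0 z := by
  have hF : IsFloquet (k + K) fun z => u 0 z * v 1 z + (-1) * (u 1 z * v 0 z) := by
    refine IsFloquet.add ?_ (IsFloquet.const_mul _ ?_)
    · have := (hu.floquet 0).mul (hv.floquet 1)
      simp only [shiftK, if_true, one_ne_zero, if_false] at this
      rwa [show k - K + (K + K) = k + K by ring] at this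
    · have := (hu.floquet 1).mul (hv.floquet 0)
      simp only [shiftK, if_true, one_ne_zero, if_false] at this
      rwa [show k + K + (K - K) = k + K by ring] at this
  have hd : Differentiable ℂ fun z => u 0 z * v 1 z + (-1) * (u 1 z * v 0 z) := by
    intro z
    have d1 : DifferentiableAt ℝ (fun z => u 0 z * v 1 z) z := (hu.diff 0 z).mul (hv.diff 1 z)
    have d2 : DifferentiableAt ℝ (fun z => u 1 z * v 0 z) z := (hu.diff 1 z).mul (hv.diff 0 z)
    have e1 := dop_mul (-Complex.I) 1 (hu.diff 0 z) (hv.diff 1 z)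
    have e2 := dop_mul (-Complex.I) 1 (hu.diff 1 z) (hv.diff 0 z)
    refine differentiableAt_complex_of_dop (d1.add (d2.const_mul _)) ?_
    have h3 : dop (-Complex.I) 1 (fun z => u 0 z * v 1 z + (-1) * (u 1 z * v 0 z)) z =
        dop (-Complex.I) 1 (fun z => u 0 z * v 1 z) z -
          dop (-Complex.I) 1 (fun z => u 1 z * v 0 z) z := by
      have := (d1.hasFDerivAt.add (d2.hasFDerivAt.const_mul (-1))).fderiv
      have h4 : fderiv ℝ (fun z => u 0 z * v 1 z + (-1) * (u 1 z * v 0 z)) z = _ := this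
      rw [dop, h4, dop, dop]
      simp
      ring
    rw [h3, e1, e2]
    have a0 := hu.eq 0 z
    have a1 := hu.eq 1 z
    have b0 := hv.eq 0 z
    have b1 := hv.eq 1 z
    simp only [zero_add, show (1 : Fin 2) + 1 = 0 from rfl] at a0 a1 b0 b1
    linear_combination (v 1 z) * a0 - (v 0 z) * a1 - u 1 z * b0 + u 0 z * b1
  have := hF.eq_zero_of_entire hd hk z
  linear_combination this

/-- Kernel states outside the conic points have zeros. -/
lemma IsKernelState.exists_zero (hu : IsKernelState K c k u) (hv : IsKernelState K c K v)
    (h1 : k + K ∉ dualLattice) (h2 : K - k ∉ dualLattice) : ∃ z, ∀ j, u j z = 0 := by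
  by_contra! hne
  have hW := hu.wronskian hv h1
  -- The ratio `v / u` is formed from whichever component of `u` is nonzero; the vanishing Wronskian
  -- makes the choice irrelevant, so that `v = f u` in both components.
  set f : ℂ → ℂ := fun z => if u 0 z = 0 then v 1 z / u 1 z else v 0 z / u 0 z with hf
  have hfj : ∀ j z, u j z ≠ 0 → f z = v j z / u j z := by
    intro j z hz
    fin_cases j
    · exact if_neg hz
    · by_cases h0 : u 0 z = 0
      · exact if_pos h0
      · refine (if_neg h0).trans ?_
        change u 1 z ≠ 0 at hz
        change v 0 z / u 0 z = v 1 z / u 1 z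
        rw [div_eq_div_iff h0 hz]
        linear_combination -hW z
  have hvf : ∀ j z, v j z = f z * u j z := by
    intro j z
    by_cases hz : u j z = 0
    · obtain ⟨i, hi⟩ := hne z
      have hij : i = j + 1 := by
        have : i ≠ j := fun h => hi (h ▸ hz)
        fin_cases i <;> fin_cases j <;> simp_all
      have : u i z * v j z = 0 := by
        have := hW z
        subst hij
        fin_cases j
        · change u 1 z * v 0 z = 0
          change u 0 z = 0 at hz
          rw [← this, hz, zero_mul]
        · change u 0 z * v 1 z = 0
          change u 1 z = 0 at hz
          rw [this, hz, zero_mul]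
      rw [hz, mul_zero]
      exact (mul_eq_zero.1 this).resolve_left hi
    · rw [hfj j z hz, div_mul_cancel₀ _ hz]
  have hfF : IsFloquet (K - k) f := by
    intro γ hγ z
    obtain ⟨j, hj⟩ := hne z
    have hj' : u j (z + γ) ≠ 0 := by
      rw [hu.floquet j γ hγ]; exact mul_ne_zero (ch_ne_zero _ _) hj
    have e : shiftK K K j = (K - k) + shiftK K k j := by simp only [shiftK]; split_ifs <;> ring
    rw [hfj j z hj, hfj j _ hj', hu.floquet j γ hγ, hv.floquet j γ hγ, e, ch_add_left]
    have := ch_ne_zero (shiftK K k j) γ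
    field_simp
  have hfd : Differentiable ℂ f := by
    intro z
    obtain ⟨j, hj⟩ := hne z
    have hev : f =ᶠ[nhds z] fun w => v j w / u j w := by
      filter_upwards [(hu.diff j).continuous.continuousAt.eventually_ne hj] with w hw
      exact hfj j w hw
    have hinv : DifferentiableAt ℝ (fun w => (u j w)⁻¹) z :=
      (((differentiableAt_inv hj : DifferentiableAt ℂ _ _).restrictScalars ℝ).comp z (hu.diff j z) :)
    have hd : DifferentiableAt ℝ f z := by
      simp only [div_eq_mul_inv] at hev
      exact ((hv.diff j z).mul hinv).congr_of_eventuallyEq hev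
    refine differentiableAt_complex_of_dop hd ?_
    -- Applying `D` to `v = f u` leaves `(2 D_z̄ f) u_j = 0`, and `u_j z ≠ 0`; hence `f` is
    -- holomorphic.
    have e1 := dop_mul (-Complex.I) 1 hd (hu.diff j z)
    have e2 : (fun w => f w * u j w) = v j := by ext w; rw [hvf]
    rw [e2] at e1
    have e3 := hu.eq j z
    have e4 := hv.eq j z
    rw [hvf (j + 1)] at e4
    refine (mul_eq_zero.1 ?_).resolve_right hj
    linear_combination e4 - f z * e3 - e1
  obtain ⟨j, z, hz⟩ := hv.ne
  exact hz (by rw [hvf, hfF.eq_zero_of_entire hfd h2, zero_mul])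

end Wronskian

/-! ### Passing from one sector to all others through a zero. -/

section Multiply

variable {K k : ℂ} {c : ℤ × ℤ → ℂ} {u : Fin 2 → ℂ → ℂ}

/-- Multiplication of a Floquet function with a zero by a function with simple poles on the
translated lattice extends continuously. -/
lemma exists_continuous_mul {p q z₀ : ℂ} {F f : ℂ → ℂ} (hFF : IsFloquet p F)
    (hFd : ∀ z ∉ lattice, DifferentiableAt ℂ F z)
    (hFp : ∃ L, Filter.Tendsto (fun z => z * F z) (nhdsWithin 0 {0}ᶜ) (nhds L))
    (hfF : IsFloquet q f) (hfd : Differentiable ℝ f) (hf0 : f z₀ = 0)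
    (hf1 : dop (-Complex.I) 1 f z₀ = 0) :
    ∃ g : ℂ → ℂ, Continuous g ∧ IsFloquet (p + q) g ∧
      ∀ z, z - z₀ ∉ lattice → g z = F (z - z₀) * f z := by
  set A : Set ℂ := {z | z - z₀ ∉ lattice} with hA
  have hAd : Dense A := by
    have : A = ((fun w => w + z₀) '' lattice)ᶜ := by
      ext z
      simp only [hA, Set.mem_ofPred_eq, Set.mem_compl_iff, Set.mem_image, not_iff_not]
      exact ⟨fun h => ⟨z - z₀, h, by ring⟩, by rintro ⟨w, hw, rfl⟩; simpa using hw⟩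
    rw [this]
    exact (countable_lattice.image _).dense_compl ℝ
  have hAt : ∀ γ ∈ lattice, ∀ z, z + γ ∈ A ↔ z ∈ A := by
    have hadd : ∀ a ∈ lattice, ∀ b ∈ lattice, a + b ∈ lattice := by
      rintro _ ⟨m, n, rfl⟩ _ ⟨m', n', rfl⟩
      exact ⟨m + m', n + n', by push_cast; ring⟩
    have hneg : ∀ a ∈ lattice, -a ∈ lattice := by
      rintro _ ⟨m, n, rfl⟩
      exact ⟨-m, -n, by push_cast; ring⟩
    intro γ hγ z
    simp only [hA, Set.mem_ofPred_eq, not_iff_not]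
    constructor
    · intro h
      have := hadd _ h _ (hneg _ hγ)
      rwa [show z + γ - z₀ + -γ = z - z₀ by ring] at this
    · intro h
      have := hadd _ h _ hγ
      rwa [show z - z₀ + γ = z + γ - z₀ by ring] at this
  set h : ℂ → ℂ := fun z => F (z - z₀) * f z with hh
  have hhF : IsFloquet (p + q) h := by
    intro γ hγ z
    simp only [hh]
    rw [add_sub_right_comm, hFF γ hγ, hfF γ hγ, ch_add_left]; ring
  have hcont : ∀ z ∈ A, ContinuousAt h z := by
    intro z hz
    have h1 : ContinuousAt (fun z => F (z - z₀)) z :=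
      ContinuousAt.comp (f := fun z => z - z₀) (hFd _ hz).continuousAt (by fun_prop)
    exact h1.mul (hfd z).continuousAt
  have hlim0 : ∃ y, Filter.Tendsto h (nhdsWithin z₀ A) (nhds y) := by
    obtain ⟨L, hL⟩ := hFp
    -- At `z₀` the function `f` is complex differentiable, so `f z / (z - z₀)` has a limit. Real
    -- differentiability alone would give only boundedness, not a continuous extension of the
    -- product with `F`.
    have hfc := (differentiableAt_complex_of_dop (hfd z₀) hf1).hasDerivAt.tendsto_slope
    have hsub : Filter.Tendsto (fun z => z - z₀) (nhdsWithin z₀ {z₀}ᶜ) (nhdsWithin 0 {0}ᶜ) := by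
      refine tendsto_nhdsWithin_iff.2 ⟨?_, ?_⟩
      · have : Filter.Tendsto (fun z => z - z₀) (nhds z₀) (nhds (z₀ - z₀)) :=
          (continuous_id.sub continuous_const).tendsto z₀
        rw [sub_self] at this
        exact this.mono_left nhdsWithin_le_nhds
      · filter_upwards [self_mem_nhdsWithin] with z hz
        exact sub_ne_zero.2 hz
    have h3 := (hL.comp hsub).mul hfc
    refine ⟨_, (h3.congr' ?_).mono_left (nhdsWithin_mono _ ?_)⟩
    · filter_upwards [self_mem_nhdsWithin] with z hz
      have hz' : z - z₀ ≠ 0 := sub_ne_zero.2 hz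
      simp only [Function.comp, slope, vsub_eq_sub, smul_eq_mul, hf0, sub_zero, hh]
      field_simp
    · intro z hz hz0
      rw [Set.mem_singleton_iff] at hz0
      refine hz ?_
      rw [hz0, sub_self]
      exact ⟨0, 0, by simp⟩
  have hlim : ∀ z, ∃ y, Filter.Tendsto h (nhdsWithin z A) (nhds y) := by
    intro z
    by_cases hz : z ∈ A
    · exact ⟨_, (hcont z hz).tendsto.mono_left nhdsWithin_le_nhds⟩
    · obtain ⟨y, hy⟩ := hlim0
      have hz' : z - z₀ ∈ lattice := not_not.1 hz
      set γ := z - z₀ with hγ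
      have hsub : Filter.Tendsto (fun w => w - γ) (nhdsWithin z A) (nhdsWithin z₀ A) := by
        refine tendsto_nhdsWithin_iff.2 ⟨?_, ?_⟩
        · have : Filter.Tendsto (fun w => w - γ) (nhds z) (nhds (z - γ)) :=
            (continuous_id.sub continuous_const).tendsto z
          rw [show z - γ = z₀ by rw [hγ]; ring] at this
          exact this.mono_left nhdsWithin_le_nhds
        · filter_upwards [self_mem_nhdsWithin] with w hw
          rw [← hAt γ hz']
          simpa using hw
      refine ⟨_, ((hy.comp hsub).const_mul (ch (p + q) γ)).congr fun w => ?_⟩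
      have := hhF γ hz' (w - γ)
      rw [sub_add_cancel] at this
      exact this.symm
  -- Limits along the dense set `A` exist at every point, at the other poles by translating the
  -- limit at `z₀` with the Floquet relation.
  have hgc := continuous_extendFrom hAd hlim
  have hge : ∀ z ∈ A, extendFrom A h z = h z := fun z hz =>
    extendFrom_extends (fun z hz => (hcont z hz).continuousWithinAt) z hz
  refine ⟨extendFrom A h, hgc, fun γ hγ => ?_, hge⟩
  refine congrFun (Continuous.ext_on hAd (hgc.comp (continuous_id.add continuous_const))
    (continuous_const.mul hgc) fun z hz => ?_)
  rw [hge z hz, hge _ ((hAt γ hγ z).2 hz), hhF γ hγ]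

/-- The theta function argument: a kernel state with a zero produces elements of the kernel in
all sectors. -/
lemma IsKernelState.exists_kernel (hc : Summable fun m => ‖c m‖) (hu : IsKernelState K c k u)
    {z₀ : ℂ} (h0 : ∀ j, u j z₀ = 0) (k' : ℂ) :
    ∃ x : Ell2 Idx, x ≠ 0 ∧
      ∀ i, lam K k' i * x i + ∑' m, c m * x (shiftIdx m i) = 0 := by
  obtain ⟨F, hFF, hFd, hFp, hF0⟩ := exists_meromorphic_multiplier (k' - k)
  -- Both components of `u` vanish at `z₀`, so the equation itself gives `D_z̄ u = 0` there.
  have hg := fun j => exists_continuous_mul hFF hFd hFp (hu.floquet j) (hu.diff j) (h0 j)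
    (by simpa [h0] using hu.eq j z₀)
  choose g hgc hgF hge using hg
  have hsh : ∀ j, k' - k + shiftK K k j = shiftK K k' j := by
    intro j; simp only [shiftK]; split_ifs <;> ring
  simp only [hsh] at hgF
  set s : Set ℂ := (fun w => w + z₀) '' lattice with hs
  have hsc : s.Countable := countable_lattice.image _
  have hsm : ∀ z, z ∉ s → z - z₀ ∉ lattice := fun z hz h => hz ⟨z - z₀, h, by ring⟩
  have hev : ∀ j z, z ∉ s → g j =ᶠ[nhds z] fun w => F (w - z₀) * u j w := by
    intro j z hz
    have ho : IsOpen {w | w - z₀ ∉ lattice} :=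
      (isClosed_lattice.isOpen_compl).preimage (continuous_id.sub continuous_const)
    filter_upwards [ho.mem_nhds (hsm z hz)] with w hw
    exact hge j w hw
  have hFd' : ∀ z ∉ s, DifferentiableAt ℂ (fun w => F (w - z₀)) z := fun z hz =>
    DifferentiableAt.comp (g := F) z (hFd _ (hsm z hz)) (by fun_prop)
  -- Off the poles the factor is holomorphic and commutes with `D`. The exceptional set is countable
  -- and the product continuous, so the poles leave no trace in the coefficient identity.
  have hsol := coefVec_of_off_countable (K := K) (k := k') (a := -Complex.I) (b := 1) hc hgc hgF
    hsc (fun j z hz => ((hFd' z hz).restrictScalars ℝ |>.mul (hu.diff j z)).congr_of_eventuallyEq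
      (hev j z hz)) (fun j z hz => by
      rw [dop_congr (hev j z hz), dop_mul _ _ ((hFd' z hz).restrictScalars ℝ) (hu.diff j z),
        dop_of_differentiableAt_complex (hFd' z hz), hge _ z (hsm z hz)]
      linear_combination F (z - z₀) * hu.eq j z)
  refine ⟨⟨coefVec K k' g, memℓp_coefVec fun j => Continuous.memL2loc (hgc j)⟩, fun hx => ?_,
    fun i => ?_⟩
  · have hx0 : coefVec K k' g = 0 := congrArg Subtype.val hx
    obtain ⟨j, z, hz⟩ := hu.ne
    have hg0 : ∀ z, g j z = 0 :=
      (hgF j).eq_zero_of_coef (hgc j) fun n => congrFun hx0 (n, j)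
    -- If the product vanished, `u j` would vanish off the countable set of poles and zeros of the
    -- factor, hence everywhere by continuity.
    have hcount : (s ∪ (fun w => w + z₀) '' {z | F z = 0}).Countable :=
      hsc.union (hF0.image _)
    have : u j = fun _ => 0 := by
      refine Continuous.ext_on (hcount.dense_compl ℝ) (hu.diff j).continuous continuous_const ?_
      intro w hw
      rw [Set.mem_compl_iff, Set.mem_union, not_or] at hw
      have h1 := hge j w (hsm w hw.1)
      rw [hg0] at h1
      exact (mul_eq_zero.1 h1.symm).resolve_left fun h => hw.2 ⟨w - z₀, h, by ring⟩
    exact hz (congrFun this z)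
  · have := hsol i
    rw [sym_dbar] at this
    exact this

end Multiply

/-! ### Conjugation symmetry and the conclusion. -/

section Main

variable {K : ℂ} {U : ℂ → ℂ} {α k : ℂ}

lemma exists_kernelState (hU : IsChiralPotential K U) (hK : IsDiracPoint K) {x : Ell2 Idx}
    (hx : x ≠ 0) (h : ∀ i, lam K k i * x i + potOp K U α x i = 0) :
    ∃ u, IsKernelState K (potSeq K U α) k u := by
  have hs := summable_potSeq hU hK α
  have hd : ∀ j, RapidDecay fun n => x (n, j) := fun j =>
    (rapidDecay_of_mode hU hK (E := 0) (y := 0) (by simpa using h) (by simp) j).1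
  refine ⟨serVec K k x, fun j => differentiable_ser (hd j) _, fun j => isFloquet_ser _ _,
    fun j z => ?_, ?_⟩
  · simpa using serVec_solves (k := k) (E := 0) (a := -Complex.I) (b := 1) hs hd hd
      (fun i => by rw [sym_dbar, ← potOp_apply hU hK, zero_mul]; exact h i) j z
  · by_contra! h0
    refine hx ?_
    ext i
    have h1 : serVec K k x = fun _ _ => 0 := by ext j z; exact h0 j z
    have h2 := congrFun (coefVec_serVec (K := K) (k := k) hd) i
    rw [h1] at h2
    simpa [coefVec, coef] using h2.symm

/-- Chiral conjugation maps the kernel of the adjoint in the sector `k` to the kernel in the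
sector `-k`. -/
lemma exists_kernel_neg (hU : IsChiralPotential K U) (hK : IsDiracPoint K) {y : Ell2 Idx}
    (hy : y ≠ 0)
    (h : ∀ i, conj (lam K k i) * y i + ContinuousLinearMap.adjoint (potOp K U α) y i = 0) :
    ∃ x : Ell2 Idx, x ≠ 0 ∧ ∀ i, lam K (-k) i * x i + potOp K U α x i = 0 := by
  let σ : Equiv.Perm Idx := Function.Involutive.toPerm (fun i => (-i.1, i.2 + 1)) (by
    rintro ⟨n, j⟩; fin_cases j <;> simp)
  have hσ : ∀ n j, σ (n, j) = (-n, j + 1) := fun n j => rfl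
  -- Conjugation turns `2 D_z` into `-2 D_z̄`. Swapping the two components and changing the sign of
  -- one of them restores the relative sign to the potential: `x = (ȳ₁, -ȳ₀)`.
  let sg : Fin 2 → ℂ := fun j => if j = 0 then 1 else -1
  have hsg : ∀ j, ‖sg j‖ = 1 := by intro j; fin_cases j <;> simp [sg]
  have hmem : Memℓp (fun i : Idx => sg i.2 * conj (y (σ i))) 2 := by
    rw [ell2_memℓp_iff]
    have := (ell2_memℓp_iff _).1 y.2
    refine (σ.summable_iff.2 this).congr fun i => ?_
    simp [hsg]
  refine ⟨⟨_, hmem⟩, fun h0 => hy ?_, ?_⟩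
  · ext i
    have h1 := congrFun (congrArg Subtype.val h0) (σ.symm i)
    change sg (σ.symm i).2 * conj (y (σ (σ.symm i))) = 0 at h1
    have h2 : sg (σ.symm i).2 ≠ 0 := by rw [← norm_ne_zero_iff, hsg]; exact one_ne_zero
    have h3 := (mul_eq_zero.1 h1).resolve_left h2
    rw [Equiv.apply_symm_apply] at h3
    exact (map_eq_zero _).1 h3
  · rintro ⟨n, j⟩
    rw [potOp_apply hU hK]
    have h1 := congrArg conj (h (σ (n, j)))
    rw [adjoint_potOp_apply hU hK, map_add, map_mul, Complex.conj_conj, Complex.conj_tsum] at h1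
    simp only [map_mul, Complex.conj_conj, map_zero, hσ, shiftIdx_apply] at h1
    change lam K (-k) (n, j) * (sg j * conj (y (σ (n, j)))) +
      ∑' m, potSeq K U α m * (sg (shiftIdx m (n, j)).2 * conj (y (σ (shiftIdx m (n, j))))) = 0
    simp only [hσ, shiftIdx_apply]
    fin_cases j
    · have e : lam K (-k) (n, 0) = -lam K k (-n, 1) := by
        simp [lam, shiftK, freq_neg]; ring
      simp only [Fin.zero_eta, zero_add, one_ne_zero, if_false, if_true, sg, e, neg_sub,
        show (1 : Fin 2) + 1 = 0 from rfl, neg_mul, one_mul, mul_neg, tsum_neg] at h1 ⊢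
      simp only [← sub_eq_neg_add] at h1
      linear_combination -h1
    · have e : lam K (-k) (n, 1) = -lam K k (-n, 0) := by
        simp [lam, shiftK, freq_neg]; ring
      simp only [Fin.mk_one, zero_add, one_ne_zero, if_false, if_true, sg, e, neg_add,
        show (1 : Fin 2) + 1 = 0 from rfl, neg_mul, one_mul, mul_neg] at h1 ⊢
      simp only [← sub_eq_add_neg, neg_neg] at h1 ⊢
      linear_combination h1

lemma flat_of_kernel (hU : IsChiralPotential K U) (hK : IsDiracPoint K)
    (h1 : k + K ∉ dualLattice) (h2 : K - k ∉ dualLattice) {x : Ell2 Idx} (hx : x ≠ 0)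
    (h : ∀ i, lam K k i * x i + potOp K U α x i = 0) (k' : ℂ) :
    IsModeEigenvalue (lam K k') (potOp K U α) 0 := by
  obtain ⟨u, hu⟩ := exists_kernelState hU hK hx h
  obtain ⟨w, hw, hw'⟩ := exists_kernel_at_K hU hK α
  obtain ⟨v, hv⟩ := exists_kernelState hU hK hw hw'
  obtain ⟨z₀, hz₀⟩ := hu.exists_zero hv h1 h2
  obtain ⟨x', hx', he⟩ := hu.exists_kernel (summable_potSeq hU hK α) hz₀ k'
  refine ⟨x', 0, Or.inl hx', fun i => ?_, fun i => by simp⟩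
  rw [potOp_apply hU hK, he i]
  simp

/-- At `E = 0` the two blocks decouple, so one of them has a nonzero kernel element. The kernel of
the adjoint block is moved to the sector `-k`, which also avoids `{-K, K} + Λ*`. -/
lemma flat_of_mode (hU : IsChiralPotential K U) (hK : IsDiracPoint K)
    (hk : k ∉ ({-K, K} : Set ℂ) + dualLattice) (h : IsModeEigenvalue (lam K k) (potOp K U α) 0)
    (k' : ℂ) : IsModeEigenvalue (lam K k') (potOp K U α) 0 := by
  have h1 : k + K ∉ dualLattice := fun hm =>
    hk (Set.mem_add.2 ⟨-K, by simp, k + K, hm, by ring⟩)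
  have h2 : k - K ∉ dualLattice := fun hm =>
    hk (Set.mem_add.2 ⟨K, by simp, k - K, hm, by ring⟩)
  have h1' : K - -k ∉ dualLattice := fun hm => h1 (by convert hm using 1; ring)
  have h2' : K - k ∉ dualLattice := fun hm => h2 (by convert dualLattice_neg hm using 1; ring)
  have h3' : -k + K ∉ dualLattice := fun hm => h2' (by convert hm using 1; ring)
  obtain ⟨x, y, hne, hx, hy⟩ := h
  simp only [Complex.ofReal_zero, zero_mul] at hx hy
  rcases hne with hne | hne
  · exact flat_of_kernel hU hK h1 h2' hne hx k'
  · obtain ⟨x', hx', he⟩ := exists_kernel_neg hU hK hne hy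
    exact flat_of_kernel hU hK h3' h1' hx' he k'

/-- This supplies the witness `k = 0` for the implication from a flat band to a zero off the conic
points. -/
lemma IsDiracPoint.zero_notMem (hK : IsDiracPoint K) : (0 : ℂ) ∉ ({-K, K} : Set ℂ) + dualLattice := by
  intro h
  obtain ⟨a, ha, b, hb, hab⟩ := Set.mem_add.1 h
  rcases ha with rfl | ha
  · exact hK.ne_zero (by convert hb using 1; linear_combination -hab)
  · rw [Set.mem_singleton_iff] at ha
    subst ha
    exact hK.ne_zero (by convert dualLattice_neg hb using 1; linear_combination hab)

end Main

end ChiralTBG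

end

theorem theorem1 (K : ℂ) (hK : ChiralTBG.IsDiracPoint K)
    (U : ℂ → ℂ) (hU : ChiralTBG.IsChiralPotential K U) (α : ℂ) :
    (∀ k : ℂ, IsLeast {E : ℝ | 0 ≤ E ∧ ChiralTBG.IsBlochEigenvalue K U α k E}
      (ChiralTBG.E₁ K U α k)) ∧
    ((∃ k : ℂ, k ∉ ({-K, K} : Set ℂ) + ChiralTBG.dualLattice ∧ ChiralTBG.E₁ K U α k = 0) ↔
      ∀ k : ℂ, ChiralTBG.E₁ K U α k = 0) := by
  refine ⟨ChiralTBG.isLeast_E₁ hU hK α, ?_, fun h => ⟨0, hK.zero_notMem, h 0⟩⟩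
  rintro ⟨k, hk, h⟩ k'
  rw [ChiralTBG.E₁_eq_zero_iff hU hK] at h ⊢
  exact ChiralTBG.flat_of_mode hU hK hk h k'
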